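/- Let $S$ be a countable set, $p\in\,]0,1[$, $\beta_p=(1-p)\delta_0+p\delta_1$, $\lambda_p^S=\beta_p^{\otimes S}$ on $\{0,1\}^S$, and let $\gamma$ be the standard Gaussian measure on $\mathbb R$, with density $g(x)=\frac1{\sqrt{2\pi}}e^{-x^2/2}$ and distribution function $G$. Let $c_{LS}(p)=\frac{\log p-\log(1-p)}{p-(1-p)}$ for $p\neq 1/2$ and $c_{LS}(1/2)=2$. Let $H_1^2(\lambda_p^S\otimes\gamma^{\mathbb N})$ be the set of $F\in L^2(\lambda_p^S\otimes\gamma^{\mathbb N})$ such that for every $i\in\mathbb N$ there is $F_i\in L^2(\lambda_p^S\otimes\gamma^{\mathbb N})$ which, almost surely with all the other coordinates fixed, is the weak derivative of $F$ on $\mathbb R$ as a function of the coordinate $y_i$ (in particular both are locally integrable there). Let $\nu$ be a probability measure on $\mathbb R_+$, absolutely continuous with density $h\ge 0$ and distribution function $H(t)=\int_0^t h(u)\,du$; let $H^{-1}(t)=\inf\{x: t\le H(x)\}$ for $0<t<1$, and $$\psi(t)=\frac{g\big(G^{-1}(H(t))\big)}{h(t)}\qquad (t\ge 0,\ h(t)>0),$$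 which is defined $\nu$-almost everywhere. Equip $\{0,1\}^S\times\mathbb R^{\mathbb N}$ with $\mu=\lambda_p^S\otimes\nu^{\otimes\mathbb N}$; $\mathbb E$, $\mathsf{Var}$ and $\|\cdot\|_1$ refer to $\mu$. For a coordinate $j\in S\cup\mathbb N$ let $\Delta_j f$ be $f$ minus its integral over the coordinate $j$ (with respect to $\beta_p$ if $j\in S$, to $\nu$ if $j\in\mathbb N$). A measurable function $D$ is called a partial derivative $\partial f/\partial y_i$ of $f$ (with respect to $\mu$) if, for $\mu$-almost all values of the other coordinates, there are functions $u,v$ on the interval $\{0<H<1\}$ such that $v$ is the weak derivative of $u$ there and, as functions of $y_i$, $f=u$ and $D=v$ hold $\nu$-almost everywhere. (If $h>0$ almost everywhere on this interval, this is the usual weak partial derivative there.) Let $f:\{0,1\}^S\times\mathbb R^{\mathbb N}\to\mathbb R$ be such that the function $(x,z)\mapsto f\big(x,(H^{-1}(G(z_i)))_{i\in\mathbb N}\big)$ belongs to $H_1^2(\lambda_p^S\otimes\gamma^{\mathbb N})$. Then $f\in L^2(\mu)$, for every $i\in\mathbb N$ the partial derivative $\partial f/\partial y_i$ exists, and for every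 choice of these partial derivatives the functions $$\nabla_i f(x,y)=\psi(y_i)\,\frac{\partial f}{\partial y_i}(x,y)$$ are in $L^2(\mu)$ and $$\mathsf{Var}(f)\,\log\frac{\mathsf{Var}(f)}{\sum_{s\in S}\|\Delta_s f\|_1^2+\sum_{i\in\mathbb N}\|\Delta_i f\|_1^2}\;\le\; c_{LS}(p)\sum_{s\in S}\mathbb E\big((\Delta_s f)^2\big)+2\sum_{i\in\mathbb N}\mathbb E\big((\nabla_i f)^2\big).$$ Here the sums take values in $[0,\infty]$, and the left side is in $[-\infty,\infty]$, equal to $0$ if $\mathsf{Var}(f)=0$, to $-\infty$ if $\mathsf{Var}(f)>0$ and the sum in the denominator is infinite, and to $+\infty$ if $\mathsf{Var}(f)>0$ and that sum is $0$. -/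

import Mathlib

open MeasureTheory ProbabilityTheory
open scoped ENNReal

noncomputable section

namespace ModifiedPoincare

/-- The (left-continuous) inverse `t ↦ inf {x | t ≤ F x}` of a distribution function `F`. On `(0,1)`
it is the usual inverse whenever `F` is continuous and strictly increasing on `{0 < F < 1}`. -/
def genInv (F : ℝ → ℝ) (t : ℝ) : ℝ := sInf {x : ℝ | t ≤ F x}

/-- The density of the standard Gaussian distribution. -/
def gaussDensity (x : ℝ) : ℝ := (Real.sqrt (2 * Real.pi))⁻¹ * Real.exp (-x ^ 2 / 2)

/-- The distribution function of the standard Gaussian distribution. -/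
def gaussCDF (x : ℝ) : ℝ := ∫ u in Set.Iic x, gaussDensity u

/-- The distribution function `H(t) = ∫₀ᵗ h` of the density `h` on the half line. -/
def cdfOf (h : ℝ → ℝ) (t : ℝ) : ℝ := ∫ u in (0 : ℝ)..t, h u

/-- The map `H⁻¹ ∘ G`, acting on one coordinate. -/
def transport (h : ℝ → ℝ) (z : ℝ) : ℝ := genInv (cdfOf h) (gaussCDF z)

/-- The weight `ψ(t) = g(G⁻¹(H(t))) / h(t)`. -/
def weight (h : ℝ → ℝ) (t : ℝ) : ℝ := gaussDensity (genInv gaussCDF (cdfOf h t)) / h t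

/-- The logarithmic Sobolev constant of the Bernoulli law with parameter `p`
(extended by continuity at `p = 1/2`). -/
def cLS (p : ℝ) : ℝ :=
  if p = 1 / 2 then 2 else (Real.log p - Real.log (1 - p)) / (p - (1 - p))

/-- The law on `{0,1}^S` (with `true` for `1`) of independent Bernoulli variables of
parameter `p`. -/
def bernoulliPi (S : Type*) (p : unitInterval) : Measure (S → Bool) :=
  Measure.infinitePi (fun _ : S => bernoulliMeasure true false p)

/-- The measure `λ_p^S ⊗ ν^ℕ` on `{0,1}^S × ℝ^ℕ`. -/
def mixedProduct (S : Type*) (p : unitInterval) (ν : Measure ℝ) :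
    Measure ((S → Bool) × (ℕ → ℝ)) :=
  (bernoulliPi S p).prod (Measure.infinitePi (fun _ : ℕ => ν))

/-- The function of the real variable `t` obtained from `f` by putting `t` in the `i`-th real
coordinate and keeping all the other coordinates of `ω` fixed. -/
def realSlice {S : Type*} (f : (S → Bool) × (ℕ → ℝ) → ℝ) (i : ℕ) (ω : (S → Bool) × (ℕ → ℝ)) :
    ℝ → ℝ :=
  fun t => f (ω.1, Function.update ω.2 i t)

/-- `Δ_s f = f - ∫ f dβ_p(x_s)`. -/
def deltaBit {S : Type*} [DecidableEq S] (p : unitInterval) (f : (S → Bool) × (ℕ → ℝ) → ℝ)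
    (s : S) (ω : (S → Bool) × (ℕ → ℝ)) : ℝ :=
  f ω - ∫ b, f (Function.update ω.1 s b, ω.2) ∂(bernoulliMeasure true false p)

/-- `Δ_i f = f - ∫ f dν(y_i)`. -/
def deltaReal {S : Type*} (ν : Measure ℝ) (f : (S → Bool) × (ℕ → ℝ) → ℝ)
    (i : ℕ) (ω : (S → Bool) × (ℕ → ℝ)) : ℝ :=
  f ω - ∫ t, realSlice f i ω t ∂ν

/-- `v` is the weak derivative of `u` on the open set `U ⊆ ℝ`. -/
def HasWeakDerivOn (U : Set ℝ) (u v : ℝ → ℝ) : Prop :=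
  LocallyIntegrableOn u U ∧ LocallyIntegrableOn v U ∧
    ∀ φ : ℝ → ℝ, ContDiff ℝ ((⊤ : ℕ∞) : WithTop ℕ∞) φ → HasCompactSupport φ → tsupport φ ⊆ U →
      ∫ t, v t * φ t = -∫ t, deriv φ t * u t

/-- The weighted Sobolev space `H_1^2(λ_p^S ⊗ γ^ℕ)`: square integrable functions which have, in
each real coordinate, a square integrable partial weak derivative. -/
def MemGaussSobolev {S : Type*} (p : unitInterval) (F : (S → Bool) × (ℕ → ℝ) → ℝ) : Prop :=
  MemLp F 2 (mixedProduct S p (gaussianReal 0 1)) ∧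
    ∀ i : ℕ, ∃ D : (S → Bool) × (ℕ → ℝ) → ℝ,
      MemLp D 2 (mixedProduct S p (gaussianReal 0 1)) ∧
      ∀ᵐ ω ∂(mixedProduct S p (gaussianReal 0 1)),
        HasWeakDerivOn Set.univ (realSlice F i ω) (realSlice D i ω)

/-- `D` is the partial derivative `∂f/∂y_i` with respect to the measure `λ_p^S ⊗ ν^ℕ`, where `ν` is
the law with density `h`. For almost all values of the other coordinates, the slice of `f` is
weakly differentiable on the open interval `{0 < H < 1}` with the slice of `D` as its derivative,
up to modification on a `ν`-null set (as `f` and `D` matter only up to null sets; a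
Lebesgue-null modification does not affect weak derivatives, so this only matters on `{h = 0}`). -/
def IsPartialDeriv {S : Type*} (p : unitInterval) (ν : Measure ℝ) (h : ℝ → ℝ)
    (f : (S → Bool) × (ℕ → ℝ) → ℝ) (i : ℕ) (D : (S → Bool) × (ℕ → ℝ) → ℝ) : Prop :=
  AEStronglyMeasurable D (mixedProduct S p ν) ∧
    ∀ᵐ ω ∂(mixedProduct S p ν), ∃ u v : ℝ → ℝ,
      HasWeakDerivOn {t : ℝ | 0 < cdfOf h t ∧ cdfOf h t < 1} u v ∧
      realSlice f i ω =ᵐ[ν] u ∧ realSlice D i ω =ᵐ[ν] v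

/-- `∇_i f (x,y) = ψ(y_i) ∂f/∂y_i (x,y)`, where `D i` is the function `∂f/∂y_i`. -/
def weightedGrad {S : Type*} (h : ℝ → ℝ) (D : ℕ → (S → Bool) × (ℕ → ℝ) → ℝ) (i : ℕ)
    (ω : (S → Bool) × (ℕ → ℝ)) : ℝ :=
  weight h (ω.2 i) * D i ω

/-- The sum `∑_s ‖Δ_s f‖₁² + ∑_i ‖Δ_i f‖₁²`, in `[0,∞]`. -/
def sumInfluences {S : Type*} [DecidableEq S] (p : unitInterval) (ν : Measure ℝ)
    (f : (S → Bool) × (ℕ → ℝ) → ℝ) : ℝ≥0∞ :=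
  ∑' s : S, (∫⁻ ω, ‖deltaBit p f s ω‖ₑ ∂(mixedProduct S p ν)) ^ 2 +
    ∑' i : ℕ, (∫⁻ ω, ‖deltaReal ν f i ω‖ₑ ∂(mixedProduct S p ν)) ^ 2

/-- The energy `c_LS(p) ∑_s E((Δ_s f)²) + 2 ∑_i E((∇_i f)²)`, in `[0,∞]`. -/
def energy {S : Type*} [DecidableEq S] (p : unitInterval) (ν : Measure ℝ) (h : ℝ → ℝ)
    (f : (S → Bool) × (ℕ → ℝ) → ℝ) (D : ℕ → (S → Bool) × (ℕ → ℝ) → ℝ) : ℝ≥0∞ :=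
  ENNReal.ofReal (cLS p) * ∑' s : S, ∫⁻ ω, ‖deltaBit p f s ω‖ₑ ^ 2 ∂(mixedProduct S p ν) +
    2 * ∑' i : ℕ, ∫⁻ ω, ‖weightedGrad h D i ω‖ₑ ^ 2 ∂(mixedProduct S p ν)

end ModifiedPoincare

end

open ModifiedPoincare

/-!
The function is decomposed into martingale increments `V k`, obtained by revealing the coordinates
one after the other. The tensorised logarithmic Sobolev inequality, applied to each `V k`, bounds
the sum of the entropies of the `V k ^ 2` by the energy of `f`. On the other hand the entropy of
`V ^ 2` is at least `‖V‖₂ ^ 2 * log (‖V‖₂ ^ 2 / ‖V‖₁ ^ 2)`, while `‖V k‖₁` is at most the `L¹`-norm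
of the `k`-th difference `Δ f`; summing these lower bounds with the log-sum inequality yields the
logarithmic factor. For the coins the logarithmic Sobolev inequality holds with the sharp two-point
constant, and for the Gaussian coordinates it follows from the fair coins by the central limit
theorem. Finally the map `H⁻¹ ∘ G` carries the Gaussian measure to `ν`, and the chain rule turns
the Gaussian derivative into `ψ ∂f/∂y`.
-/

namespace ModifiedPoincare

open Filter Topology

local notation "γ" => gaussianReal 0 1

section BoundedEntropy

variable {Ω : Type*} {mΩ : MeasurableSpace Ω} {μ : Measure Ω} {m M : ℝ}

lemma sq_mem_Icc_sq {x : ℝ} (hm : 0 < m) (hx : x ∈ Set.Icc m M) :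
    x ^ 2 ∈ Set.Icc (m ^ 2) (M ^ 2) :=
  ⟨pow_le_pow_left₀ hm.le hx.1 2, pow_le_pow_left₀ (hm.le.trans hx.1) hx.2 2⟩

lemma abs_log_le_max_of_mem_Icc {x : ℝ} (hm : 0 < m) (hx : x ∈ Set.Icc m M) :
    |Real.log x| ≤ max |Real.log m| |Real.log M| :=
  abs_le_max_abs_abs (Real.log_le_log hm hx.1) (Real.log_le_log (hm.trans_le hx.1) hx.2)

lemma integrable_mul_log_of_mem_Icc {F X : Ω → ℝ} (hF : Integrable F μ) (hX : Measurable X)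
    (hm : 0 < m) (hb : ∀ ω, X ω ∈ Set.Icc m M) :
    Integrable (fun ω => F ω * Real.log (X ω)) μ :=
  hF.mul_bdd hX.log.aestronglyMeasurable
    (.of_forall fun ω => abs_log_le_max_of_mem_Icc hm (hb ω))

lemma integral_pos_of_forall_pos [NeZero μ] {f : Ω → ℝ} (hf : Integrable f μ)
    (hpos : ∀ ω, 0 < f ω) : 0 < ∫ ω, f ω ∂μ := by
  rw [integral_pos_iff_support_of_nonneg (fun ω => (hpos ω).le) hf,
    Function.support_eq_univ fun ω => (hpos ω).ne']
  exact NeZero.pos _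

/-- The entropy `E[F log F] - E[F] log E[F]` of a nonnegative function. -/
noncomputable def entropy (F : Ω → ℝ) (μ : Measure Ω) : ℝ :=
  ∫ ω, F ω * Real.log (F ω) ∂μ - (∫ ω, F ω ∂μ) * Real.log (∫ ω, F ω ∂μ)

lemma two_mul_log_add_two_mul_sq_sub_le {c x : ℝ} (hc : 0 < c) (hx : 0 < x) :
    (2 * Real.log c + 2) * x ^ 2 - 2 * c * x ≤ x ^ 2 * Real.log (x ^ 2) := by
  have hlog : Real.log c - Real.log x ≤ c / x - 1 := by
    simpa [Real.log_div hc.ne' hx.ne'] using Real.log_le_sub_one_of_pos (div_pos hc hx)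
  have hmul := mul_le_mul_of_nonneg_left hlog (sq_nonneg x)
  have hdiv : x ^ 2 * (c / x - 1) = c * x - x ^ 2 := by field_simp
  rw [Real.log_pow]
  push_cast
  linarith

/-- This is the entropy bound `a log (a / w²) ≤ Ent(W²)`, where `a = E[W²]` and `w = E[W]`, with
the logarithm replaced by its tangent lines, `l` being the slope parameter. -/
lemma log_add_one_mul_integral_sq_sub_le_entropy [IsProbabilityMeasure μ] {W : Ω → ℝ}
    (hW : Measurable W) (hm : 0 < m) (hb : ∀ ω, W ω ∈ Set.Icc m M) {l : ℝ} (hl : 0 < l) :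
    (Real.log l + 1) * ∫ ω, W ω ^ 2 ∂μ - l * (∫ ω, W ω ∂μ) ^ 2 ≤
      entropy (fun ω => W ω ^ 2) μ := by
  have hpos : ∀ ω, 0 < W ω := fun ω => hm.trans_le (hb ω).1
  have hb2 := fun ω => sq_mem_Icc_sq hm (hb ω)
  have hi : Integrable W μ := .of_mem_Icc m M hW.aemeasurable (.of_forall hb)
  have hi2 : Integrable (fun ω => W ω ^ 2) μ :=
    .of_mem_Icc _ _ (hW.pow_const 2).aemeasurable (.of_forall hb2)
  have hilog := integrable_mul_log_of_mem_Icc hi2 (hW.pow_const 2) (pow_pos hm 2) hb2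
  have hw := integral_pos_of_forall_pos hi hpos
  have ha := integral_pos_of_forall_pos hi2 fun ω => pow_pos (hpos ω) 2
  set a := ∫ ω, W ω ^ 2 ∂μ
  set w := ∫ ω, W ω ∂μ
  have hmean : (2 * Real.log (a / w) + 2) * a - 2 * (a / w) * w ≤
      ∫ ω, W ω ^ 2 * Real.log (W ω ^ 2) ∂μ := by
    rw [← integral_const_mul, ← integral_const_mul,
      ← integral_sub (hi2.const_mul _) (hi.const_mul _)]
    exact integral_mono ((hi2.const_mul _).sub (hi.const_mul _)) hilog fun ω =>
      two_mul_log_add_two_mul_sq_sub_le (div_pos ha hw) (hpos ω)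
  have htangent : Real.log l + 2 * Real.log w - Real.log a ≤ l * w ^ 2 / a - 1 := by
    have h := Real.log_le_sub_one_of_pos (x := l * w ^ 2 / a) (by positivity)
    rwa [Real.log_div (by positivity) ha.ne', Real.log_mul hl.ne' (by positivity),
      Real.log_pow, Nat.cast_ofNat] at h
  have hmul := mul_le_mul_of_nonneg_left htangent ha.le
  have hdiv : a * (l * w ^ 2 / a - 1) = l * w ^ 2 - a := by field_simp
  have hcancel : 2 * (a / w) * w = 2 * a := by field_simp
  rw [Real.log_div ha.ne' hw.ne', hcancel] at hmean
  rw [entropy]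
  linarith

end BoundedEntropy

section MeasurableL2

/-- The functions that are square integrable and measurable. Measurability everywhere, and not only
almost everywhere, is what makes all slices and partial integrals of `f` measurable. -/
structure MeasurableL2 {Ω : Type*} [MeasurableSpace Ω] (f : Ω → ℝ) (μ : Measure Ω) : Prop where
  measurable : Measurable f
  memLp : MemLp f 2 μ

namespace MeasurableL2

variable {Ω : Type*} {mΩ : MeasurableSpace Ω} {μ : Measure Ω} {f g : Ω → ℝ}

lemma sub (hf : MeasurableL2 f μ) (hg : MeasurableL2 g μ) :
    MeasurableL2 (fun ω => f ω - g ω) μ :=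
  ⟨hf.measurable.sub hg.measurable, hf.memLp.sub hg.memLp⟩

lemma zero : MeasurableL2 (fun _ : Ω => (0 : ℝ)) μ :=
  ⟨measurable_const, MemLp.zero⟩

lemma integrable_sq (hf : MeasurableL2 f μ) : Integrable (fun ω => f ω ^ 2) μ :=
  hf.memLp.integrable_sq

lemma integrable [IsFiniteMeasure μ] (hf : MeasurableL2 f μ) : Integrable f μ :=
  hf.memLp.integrable one_le_two

end MeasurableL2

end MeasurableL2

/-- For a measure `μ` with independent coordinates indexed by `ι`, the operations `splice A a b`
which replace the coordinates of `a` outside `A` by those of `b`. -/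
structure Splicing (ι : Type*) {Ω : Type*} [MeasurableSpace Ω] (μ : Measure Ω) where
  splice : Set ι → Ω → Ω → Ω
  measurePreserving : ∀ A, MeasurePreserving (fun q : Ω × Ω => splice A q.1 q.2) (μ.prod μ) μ
  splice_splice : ∀ A B a b c, splice B (splice A a b) c = splice (A ∩ B) a (splice B b c)
  splice_right : ∀ A a b c, splice A a (splice A b c) = splice A a c
  splice_univ : ∀ a b, splice Set.univ a b = a
  splice_empty : ∀ a b, splice ∅ a b = b

namespace Splicing

section Averages

variable {ι Ω : Type*} {mΩ : MeasurableSpace Ω} {μ : Measure Ω} (sp : Splicing ι μ)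
  {A B : Set ι} {f g : Ω → ℝ}

/-- The functions which depend only on the coordinates in `A`. -/
def DependsOn (A : Set ι) (f : Ω → ℝ) : Prop := ∀ a b, f (sp.splice A a b) = f a

/-- The `σ`-algebra generated by the coordinates in `A`, described as the measurable sets which are
invariant under changes of the other coordinates. -/
@[reducible] def sigmaAlgebra (A : Set ι) : MeasurableSpace Ω where
  MeasurableSet' s := MeasurableSet s ∧ ∀ a b, sp.splice A a b ∈ s ↔ a ∈ s
  measurableSet_empty := ⟨MeasurableSet.empty, fun _ _ => Iff.rfl⟩
  measurableSet_compl := fun _ hs => ⟨hs.1.compl, fun a b => not_congr (hs.2 a b)⟩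
  measurableSet_iUnion := fun s hs => ⟨MeasurableSet.iUnion fun i => (hs i).1, fun a b => by
    simp only [Set.mem_iUnion]; exact exists_congr fun i => (hs i).2 a b⟩

/-- The average of `f` over the coordinates outside `A`, a version of the conditional expectation
given the coordinates in `A`. -/
noncomputable def avg (A : Set ι) (f : Ω → ℝ) (ω : Ω) : ℝ := ∫ ω', f (sp.splice A ω ω') ∂μ

lemma splice_splice_of_subset_left (h : A ⊆ B) (a b c : Ω) :
    sp.splice B (sp.splice A a b) c = sp.splice A a (sp.splice B b c) := by
  rw [sp.splice_splice, Set.inter_eq_self_of_subset_left h]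

lemma splice_splice_of_subset_right (h : A ⊆ B) (a b c : Ω) :
    sp.splice A (sp.splice B a b) c = sp.splice A a (sp.splice A b c) := by
  rw [sp.splice_splice, Set.inter_eq_self_of_subset_right h]

lemma measurable_splice (A : Set ι) : Measurable (fun q : Ω × Ω => sp.splice A q.1 q.2) :=
  (sp.measurePreserving A).measurable

lemma measurable_splice_left (A : Set ι) (a : Ω) : Measurable (sp.splice A a) :=
  (sp.measurable_splice A).comp measurable_prodMk_left

lemma DependsOn.mono (h : A ⊆ B) (hf : sp.DependsOn A f) : sp.DependsOn B f := fun a b => by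
  rw [← hf (sp.splice B a b) a, sp.splice_splice_of_subset_right h, hf]

lemma sigmaAlgebra_le (A : Set ι) : sp.sigmaAlgebra A ≤ mΩ := fun _ hs => hs.1

lemma sigmaAlgebra_mono : Monotone sp.sigmaAlgebra := fun A B h s hs => by
  refine ⟨hs.1, fun a b => ?_⟩
  rw [← hs.2 (sp.splice B a b) a, sp.splice_splice_of_subset_right h, hs.2]

lemma DependsOn.measurable_sigmaAlgebra (hf : sp.DependsOn A f) (hm : Measurable f) :
    Measurable[sp.sigmaAlgebra A] f := fun _ ht =>
  ⟨hm ht, fun a b => by rw [Set.mem_preimage, Set.mem_preimage, hf a b]⟩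

lemma dependsOn_indicator {s : Set Ω} (hs : MeasurableSet[sp.sigmaAlgebra A] s) :
    sp.DependsOn A (s.indicator 1) := fun a b => by
  by_cases ha : a ∈ s
  · rw [Set.indicator_of_mem ha, Set.indicator_of_mem ((hs.2 a b).2 ha), Pi.one_apply, Pi.one_apply]
  · rw [Set.indicator_of_notMem ha, Set.indicator_of_notMem (mt (hs.2 a b).1 ha)]

lemma dependsOn_avg (A : Set ι) (f : Ω → ℝ) : sp.DependsOn A (sp.avg A f) := fun a b => by
  simp only [avg, sp.splice_splice_of_subset_left subset_rfl, sp.splice_right]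

lemma integral_comp_splice (A : Set ι) (hf : Measurable f) :
    ∫ q : Ω × Ω, f (sp.splice A q.1 q.2) ∂(μ.prod μ) = ∫ ω, f ω ∂μ := by
  conv_rhs => rw [← (sp.measurePreserving A).map_eq]
  rw [integral_map (sp.measurable_splice A).aemeasurable hf.aestronglyMeasurable]

lemma integrable_comp_splice (A : Set ι) (hf : Integrable f μ) :
    Integrable (fun q : Ω × Ω => f (sp.splice A q.1 q.2)) (μ.prod μ) :=
  (sp.measurePreserving A).integrable_comp_of_integrable hf

lemma avg_empty (f : Ω → ℝ) (ω : Ω) : sp.avg ∅ f ω = ∫ ω', f ω' ∂μ := by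
  simp only [avg, sp.splice_empty]

variable [IsProbabilityMeasure μ]

lemma DependsOn.avg_eq (hf : sp.DependsOn A f) : sp.avg A f = f := by
  funext a
  simp [avg, hf a]

lemma avg_univ (f : Ω → ℝ) : sp.avg Set.univ f = f :=
  DependsOn.avg_eq sp fun a b => by rw [sp.splice_univ]

lemma measurable_avg (A : Set ι) (hf : Measurable f) : Measurable (sp.avg A f) :=
  (StronglyMeasurable.integral_prod_right (f := fun ω ω' => f (sp.splice A ω ω'))
    (hf.comp (sp.measurable_splice A)).stronglyMeasurable).measurable

lemma integrable_avg (A : Set ι) (hf : Integrable f μ) : Integrable (sp.avg A f) μ :=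
  (sp.integrable_comp_splice A hf).integral_prod_left

lemma integral_avg (A : Set ι) (hm : Measurable f) (hf : Integrable f μ) :
    ∫ ω, sp.avg A f ω ∂μ = ∫ ω, f ω ∂μ := by
  rw [← sp.integral_comp_splice A hm, integral_prod _ (sp.integrable_comp_splice A hf)]
  rfl

lemma integral_mul_eq_integral_avg_mul (hf : Measurable f) (hg : Measurable g)
    (hfg : Integrable (fun ω => f ω * g ω) μ) (hA : sp.DependsOn A g) :
    ∫ ω, f ω * g ω ∂μ = ∫ ω, sp.avg A f ω * g ω ∂μ := by
  rw [← sp.integral_avg A (f := fun ω => f ω * g ω) (hf.mul hg) hfg]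
  simp only [avg, hA _ _, integral_mul_const]

lemma avg_ae_eq_condExp (A : Set ι) (hm : Measurable f) (hf : Integrable f μ) :
    sp.avg A f =ᵐ[μ] μ[f|sp.sigmaAlgebra A] := by
  refine ae_eq_condExp_of_forall_setIntegral_eq (sp.sigmaAlgebra_le A) hf
    (fun s _ _ => (sp.integrable_avg A hf).integrableOn) (fun s hs _ => ?_)
    ((sp.dependsOn_avg A f).measurable_sigmaAlgebra sp
      (sp.measurable_avg A hm)).stronglyMeasurable.aestronglyMeasurable
  have hs' : MeasurableSet s := sp.sigmaAlgebra_le A s hs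
  have indicator_eq_mul : ∀ g : Ω → ℝ, s.indicator g = fun ω => g ω * s.indicator 1 ω := fun g => by
    funext ω
    by_cases hω : ω ∈ s <;> simp [hω]
  rw [← integral_indicator hs', ← integral_indicator hs', indicator_eq_mul f,
    indicator_eq_mul (sp.avg A f)]
  refine (sp.integral_mul_eq_integral_avg_mul hm (measurable_one.indicator hs') ?_
    (sp.dependsOn_indicator hs)).symm
  exact indicator_eq_mul f ▸ hf.indicator hs'

lemma measurableL2_avg (A : Set ι) (hf : MeasurableL2 f μ) : MeasurableL2 (sp.avg A f) μ :=
  ⟨sp.measurable_avg A hf.measurable,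
    (memLp_congr_ae (sp.avg_ae_eq_condExp A hf.measurable hf.integrable)).2
      (hf.memLp.condExp one_le_two)⟩

lemma avg_avg_apply (hm : Measurable f) {a : Ω}
    (ha : Integrable (fun ω => f (sp.splice (A ∩ B) a ω)) μ) :
    sp.avg A (sp.avg B f) a = sp.avg (A ∩ B) f a := by
  simp only [avg, sp.splice_splice]
  rw [← sp.integral_comp_splice B (f := fun ω => f (sp.splice (A ∩ B) a ω))
    (hm.comp (sp.measurable_splice_left (A ∩ B) a)),
    integral_prod _ (sp.integrable_comp_splice B ha)]

lemma avg_avg_ae_eq (A B : Set ι) (hm : Measurable f) (hf : Integrable f μ) :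
    sp.avg A (sp.avg B f) =ᵐ[μ] sp.avg (A ∩ B) f := by
  filter_upwards [(sp.integrable_comp_splice (A ∩ B) hf).prod_right_ae] with a ha
  exact sp.avg_avg_apply hm ha

lemma avg_sub_ae_eq (A : Set ι) (hf : Integrable f μ) (hg : Integrable g μ) :
    sp.avg A (fun ω => f ω - g ω) =ᵐ[μ] fun ω => sp.avg A f ω - sp.avg A g ω := by
  filter_upwards [(sp.integrable_comp_splice A hf).prod_right_ae,
    (sp.integrable_comp_splice A hg).prod_right_ae] with a hfa hga
  exact integral_sub hfa hga

lemma integral_sq_avg_sub_avg (h : A ⊆ B) (hf : MeasurableL2 f μ) :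
    ∫ ω, (sp.avg B f ω - sp.avg A f ω) ^ 2 ∂μ =
      ∫ ω, (sp.avg B f ω) ^ 2 ∂μ - ∫ ω, (sp.avg A f ω) ^ 2 ∂μ := by
  have hA := sp.measurableL2_avg A hf
  have hB := sp.measurableL2_avg B hf
  have hBA : Integrable (fun ω => sp.avg B f ω * sp.avg A f ω) μ := hB.memLp.integrable_mul hA.memLp
  have orthogonality : ∫ ω, sp.avg B f ω * sp.avg A f ω ∂μ = ∫ ω, (sp.avg A f ω) ^ 2 ∂μ := by
    rw [sp.integral_mul_eq_integral_avg_mul hB.measurable hA.measurable hBA (sp.dependsOn_avg A f)]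
    refine integral_congr_ae ?_
    filter_upwards [sp.avg_avg_ae_eq A B hf.measurable hf.integrable] with ω hω
    rw [hω, Set.inter_eq_self_of_subset_left h, sq]
  have expand : ∀ ω, (sp.avg B f ω - sp.avg A f ω) ^ 2 =
      (sp.avg B f ω) ^ 2 + (sp.avg A f ω) ^ 2 - 2 * (sp.avg B f ω * sp.avg A f ω) := fun ω => by
    ring
  have hsum : Integrable (fun ω => (sp.avg B f ω) ^ 2 + (sp.avg A f ω) ^ 2) μ :=
    hB.integrable_sq.add hA.integrable_sq
  simp only [expand]
  rw [integral_sub hsum (hBA.const_mul 2), integral_add hB.integrable_sq hA.integrable_sq,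
    integral_const_mul, orthogonality]
  ring

lemma integral_sq_avg_le (A : Set ι) (hf : MeasurableL2 f μ) :
    ∫ ω, (sp.avg A f ω) ^ 2 ∂μ ≤ ∫ ω, (f ω) ^ 2 ∂μ := by
  have h := sp.integral_sq_avg_sub_avg (Set.subset_univ A) hf
  rw [sp.avg_univ] at h
  exact sub_nonneg.1 (h ▸ integral_nonneg fun ω => sq_nonneg _)

lemma integral_abs_avg_sub_avg_inter_le (A B : Set ι) (hm : Measurable f) (hf : Integrable f μ) :
    ∫ ω, |sp.avg A f ω - sp.avg (A ∩ B) f ω| ∂μ ≤ ∫ ω, |f ω - sp.avg B f ω| ∂μ := by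
  have hB := sp.integrable_avg B hf
  refine le_of_eq_of_le (integral_congr_ae ?_)
    (integral_abs_condExp_le (m := sp.sigmaAlgebra A) (fun ω => f ω - sp.avg B f ω))
  filter_upwards [sp.avg_ae_eq_condExp A (hm.sub (sp.measurable_avg B hm)) (hf.sub hB),
    sp.avg_sub_ae_eq A hf hB, sp.avg_avg_ae_eq A B hm hf] with ω hcond hsub havg
  rw [← havg, ← hsub]
  exact congrArg _ hcond

end Averages

end Splicing

/-! ### Tensorisation of the entropy -/

namespace Splicing

section Entropy

variable {ι Ω : Type*} {mΩ : MeasurableSpace Ω} {μ : Measure Ω} (sp : Splicing ι μ)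

/-- The integral of `x log x` along the average of `F` over the coordinates outside `A`. Its
increments in `A` are averaged entropies: `mulLogAvg univ F - mulLogAvg ∅ F` is the entropy of `F`,
and `mulLogAvg univ F - mulLogAvg {j}ᶜ F` the mean of its entropy in the coordinate `j`. -/
noncomputable def mulLogAvg (A : Set ι) (F : Ω → ℝ) : ℝ :=
  ∫ ω, sp.avg A F ω * Real.log (sp.avg A F ω) ∂μ

lemma mulLogAvg_empty [IsProbabilityMeasure μ] (F : Ω → ℝ) :
    sp.mulLogAvg ∅ F = (∫ ω, F ω ∂μ) * Real.log (∫ ω, F ω ∂μ) := by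
  simp [mulLogAvg, sp.avg_empty]

lemma DependsOn.mulLogAvg_eq [IsProbabilityMeasure μ] {A : Set ι} {F : Ω → ℝ}
    (hF : sp.DependsOn A F) : sp.mulLogAvg A F = ∫ ω, F ω * Real.log (F ω) ∂μ := by
  rw [mulLogAvg, hF.avg_eq]

lemma mulLogAvg_univ [IsProbabilityMeasure μ] (F : Ω → ℝ) :
    sp.mulLogAvg Set.univ F = ∫ ω, F ω * Real.log (F ω) ∂μ := by
  rw [mulLogAvg, sp.avg_univ]

variable [IsProbabilityMeasure μ] {F : Ω → ℝ} {m M : ℝ} (A B : Set ι)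

lemma integrable_splice_left_of_mem_Icc (hF : Measurable F) (hb : ∀ ω, F ω ∈ Set.Icc m M) (a : Ω) :
    Integrable (fun ω => F (sp.splice A a ω)) μ :=
  .of_mem_Icc m M (hF.comp (sp.measurable_splice_left A a)).aemeasurable (.of_forall fun _ => hb _)

lemma avg_mem_Icc (hF : Measurable F) (hb : ∀ ω, F ω ∈ Set.Icc m M) (a : Ω) :
    sp.avg A F a ∈ Set.Icc m M := by
  have hi := sp.integrable_splice_left_of_mem_Icc A hF hb a
  constructor
  · simpa [avg] using integral_mono (integrable_const m) hi (fun ω => (hb _).1)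
  · simpa [avg] using integral_mono hi (integrable_const M) (fun ω => (hb _).2)

lemma avg_avg_of_mem_Icc (hF : Measurable F) (hb : ∀ ω, F ω ∈ Set.Icc m M) :
    sp.avg A (sp.avg B F) = sp.avg (A ∩ B) F :=
  funext fun a => sp.avg_avg_apply hF (sp.integrable_splice_left_of_mem_Icc _ hF hb a)

lemma integrable_mul_log_avg (hF : Measurable F) (hm : 0 < m) (hb : ∀ ω, F ω ∈ Set.Icc m M) :
    Integrable (fun ω => F ω * Real.log (sp.avg A F ω)) μ :=
  integrable_mul_log_of_mem_Icc (.of_mem_Icc m M hF.aemeasurable (.of_forall hb))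
    (sp.measurable_avg A hF) hm (sp.avg_mem_Icc A hF hb)

lemma mulLogAvg_eq_integral_mul_log_avg (hF : Measurable F) (hm : 0 < m)
    (hb : ∀ ω, F ω ∈ Set.Icc m M) :
    sp.mulLogAvg A F = ∫ ω, F ω * Real.log (sp.avg A F ω) ∂μ :=
  (sp.integral_mul_eq_integral_avg_mul hF (sp.measurable_avg A hF).log
    (sp.integrable_mul_log_avg A hF hm hb) fun a b => by rw [sp.dependsOn_avg A F a b]).symm

lemma integrable_avg_mul_avg_div_avg (hF : Measurable F) (hm : 0 < m)
    (hb : ∀ ω, F ω ∈ Set.Icc m M) :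
    Integrable (fun ω => sp.avg A F ω * (sp.avg B F ω / sp.avg (A ∩ B) F ω)) μ := by
  have hFi : Integrable F μ := .of_mem_Icc m M hF.aemeasurable (.of_forall hb)
  refine (sp.integrable_avg A hFi).mul_bdd (c := M / m)
    ((sp.measurable_avg B hF).div (sp.measurable_avg _ hF)).aestronglyMeasurable
    (.of_forall fun ω => ?_)
  have hB := sp.avg_mem_Icc B hF hb ω
  have hAB := sp.avg_mem_Icc (A ∩ B) hF hb ω
  rw [Real.norm_of_nonneg (div_nonneg (hm.le.trans hB.1) (hm.le.trans hAB.1))]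
  exact div_le_div₀ (hm.le.trans (hB.1.trans hB.2)) hB.2 hm hAB.1

lemma integral_avg_mul_avg_div_avg (hF : Measurable F) (hm : 0 < m)
    (hb : ∀ ω, F ω ∈ Set.Icc m M) :
    ∫ ω, sp.avg A F ω * (sp.avg B F ω / sp.avg (A ∩ B) F ω) ∂μ = ∫ ω, F ω ∂μ := by
  have hratio : sp.DependsOn B fun ω => sp.avg B F ω / sp.avg (A ∩ B) F ω := fun a b => by
    simp only [sp.dependsOn_avg B F a b,
      (sp.dependsOn_avg (A ∩ B) F).mono sp Set.inter_subset_right a b]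
  rw [sp.integral_mul_eq_integral_avg_mul (g := fun ω => sp.avg B F ω / sp.avg (A ∩ B) F ω)
      (sp.measurable_avg A hF)
      ((sp.measurable_avg B hF).div (sp.measurable_avg _ hF))
      (sp.integrable_avg_mul_avg_div_avg A B hF hm hb) hratio,
    ← sp.integral_avg B hF (.of_mem_Icc m M hF.aemeasurable (.of_forall hb))]
  congr with ω
  rw [sp.avg_avg_of_mem_Icc B A hF hb, Set.inter_comm B A,
    mul_div_cancel₀ _ (hm.trans_le (sp.avg_mem_Icc (A ∩ B) hF hb ω).1).ne']

end Entropy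

end Splicing

lemma mul_log_div_le_mul_log_div_add {a A b B : ℝ} (ha : 0 < a) (hA : 0 < A) (hb : 0 < b)
    (hB : 0 < B) :
    a * Real.log b - a * Real.log B ≤ a * Real.log a - a * Real.log A + b * (A / B) - a := by
  have hlog := Real.log_le_sub_one_of_pos (x := b * A / (B * a)) (by positivity)
  rw [Real.log_div (by positivity) (by positivity), Real.log_mul hb.ne' hA.ne',
    Real.log_mul hB.ne' ha.ne'] at hlog
  have hmul := mul_le_mul_of_nonneg_left hlog ha.le
  have hdiv : a * (b * A / (B * a) - 1) = b * (A / B) - a := by field_simp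
  linarith

namespace Splicing

variable {ι Ω : Type*} {mΩ : MeasurableSpace Ω} {μ : Measure Ω} (sp : Splicing ι μ)
  [IsProbabilityMeasure μ]

/-- The difference of the two sides is a relative entropy: the density `F · E[F|A∩B]` is compared
with `E[F|A] · E[F|B]`. -/
lemma mulLogAvg_sub_inter_le (A B : Set ι) {F : Ω → ℝ} (hF : Measurable F) {m M : ℝ} (hm : 0 < m)
    (hb : ∀ ω, F ω ∈ Set.Icc m M) :
    sp.mulLogAvg A F - sp.mulLogAvg (A ∩ B) F ≤ sp.mulLogAvg Set.univ F - sp.mulLogAvg B F := by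
  have hFi : Integrable F μ := .of_mem_Icc m M hF.aemeasurable (.of_forall hb)
  have hlog := fun C => sp.integrable_mul_log_avg C hF hm hb
  have hpos : ∀ C ω, 0 < sp.avg C F ω := fun C ω => hm.trans_le (sp.avg_mem_Icc C hF hb ω).1
  have hFlog : Integrable (fun ω => F ω * Real.log (F ω)) μ := by
    simpa only [sp.avg_univ] using hlog Set.univ
  have hratio := sp.integrable_avg_mul_avg_div_avg A B hF hm hb
  have hdiff : Integrable (fun ω => F ω * Real.log (F ω) - F ω * Real.log (sp.avg B F ω)) μ :=
    hFlog.sub (hlog B)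
  have hsum : Integrable (fun ω => F ω * Real.log (F ω) - F ω * Real.log (sp.avg B F ω) +
      sp.avg A F ω * (sp.avg B F ω / sp.avg (A ∩ B) F ω)) μ := hdiff.add hratio
  calc sp.mulLogAvg A F - sp.mulLogAvg (A ∩ B) F
      = ∫ ω, (F ω * Real.log (sp.avg A F ω) - F ω * Real.log (sp.avg (A ∩ B) F ω)) ∂μ := by
        rw [integral_sub (hlog A) (hlog _), sp.mulLogAvg_eq_integral_mul_log_avg A hF hm hb,
          sp.mulLogAvg_eq_integral_mul_log_avg (A ∩ B) hF hm hb]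
    _ ≤ ∫ ω, (F ω * Real.log (F ω) - F ω * Real.log (sp.avg B F ω) +
          sp.avg A F ω * (sp.avg B F ω / sp.avg (A ∩ B) F ω) - F ω) ∂μ :=
        integral_mono ((hlog A).sub (hlog _)) (hsum.sub hFi) fun ω =>
          mul_log_div_le_mul_log_div_add (hm.trans_le (hb ω).1) (hpos B ω) (hpos A ω) (hpos _ ω)
    _ = sp.mulLogAvg Set.univ F - sp.mulLogAvg B F := by
        rw [integral_sub hsum hFi, integral_add hdiff hratio, integral_sub hFlog (hlog B),
          sp.integral_avg_mul_avg_div_avg A B hF hm hb, sp.mulLogAvg_univ,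
          sp.mulLogAvg_eq_integral_mul_log_avg B hF hm hb]
        ring

end Splicing

/-- The first `n` coordinates in an enumeration `e` of the index set. -/
def initialCoords {ι : Type*} (e : ι ≃ ℕ) (n : ℕ) : Set ι := {j | e j < n}

section InitialCoords

variable {ι : Type*} (e : ι ≃ ℕ)

lemma initialCoords_zero : initialCoords e 0 = ∅ := by simp [initialCoords]

lemma initialCoords_mono : Monotone (initialCoords e) := fun _ _ h _ hj => lt_of_lt_of_le hj h

lemma initialCoords_succ_inter (k : ℕ) :
    initialCoords e (k + 1) ∩ {e.symm k}ᶜ = initialCoords e k := by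
  ext j
  simp only [initialCoords, Set.mem_inter_iff, Set.mem_ofPred_eq, Set.mem_compl_iff,
    Set.mem_singleton_iff, Equiv.eq_symm_apply]
  lia

end InitialCoords

lemma Splicing.entropy_le_sum_of_dependsOn {ι Ω : Type*} {mΩ : MeasurableSpace Ω}
    {μ : Measure Ω} (sp : Splicing ι μ) [IsProbabilityMeasure μ] (e : ι ≃ ℕ) (n : ℕ) {F : Ω → ℝ}
    (hdep : sp.DependsOn (initialCoords e n) F) (hF : Measurable F) {m M : ℝ} (hm : 0 < m)
    (hb : ∀ ω, F ω ∈ Set.Icc m M) :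
    entropy F μ ≤
      ∑ k ∈ Finset.range n, (sp.mulLogAvg Set.univ F - sp.mulLogAvg {e.symm k}ᶜ F) := by
  rw [entropy, ← hdep.mulLogAvg_eq, ← sp.mulLogAvg_empty, ← initialCoords_zero e,
    ← Finset.sum_range_sub (fun k => sp.mulLogAvg (initialCoords e k) F)]
  refine Finset.sum_le_sum fun k _ => ?_
  simpa only [initialCoords_succ_inter] using
    sp.mulLogAvg_sub_inter_le (initialCoords e (k + 1)) {e.symm k}ᶜ hF hm hb

/-! ### Truncation and limits in `L²` -/

/-- The absolute value clamped to the interval from `1 / (n + 1)` to `n`; it makes the Lipschitz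
logarithmic Sobolev inequalities applicable to unbounded functions with zeros. -/
noncomputable def clampAbs (n : ℕ) (x : ℝ) : ℝ := max (1 / (n + 1 : ℝ)) (min |x| n)

section ClampAbs

lemma lipschitzWith_clampAbs (n : ℕ) : LipschitzWith 1 (clampAbs n) := by
  have habs : LipschitzWith 1 fun x : ℝ => |x| := lipschitzWith_one_norm
  exact (habs.min_const (n : ℝ)).const_max (1 / (n + 1 : ℝ))

lemma measurable_clampAbs (n : ℕ) : Measurable (clampAbs n) :=
  (lipschitzWith_clampAbs n).continuous.measurable

lemma one_div_natCast_add_one_le_one (n : ℕ) : 1 / (n + 1 : ℝ) ≤ 1 :=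
  (div_le_one (by positivity)).2 (by linarith [(Nat.cast_nonneg n : (0 : ℝ) ≤ n)])

lemma clampAbs_mem_Icc (n : ℕ) (x : ℝ) : clampAbs n x ∈ Set.Icc (1 / (n + 1 : ℝ)) (n + 1) := by
  refine ⟨le_max_left _ _, max_le ?_ ?_⟩
  · linarith [one_div_natCast_add_one_le_one n, (Nat.cast_nonneg n : (0 : ℝ) ≤ n)]
  · exact (min_le_right _ _).trans (by linarith)

lemma clampAbs_nonneg (n : ℕ) (x : ℝ) : 0 ≤ clampAbs n x :=
  le_trans (by positivity) (clampAbs_mem_Icc n x).1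

lemma clampAbs_le (n : ℕ) (x : ℝ) : clampAbs n x ≤ |x| + 1 :=
  max_le (by linarith [one_div_natCast_add_one_le_one n, abs_nonneg x])
    ((min_le_left _ _).trans (by linarith))

lemma tendsto_clampAbs (x : ℝ) : Tendsto (fun n => clampAbs n x) atTop (𝓝 |x|) := by
  have hmin : Tendsto (fun n : ℕ => min |x| (n : ℝ)) atTop (𝓝 |x|) := by
    refine tendsto_const_nhds.congr' ?_
    filter_upwards [tendsto_natCast_atTop_atTop.eventually_ge_atTop |x|] with n hn
    exact (min_eq_left hn).symm
  simpa [clampAbs] using (tendsto_one_div_add_atTop_nhds_zero_nat (𝕜 := ℝ)).max hmin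

variable {Ω : Type*} {mΩ : MeasurableSpace Ω} {μ : Measure Ω} [IsFiniteMeasure μ] {V : Ω → ℝ}

lemma tendsto_integral_clampAbs (hV : MeasurableL2 V μ) :
    Tendsto (fun n => ∫ ω, clampAbs n (V ω) ∂μ) atTop (𝓝 (∫ ω, |V ω| ∂μ)) :=
  tendsto_integral_of_dominated_convergence (fun ω => |V ω| + 1)
    (fun n => ((measurable_clampAbs n).comp hV.measurable).aestronglyMeasurable)
    (hV.integrable.abs.add (integrable_const 1))
    (fun n => .of_forall fun ω => by
      rw [Real.norm_of_nonneg (clampAbs_nonneg _ _)]; exact clampAbs_le _ _)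
    (.of_forall fun ω => tendsto_clampAbs _)

lemma tendsto_integral_sq_clampAbs (hV : MeasurableL2 V μ) :
    Tendsto (fun n => ∫ ω, clampAbs n (V ω) ^ 2 ∂μ) atTop (𝓝 (∫ ω, V ω ^ 2 ∂μ)) := by
  have hbound : MemLp (fun ω => |V ω| + 1) 2 μ := hV.memLp.abs.add (memLp_const 1)
  refine tendsto_integral_of_dominated_convergence (fun ω => (|V ω| + 1) ^ 2)
    (fun n => (((measurable_clampAbs n).comp hV.measurable).pow_const 2).aestronglyMeasurable)
    hbound.integrable_sq (fun n => .of_forall fun ω => ?_) (.of_forall fun ω => ?_)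
  · rw [Real.norm_of_nonneg (sq_nonneg _)]
    exact pow_le_pow_left₀ (clampAbs_nonneg _ _) (clampAbs_le _ _) 2
  · simpa only [sq_abs] using (tendsto_clampAbs (V ω)).pow 2

end ClampAbs

lemma ofReal_integral_sq {Ω : Type*} [MeasurableSpace Ω] {μ : Measure Ω} {f : Ω → ℝ}
    (hf : MemLp f 2 μ) : ENNReal.ofReal (∫ ω, f ω ^ 2 ∂μ) = ∫⁻ ω, ‖f ω‖ₑ ^ 2 ∂μ := by
  rw [ofReal_integral_eq_lintegral_ofReal hf.integrable_sq (.of_forall fun ω => sq_nonneg _)]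
  simp only [Real.enorm_eq_ofReal_abs, ← ENNReal.ofReal_pow (abs_nonneg _), sq_abs]

/-- By Fatou's lemma, the bound on the second moments prevents a loss of mass in the limit. -/
lemma tendsto_integral_sq_of_ae_tendsto_of_le {Ω : Type*} {mΩ : MeasurableSpace Ω} {μ : Measure Ω}
    {f : Ω → ℝ} {u : ℕ → Ω → ℝ} (hf : MemLp f 2 μ) (hu : ∀ n, MeasurableL2 (u n) μ)
    (hlim : ∀ᵐ ω ∂μ, Tendsto (fun n => u n ω) atTop (𝓝 (f ω)))
    (hle : ∀ n, ∫ ω, u n ω ^ 2 ∂μ ≤ ∫ ω, f ω ^ 2 ∂μ) :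
    Tendsto (fun n => ∫ ω, u n ω ^ 2 ∂μ) atTop (𝓝 (∫ ω, f ω ^ 2 ∂μ)) := by
  have hnonneg : ∀ g : Ω → ℝ, 0 ≤ ∫ ω, g ω ^ 2 ∂μ := fun g => integral_nonneg fun _ => sq_nonneg _
  suffices h : Tendsto (fun n => ENNReal.ofReal (∫ ω, u n ω ^ 2 ∂μ)) atTop
      (𝓝 (ENNReal.ofReal (∫ ω, f ω ^ 2 ∂μ))) by
    simpa only [Function.comp_def, ENNReal.toReal_ofReal (hnonneg _)] using
      (ENNReal.tendsto_toReal ENNReal.ofReal_ne_top).comp h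
  refine tendsto_of_le_liminf_of_limsup_le ?_
    (limsup_le_of_le (h := .of_forall fun n => ENNReal.ofReal_le_ofReal (hle n)))
  simp only [ofReal_integral_sq hf, ofReal_integral_sq (hu _).memLp]
  refine le_of_eq_of_le (lintegral_congr_ae ?_)
    (lintegral_liminf_le fun n => (hu n).measurable.enorm.pow_const 2)
  filter_upwards [hlim] with ω hω
  exact (((ENNReal.continuous_pow 2).comp continuous_enorm).tendsto (f ω) |>.comp hω).liminf_eq.symm

/-! ### The modified Poincaré inequality for independent coordinates -/

namespace Splicing

variable {ι Ω : Type*} {mΩ : MeasurableSpace Ω} {μ : Measure Ω} (sp : Splicing ι μ)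

/-- An abstract notion of partial derivatives satisfying a logarithmic Sobolev inequality with
constant `c j` in each coordinate `j`: `R j f D` says that `D` is a derivative of `f` in the
coordinate `j`. It covers both the discrete derivatives in `S` and the weak ones in `ℕ`. The
logarithmic Sobolev inequality is required of `θ ∘ f`, with `θ` Lipschitz, in terms of `D` itself,
so that no chain rule is needed. -/
structure IsDerivation (c : ι → ℝ) (R : ι → (Ω → ℝ) → (Ω → ℝ) → Prop) : Prop where
  measurableL2 : ∀ {j f D}, R j f D → MeasurableL2 f μ
  measurableL2_deriv : ∀ {j f D}, R j f D → MeasurableL2 D μ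
  avg : ∀ {j A f D}, R j f D → j ∈ A → R j (sp.avg A f) (sp.avg A D)
  avg_zero : ∀ {j A f}, MeasurableL2 f μ → j ∉ A → R j (sp.avg A f) (fun _ => 0)
  sub : ∀ {j f g D E}, R j f D → R j g E → R j (fun ω => f ω - g ω) (fun ω => D ω - E ω)
  logSobolev : ∀ {j f D} {θ : ℝ → ℝ} {m M : ℝ}, R j f D → LipschitzWith 1 θ →
    (∀ x, θ x ∈ Set.Icc m M) → 0 < m →
    sp.mulLogAvg Set.univ (fun ω => θ (f ω) ^ 2) - sp.mulLogAvg {j}ᶜ (fun ω => θ (f ω) ^ 2) ≤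
      c j * ∫ ω, D ω ^ 2 ∂μ

section MartingaleConvergence

variable [IsProbabilityMeasure μ]

lemma ae_tendsto_avg_initialCoords (e : ι ≃ ℕ) (hgen : mΩ ≤ ⨆ j, sp.sigmaAlgebra {j}) {f : Ω → ℝ}
    (hm : Measurable f) (hf : Integrable f μ) :
    ∀ᵐ ω ∂μ, Tendsto (fun n => sp.avg (initialCoords e n) f ω) atTop (𝓝 (f ω)) := by
  let ℱ : Filtration ℕ mΩ := ⟨fun n => sp.sigmaAlgebra (initialCoords e n),
    fun _ _ h => sp.sigmaAlgebra_mono (initialCoords_mono e h), fun n => sp.sigmaAlgebra_le _⟩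
  have hsup : mΩ ≤ ⨆ n, ℱ n := hgen.trans <| iSup_le fun j =>
    (sp.sigmaAlgebra_mono (b := initialCoords e (e j + 1)) (by simp [initialCoords])).trans
      (le_iSup (fun n => ℱ n) (e j + 1))
  have havg : ∀ᵐ ω ∂μ, ∀ n, sp.avg (initialCoords e n) f ω = (μ[f|ℱ n]) ω :=
    ae_all_iff.2 fun n => sp.avg_ae_eq_condExp _ hm hf
  filter_upwards [hf.tendsto_ae_condExp (ℱ := ℱ) (hm.stronglyMeasurable.mono hsup), havg]
    with ω hlim hω
  simpa only [hω] using hlim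

lemma tendsto_integral_sq_avg_initialCoords (e : ι ≃ ℕ) (hgen : mΩ ≤ ⨆ j, sp.sigmaAlgebra {j})
    {f : Ω → ℝ} (hf : MeasurableL2 f μ) :
    Tendsto (fun n => ∫ ω, sp.avg (initialCoords e n) f ω ^ 2 ∂μ) atTop (𝓝 (∫ ω, f ω ^ 2 ∂μ)) :=
  tendsto_integral_sq_of_ae_tendsto_of_le hf.memLp (fun _ => sp.measurableL2_avg _ hf)
    (sp.ae_tendsto_avg_initialCoords e hgen hf.measurable hf.integrable)
    fun _ => sp.integral_sq_avg_le _ hf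

end MartingaleConvergence

section Increments

/-- The `k`-th difference of the martingale of averages of `f` over all but the first coordinates
in the enumeration `e`. -/
noncomputable def increment (e : ι ≃ ℕ) (f : Ω → ℝ) (k : ℕ) (ω : Ω) : ℝ :=
  sp.avg (initialCoords e (k + 1)) f ω - sp.avg (initialCoords e k) f ω

/-- The partial derivative in the coordinate `j` of the average of `f` over all but the first `k`
coordinates, where `D j` is the one of `f`. -/
noncomputable def avgDeriv (e : ι ≃ ℕ) (D : ι → Ω → ℝ) (k : ℕ) (j : ι) : Ω → ℝ :=
  if e j < k then sp.avg (initialCoords e k) (D j) else fun _ => 0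

variable (e : ι ≃ ℕ) {f : Ω → ℝ} {D : ι → Ω → ℝ}

lemma avgDeriv_zero (D : ι → Ω → ℝ) (j : ι) : sp.avgDeriv e D 0 j = fun _ => 0 := by
  simp [avgDeriv]

lemma dependsOn_increment (f : Ω → ℝ) {k n : ℕ} (hk : k < n) :
    sp.DependsOn (initialCoords e n) (sp.increment e f k) := fun a b => by
  simp only [increment, (sp.dependsOn_avg _ f).mono sp (initialCoords_mono e hk) a b,
    (sp.dependsOn_avg _ f).mono sp (initialCoords_mono e hk.le) a b]

variable [IsProbabilityMeasure μ]

lemma sum_integral_sq_increment (hf : MeasurableL2 f μ) (n : ℕ) :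
    ∑ k ∈ Finset.range n, ∫ ω, sp.increment e f k ω ^ 2 ∂μ =
      ∫ ω, sp.avg (initialCoords e n) f ω ^ 2 ∂μ - (∫ ω, f ω ∂μ) ^ 2 := by
  have hzero : ∫ ω, sp.avg (initialCoords e 0) f ω ^ 2 ∂μ = (∫ ω, f ω ∂μ) ^ 2 := by
    simp [initialCoords_zero, sp.avg_empty]
  rw [← hzero, ← Finset.sum_range_sub fun k => ∫ ω, sp.avg (initialCoords e k) f ω ^ 2 ∂μ]
  exact Finset.sum_congr rfl fun k _ =>
    sp.integral_sq_avg_sub_avg (initialCoords_mono e k.le_succ) hf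

lemma integral_abs_increment_le (hf : MeasurableL2 f μ) (k : ℕ) :
    ∫ ω, |sp.increment e f k ω| ∂μ ≤ ∫ ω, |f ω - sp.avg {e.symm k}ᶜ f ω| ∂μ := by
  simpa only [increment, initialCoords_succ_inter] using
    sp.integral_abs_avg_sub_avg_inter_le (initialCoords e (k + 1)) {e.symm k}ᶜ hf.measurable
      hf.integrable

lemma integral_sq_avgDeriv_sub {j : ι} (hD : MeasurableL2 (D j) μ) (k : ℕ) :
    ∫ ω, (sp.avgDeriv e D (k + 1) j ω - sp.avgDeriv e D k j ω) ^ 2 ∂μ =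
      ∫ ω, sp.avgDeriv e D (k + 1) j ω ^ 2 ∂μ - ∫ ω, sp.avgDeriv e D k j ω ^ 2 ∂μ := by
  by_cases h : e j < k
  · simp only [avgDeriv, if_pos h, if_pos (h.trans k.lt_succ_self)]
    exact sp.integral_sq_avg_sub_avg (initialCoords_mono e k.le_succ) hD
  · simp [avgDeriv, h]

lemma integral_sq_avgDeriv_le {j : ι} (hD : MeasurableL2 (D j) μ) (k : ℕ) :
    ∫ ω, sp.avgDeriv e D k j ω ^ 2 ∂μ ≤ ∫ ω, D j ω ^ 2 ∂μ := by
  unfold avgDeriv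
  split_ifs
  · exact sp.integral_sq_avg_le _ hD
  · simpa using integral_nonneg fun ω => sq_nonneg (D j ω)

lemma sum_integral_sq_avgDeriv_sub_le {j : ι} (hD : MeasurableL2 (D j) μ) (n : ℕ) :
    ∑ k ∈ Finset.range n, ∫ ω, (sp.avgDeriv e D (k + 1) j ω - sp.avgDeriv e D k j ω) ^ 2 ∂μ ≤
      ∫ ω, D j ω ^ 2 ∂μ := by
  simp only [sp.integral_sq_avgDeriv_sub e hD]
  rw [Finset.sum_range_sub fun k => ∫ ω, sp.avgDeriv e D k j ω ^ 2 ∂μ]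
  simpa [avgDeriv_zero] using sp.integral_sq_avgDeriv_le e hD n

end Increments

namespace IsDerivation

variable {sp} {c : ι → ℝ} {R : ι → (Ω → ℝ) → (Ω → ℝ) → Prop}

lemma avgDeriv (hR : sp.IsDerivation c R) (e : ι ≃ ℕ) {f : Ω → ℝ} {D : ι → Ω → ℝ} {j : ι}
    (hfD : R j f (D j)) (k : ℕ) :
    R j (sp.avg (initialCoords e k) f) (sp.avgDeriv e D k j) := by
  unfold Splicing.avgDeriv
  split_ifs with h
  exacts [hR.avg hfD h, hR.avg_zero (hR.measurableL2 hfD) h]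

variable [IsProbabilityMeasure μ]

lemma log_add_one_mul_clampAbs_le (hR : sp.IsDerivation c R) (e : ι ≃ ℕ) {n : ℕ} {V : Ω → ℝ}
    (hV : Measurable V) (hdep : sp.DependsOn (initialCoords e n) V) {D : ι → Ω → ℝ}
    (hVD : ∀ j, R j V (D j)) {l : ℝ} (hl : 0 < l) (N : ℕ) :
    (Real.log l + 1) * ∫ ω, clampAbs N (V ω) ^ 2 ∂μ - l * (∫ ω, clampAbs N (V ω) ∂μ) ^ 2 ≤
      ∑ k ∈ Finset.range n, c (e.symm k) * ∫ ω, D (e.symm k) ω ^ 2 ∂μ := by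
  have hpos : (0 : ℝ) < 1 / (N + 1 : ℝ) := by positivity
  have hmeas : Measurable fun ω => clampAbs N (V ω) := (measurable_clampAbs N).comp hV
  have hdep2 : sp.DependsOn (initialCoords e n) fun ω => clampAbs N (V ω) ^ 2 := fun a b => by
    simp only [hdep a b]
  have tensorisation := sp.entropy_le_sum_of_dependsOn e n hdep2 (hmeas.pow_const 2)
    (pow_pos hpos 2) fun ω => sq_mem_Icc_sq hpos (clampAbs_mem_Icc N (V ω))
  exact (log_add_one_mul_integral_sq_sub_le_entropy hmeas hpos
    (fun ω => clampAbs_mem_Icc N (V ω)) hl).trans <| tensorisation.trans <|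
      Finset.sum_le_sum fun k _ =>
        hR.logSobolev (hVD _) (lipschitzWith_clampAbs N) (clampAbs_mem_Icc N) hpos

lemma log_add_one_mul_le_of_dependsOn (hR : sp.IsDerivation c R) (e : ι ≃ ℕ) {n : ℕ} {V : Ω → ℝ}
    (hV : MeasurableL2 V μ) (hdep : sp.DependsOn (initialCoords e n) V) {D : ι → Ω → ℝ}
    (hVD : ∀ j, R j V (D j)) {l : ℝ} (hl : 0 < l) :
    (Real.log l + 1) * ∫ ω, V ω ^ 2 ∂μ - l * (∫ ω, |V ω| ∂μ) ^ 2 ≤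
      ∑ k ∈ Finset.range n, c (e.symm k) * ∫ ω, D (e.symm k) ω ^ 2 ∂μ :=
  le_of_tendsto (((tendsto_integral_sq_clampAbs hV).const_mul _).sub
      (((tendsto_integral_clampAbs hV).pow 2).const_mul l))
    (.of_forall (hR.log_add_one_mul_clampAbs_le e hV.measurable hdep hVD hl))

variable {f : Ω → ℝ} {D : ι → Ω → ℝ}

lemma log_add_one_mul_increment_le (hR : sp.IsDerivation c R) (e : ι ≃ ℕ)
    (hf : MeasurableL2 f μ) (hfD : ∀ j, R j f (D j)) {k n : ℕ} (hk : k < n) {l : ℝ} (hl : 0 < l) :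
    (Real.log l + 1) * ∫ ω, sp.increment e f k ω ^ 2 ∂μ -
        l * (∫ ω, |sp.increment e f k ω| ∂μ) ^ 2 ≤
      ∑ i ∈ Finset.range n, c (e.symm i) * ∫ ω,
        (sp.avgDeriv e D (k + 1) (e.symm i) ω - sp.avgDeriv e D k (e.symm i) ω) ^ 2 ∂μ :=
  hR.log_add_one_mul_le_of_dependsOn e
    ((sp.measurableL2_avg _ hf).sub (sp.measurableL2_avg _ hf)) (sp.dependsOn_increment e f hk)
    (D := fun j ω => sp.avgDeriv e D (k + 1) j ω - sp.avgDeriv e D k j ω)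
    (fun j => hR.sub (hR.avgDeriv e (hfD j) _) (hR.avgDeriv e (hfD j) _)) hl

lemma log_add_one_mul_avg_initialCoords_le (hR : sp.IsDerivation c R) (hc : ∀ j, 0 ≤ c j)
    (e : ι ≃ ℕ) (hf : MeasurableL2 f μ) (hfD : ∀ j, R j f (D j)) {l : ℝ} (hl : 0 < l) (n : ℕ) :
    (Real.log l + 1) * (∫ ω, sp.avg (initialCoords e n) f ω ^ 2 ∂μ - (∫ ω, f ω ∂μ) ^ 2) ≤
      ∑ k ∈ Finset.range n, c (e.symm k) * ∫ ω, D (e.symm k) ω ^ 2 ∂μ +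
        l * ∑ k ∈ Finset.range n, (∫ ω, |f ω - sp.avg {e.symm k}ᶜ f ω| ∂μ) ^ 2 := by
  have hdiff : ∑ k ∈ Finset.range n, (∫ ω, |sp.increment e f k ω| ∂μ) ^ 2 ≤
      ∑ k ∈ Finset.range n, (∫ ω, |f ω - sp.avg {e.symm k}ᶜ f ω| ∂μ) ^ 2 :=
    Finset.sum_le_sum fun k _ => pow_le_pow_left₀ (integral_nonneg fun ω => abs_nonneg _)
      (sp.integral_abs_increment_le e hf k) 2
  have hderiv : ∑ k ∈ Finset.range n, ∑ i ∈ Finset.range n, c (e.symm i) * ∫ ω,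
        (sp.avgDeriv e D (k + 1) (e.symm i) ω - sp.avgDeriv e D k (e.symm i) ω) ^ 2 ∂μ ≤
      ∑ i ∈ Finset.range n, c (e.symm i) * ∫ ω, D (e.symm i) ω ^ 2 ∂μ := by
    rw [Finset.sum_comm]
    simp only [← Finset.mul_sum]
    exact Finset.sum_le_sum fun i _ => mul_le_mul_of_nonneg_left
      (sp.sum_integral_sq_avgDeriv_sub_le e (hR.measurableL2_deriv (hfD _)) n) (hc _)
  have hsum := Finset.sum_le_sum fun k (hk : k ∈ Finset.range n) =>
    hR.log_add_one_mul_increment_le e hf hfD (Finset.mem_range.1 hk) hl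
  rw [Finset.sum_sub_distrib, ← Finset.mul_sum, ← Finset.mul_sum,
    sp.sum_integral_sq_increment e hf] at hsum
  linarith [mul_le_mul_of_nonneg_left hdiff hl.le]

/-- The modified Poincaré inequality before the optimisation over `l`, whose optimal value is
`Var f / ∑ ‖Δ_j f‖₁²`. -/
theorem modified_poincare (hR : sp.IsDerivation c R) (hc : ∀ j, 0 ≤ c j) (e : ι ≃ ℕ)
    (hgen : mΩ ≤ ⨆ j, sp.sigmaAlgebra {j}) (hf : MeasurableL2 f μ) (hfD : ∀ j, R j f (D j))
    {E B : ℝ} (hE : ∀ s : Finset ι, ∑ j ∈ s, c j * ∫ ω, D j ω ^ 2 ∂μ ≤ E)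
    (hB : ∀ s : Finset ι, ∑ j ∈ s, (∫ ω, |f ω - sp.avg {j}ᶜ f ω| ∂μ) ^ 2 ≤ B)
    {l : ℝ} (hl : 0 < l) :
    (Real.log l + 1) * (∫ ω, f ω ^ 2 ∂μ - (∫ ω, f ω ∂μ) ^ 2) ≤ E + l * B := by
  refine le_of_tendsto (((sp.tendsto_integral_sq_avg_initialCoords e hgen hf).sub_const
    _).const_mul _) (.of_forall fun n => ?_)
  have hEn := hE ((Finset.range n).map e.symm.toEmbedding)
  have hBn := mul_le_mul_of_nonneg_left (hB ((Finset.range n).map e.symm.toEmbedding)) hl.le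
  rw [Finset.sum_map] at hEn hBn
  exact (hR.log_add_one_mul_avg_initialCoords_le hc e hf hfD hl n).trans (add_le_add hEn hBn)

end IsDerivation

end Splicing

/-! ### The logarithmic Sobolev inequality on the two-point space -/

lemma convexOn_sinh : ConvexOn ℝ (Set.Ici 0) Real.sinh := by
  refine MonotoneOn.convexOn_of_deriv (convex_Ici 0) Real.continuous_sinh.continuousOn
    Real.differentiable_sinh.differentiableOn ?_
  rw [interior_Ici, Real.deriv_sinh]
  intro x hx y hy hxy
  rwa [Real.cosh_le_cosh, abs_of_pos hx, abs_of_pos hy]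

lemma mul_sinh_le_mul_sinh {y z : ℝ} (hy : 0 ≤ y) (hyz : y ≤ z) :
    z * Real.sinh y ≤ y * Real.sinh z := by
  rcases hy.eq_or_lt with rfl | hy
  · simp
  have hz := hy.trans_le hyz
  have h := convexOn_sinh.2 (Set.self_mem_Ici (a := (0 : ℝ))) (Set.mem_Ici.2 hz.le)
    (show 0 ≤ 1 - y / z by rw [sub_nonneg, div_le_one hz]; exact hyz)
    (show 0 ≤ y / z by positivity) (by ring)
  simp only [smul_eq_mul, mul_zero, zero_add, Real.sinh_zero, div_mul_cancel₀ y hz.ne'] at h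
  calc z * Real.sinh y ≤ z * (y / z * Real.sinh z) := by gcongr
    _ = y * Real.sinh z := by field_simp

/-- The log-odds of a probability `s`. -/
noncomputable def logit (s : ℝ) : ℝ := Real.log s - Real.log (1 - s)

lemma logit_le_logit {s t : ℝ} (h : 0 < s) (hst : s ≤ t) (h1 : t < 1) : logit s ≤ logit t :=
  sub_le_sub (Real.log_le_log h hst) (Real.log_le_log (by linarith) (by linarith))

lemma logit_nonneg {s : ℝ} (h : 1 / 2 ≤ s) (h1 : s < 1) : 0 ≤ logit s :=
  sub_nonneg.2 (Real.log_le_log (by linarith) (by linarith))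

lemma logit_pos {s : ℝ} (h : 1 / 2 < s) (h1 : s < 1) : 0 < logit s :=
  sub_pos.2 (Real.log_lt_log (by linarith) (by linarith))

lemma two_mul_sinh_logit {s : ℝ} (h0 : 0 < s) (h1 : s < 1) :
    2 * Real.sinh (logit s / 2) = (2 * s - 1) / √(s * (1 - s)) := by
  have h1' : 0 < 1 - s := by linarith
  have hhalf : logit s / 2 = Real.log (√s / √(1 - s)) := by
    rw [Real.log_div (by positivity) (by positivity), Real.log_sqrt h0.le, Real.log_sqrt h1'.le,
      logit]
    ring
  have hs := Real.sq_sqrt h0.le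
  have hs' := Real.sq_sqrt h1'.le
  rw [hhalf, Real.sinh_log (by positivity), Real.sqrt_mul h0.le, inv_div]
  field_simp
  rw [hs, hs']
  ring

lemma logit_mul_sinh_logit_le {x y : ℝ} (hx : 1 / 2 ≤ x) (hxy : x ≤ y) (hy : y < 1) :
    logit y * (2 * Real.sinh (logit x / 2)) ≤ logit x * (2 * Real.sinh (logit y / 2)) := by
  have hlogit := logit_nonneg hx (hxy.trans_lt hy)
  have h := mul_sinh_le_mul_sinh (y := logit x / 2) (z := logit y / 2) (by linarith)
    (by linarith [logit_le_logit (by linarith) hxy hy])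
  linarith

lemma two_mul_sinh_logit_pos {s : ℝ} (h : 1 / 2 < s) (h1 : s < 1) :
    0 < 2 * Real.sinh (logit s / 2) :=
  mul_pos two_pos (Real.sinh_pos_iff.2 (by linarith [logit_pos h h1]))

/-- The deficit in the two-point logarithmic Sobolev inequality up to an affine function of `s`,
where `s` is the fraction of the second moment carried by one of the points. -/
noncomputable def entropyDeficit (K s : ℝ) : ℝ := Real.binEntropy s - 2 * K * √(s * (1 - s))

lemma entropyDeficit_one_sub (K s : ℝ) : entropyDeficit K (1 - s) = entropyDeficit K s := by
  rw [entropyDeficit, Real.binEntropy_one_sub, sub_sub_cancel, mul_comm (1 - s), entropyDeficit]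

lemma continuous_entropyDeficit (K : ℝ) : Continuous (entropyDeficit K) := by
  have := Real.binEntropy_continuous
  unfold entropyDeficit
  fun_prop

lemma hasDerivAt_entropyDeficit (K : ℝ) {s : ℝ} (h0 : 0 < s) (h1 : s < 1) :
    HasDerivAt (entropyDeficit K) (K * (2 * Real.sinh (logit s / 2)) - logit s) s := by
  have h1' : 0 < 1 - s := by linarith
  have hprod : HasDerivAt (fun s : ℝ => s * (1 - s)) (1 - 2 * s) s := by
    refine ((hasDerivAt_id' s).mul ((hasDerivAt_id' s).const_sub 1)).congr_deriv ?_
    ring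
  have hsqrt := (hprod.sqrt (by positivity)).const_mul (2 * K)
  refine ((Real.hasDerivAt_binEntropy h0.ne' h1.ne).sub hsqrt).congr_deriv ?_
  rw [two_mul_sinh_logit h0 h1, logit]
  have : 0 < √(s * (1 - s)) := by positivity
  field_simp
  ring

section Minimum

variable {q K : ℝ} (hq : 1 / 2 ≤ q) (hq1 : q < 1)
  (hK : K * (2 * Real.sinh (logit q / 2)) = logit q)

include hq1 hK

lemma mul_two_mul_sinh_logit_le_logit {x : ℝ} (hx : 1 / 2 < x) (hxq : x < q) :
    K * (2 * Real.sinh (logit x / 2)) ≤ logit x := by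
  have hslope := logit_mul_sinh_logit_le hx.le hxq.le hq1
  nth_rewrite 1 [← hK] at hslope
  refine le_of_mul_le_mul_right ?_ (two_mul_sinh_logit_pos (hx.trans hxq) hq1)
  linarith

include hq

/-- At `q = 1/2` the equation `hK` is void, and `K = 1` is its limit. -/
lemma logit_le_mul_two_mul_sinh_logit (hK_half : q = 1 / 2 → K = 1) {x : ℝ} (hqx : q < x)
    (hx : x < 1) : logit x ≤ K * (2 * Real.sinh (logit x / 2)) := by
  rcases hq.eq_or_lt with hhalf | hhalf
  · rw [hK_half hhalf.symm]
    linarith [Real.self_le_sinh_iff.2 (by linarith [logit_nonneg (hq.trans hqx.le) hx] :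
      0 ≤ logit x / 2)]
  · have hslope := logit_mul_sinh_logit_le hq hqx.le hx
    nth_rewrite 2 [← hK] at hslope
    refine le_of_mul_le_mul_right ?_ (two_mul_sinh_logit_pos hhalf hq1)
    linarith

lemma entropyDeficit_le (hK_half : q = 1 / 2 → K = 1) {s : ℝ} (hs : 0 < s) (hs1 : s < 1) :
    entropyDeficit K q ≤ entropyDeficit K s := by
  wlog hs2 : 1 / 2 ≤ s generalizing s
  · simpa only [entropyDeficit_one_sub] using
      this (s := 1 - s) (by linarith) (by linarith) (by linarith)
  have hcont := continuous_entropyDeficit K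
  rcases le_total s q with hsq | hqs
  · have hanti : AntitoneOn (entropyDeficit K) (Set.Icc (1 / 2) q) := by
      refine antitoneOn_of_hasDerivWithinAt_nonpos (convex_Icc _ _) hcont.continuousOn
        (f' := fun s => K * (2 * Real.sinh (logit s / 2)) - logit s) ?_ ?_ <;>
        rw [interior_Icc] <;> intro x hx
      · exact (hasDerivAt_entropyDeficit K (by linarith [hx.1])
          (hx.2.trans hq1)).hasDerivWithinAt
      · exact sub_nonpos.2 (mul_two_mul_sinh_logit_le_logit hq1 hK hx.1 hx.2)
    exact hanti ⟨hs2, hsq⟩ ⟨hq, le_rfl⟩ hsq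
  · have hmono : MonotoneOn (entropyDeficit K) (Set.Ico q 1) := by
      refine monotoneOn_of_hasDerivWithinAt_nonneg (convex_Ico _ _) hcont.continuousOn
        (f' := fun s => K * (2 * Real.sinh (logit s / 2)) - logit s) ?_ ?_ <;>
        rw [interior_Ico] <;> intro x hx
      · exact (hasDerivAt_entropyDeficit K (by linarith [hx.1]) hx.2).hasDerivWithinAt
      · exact sub_nonneg.2 (logit_le_mul_two_mul_sinh_logit hq hq1 hK hK_half hx.1 hx.2)
    exact hmono ⟨le_rfl, hq1⟩ ⟨hqs, hs1⟩ hqs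

end Minimum

lemma cLS_mul_two_mul_sub_one (p : ℝ) : cLS p * (2 * p - 1) = logit p := by
  rw [cLS, logit]
  split_ifs with h
  · subst h; norm_num
  · have : p - (1 - p) ≠ 0 := fun h' => h (by linarith)
    field_simp
    ring

lemma cLS_one_sub (p : ℝ) : cLS (1 - p) = cLS p := by
  rw [cLS, cLS]
  by_cases h : p = 1 / 2
  · rw [if_pos h, if_pos (by linarith)]
  · rw [if_neg h, if_neg (fun h' => h (by linarith)), sub_sub_cancel, ← neg_div_neg_eq]
    ring_nf

lemma entropyDeficit_cLS_le {p s : ℝ} (hp0 : 0 < p) (hp1 : p < 1) (hs0 : 0 < s) (hs1 : s < 1) :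
    entropyDeficit (cLS p * √(p * (1 - p))) p ≤ entropyDeficit (cLS p * √(p * (1 - p))) s := by
  wlog hp : 1 / 2 ≤ p generalizing p
  · have h := this (p := 1 - p) (by linarith) (by linarith) (by linarith)
    rwa [entropyDeficit_one_sub, cLS_one_sub, sub_sub_cancel, mul_comm (1 - p)] at h
  refine entropyDeficit_le hp hp1 ?_ ?_ hs0 hs1
  · have : 0 < √(p * (1 - p)) := Real.sqrt_pos.2 (mul_pos hp0 (by linarith))
    rw [two_mul_sinh_logit hp0 hp1, ← cLS_mul_two_mul_sub_one p]
    field_simp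
  · rintro rfl
    rw [show (1 / 2 : ℝ) * (1 - 1 / 2) = (1 / 2) ^ 2 by norm_num, Real.sqrt_sq (by norm_num), cLS,
      if_pos rfl]
    norm_num

lemma binary_relative_entropy_le {p s : ℝ} (hp0 : 0 < p) (hp1 : p < 1) (hs0 : 0 < s)
    (hs1 : s < 1) :
    s * (Real.log s - Real.log p) + (1 - s) * (Real.log (1 - s) - Real.log (1 - p)) ≤
      cLS p * (s * (1 - p) + p * (1 - s) - 2 * (√(p * (1 - p)) * √(s * (1 - s)))) := by
  have hdeficit := entropyDeficit_cLS_le hp0 hp1 hs0 hs1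
  have hsq : √(p * (1 - p)) * √(p * (1 - p)) = p * (1 - p) :=
    Real.mul_self_sqrt (mul_pos hp0 (by linarith)).le
  have hlogit : (s - p) * (cLS p * (2 * p - 1)) = (s - p) * (Real.log p - Real.log (1 - p)) := by
    rw [cLS_mul_two_mul_sub_one, logit]
  have hconst : 2 * (cLS p * √(p * (1 - p))) * √(p * (1 - p)) = 2 * (cLS p * (p * (1 - p))) := by
    linear_combination 2 * cLS p * hsq
  simp only [entropyDeficit, Real.binEntropy, Real.log_inv] at hdeficit
  linarith

lemma two_point_logSobolev {p : ℝ} (hp0 : 0 < p) (hp1 : p < 1) {a b : ℝ} (ha : 0 < a)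
    (hb : 0 < b) :
    p * (a ^ 2 * Real.log (a ^ 2)) + (1 - p) * (b ^ 2 * Real.log (b ^ 2)) -
      (p * a ^ 2 + (1 - p) * b ^ 2) * Real.log (p * a ^ 2 + (1 - p) * b ^ 2) ≤
      cLS p * (p * (1 - p) * (a - b) ^ 2) := by
  have hp1' : 0 < 1 - p := by linarith
  set m := p * a ^ 2 + (1 - p) * b ^ 2 with hm
  have hm0 : 0 < m := by positivity
  obtain ⟨s, hs⟩ : ∃ s, p * a ^ 2 = m * s := ⟨p * a ^ 2 / m, by field_simp⟩
  have hs' : (1 - p) * b ^ 2 = m * (1 - s) := by rw [mul_sub, ← hs, hm]; ring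
  have hs0 : 0 < s := pos_of_mul_pos_right (hs ▸ by positivity) hm0.le
  have hs0' : 0 < 1 - s := pos_of_mul_pos_right (hs' ▸ by positivity) hm0.le
  have hloga : Real.log (a ^ 2) = Real.log s + Real.log m - Real.log p := by
    have h := congrArg Real.log hs
    rw [Real.log_mul hp0.ne' (by positivity), Real.log_mul hm0.ne' hs0.ne'] at h
    linarith
  have hlogb : Real.log (b ^ 2) = Real.log (1 - s) + Real.log m - Real.log (1 - p) := by
    have h := congrArg Real.log hs'
    rw [Real.log_mul hp1'.ne' (by positivity), Real.log_mul hm0.ne' hs0'.ne'] at h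
    linarith
  have hcross : m * (√(p * (1 - p)) * √(s * (1 - s))) = p * (1 - p) * (a * b) := by
    have hsq : p * (1 - p) * (s * (1 - s)) = (p * (1 - p) * (a * b) / m) ^ 2 := by
      field_simp
      linear_combination -(m * (1 - s)) * hs - p * a ^ 2 * hs'
    rw [← Real.sqrt_mul (by positivity), hsq, Real.sqrt_sq (by positivity)]
    field_simp
  have hsquare : m * (s * (1 - p) + p * (1 - s) - 2 * (√(p * (1 - p)) * √(s * (1 - s)))) =
      p * (1 - p) * (a - b) ^ 2 := by
    linear_combination -(1 - p) * hs - p * hs' - 2 * hcross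
  have h := mul_le_mul_of_nonneg_left (binary_relative_entropy_le hp0 hp1 hs0 (by linarith)) hm0.le
  rw [mul_left_comm m, hsquare] at h
  refine le_of_eq_of_le ?_ h
  linear_combination (Real.log (a ^ 2)) * hs + (Real.log (b ^ 2)) * hs' + m * s * hloga +
    m * (1 - s) * hlogb

/-! ### Splicing of the coordinates in a product -/

section PiSplicing

variable {ι X : Type*}

open scoped Classical in
lemma piecewise_preimage_pi (A : Set ι) (s : Finset ι) (t : ι → Set X) :
    (fun q : (ι → X) × (ι → X) => A.piecewise q.1 q.2) ⁻¹' (s : Set ι).pi t =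
      (s.filter (· ∈ A) : Set ι).pi t ×ˢ (s.filter (· ∉ A) : Set ι).pi t := by
  ext q
  simp only [Set.mem_preimage, Set.mem_pi, Set.mem_prod, Finset.coe_filter, Set.mem_ofPred_eq,
    Finset.mem_coe, ← forall_and]
  refine forall_congr' fun i => ?_
  by_cases hA : i ∈ A <;> simp [hA]

variable [MeasurableSpace X]

open scoped Classical in
lemma measurable_piecewise (A : Set ι) :
    Measurable (fun q : (ι → X) × (ι → X) => A.piecewise q.1 q.2) := by
  refine measurable_pi_lambda _ fun i => ?_
  by_cases hA : i ∈ A <;> simp only [Set.piecewise, hA, if_true, if_false] <;> fun_prop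

open scoped Classical in
lemma measurePreserving_piecewise (A : Set ι) (m : Measure X) [IsProbabilityMeasure m] :
    MeasurePreserving (fun q : (ι → X) × (ι → X) => A.piecewise q.1 q.2)
      ((Measure.infinitePi fun _ => m).prod (Measure.infinitePi fun _ => m))
      (Measure.infinitePi fun _ => m) := by
  refine ⟨measurable_piecewise A, Measure.eq_infinitePi _ fun s t ht => ?_⟩
  rw [Measure.map_apply (measurable_piecewise A) (.pi s.countable_toSet fun _ _ => ht _),
    piecewise_preimage_pi, Measure.prod_prod, Measure.infinitePi_pi _ (fun i _ => ht i),
    Measure.infinitePi_pi _ (fun i _ => ht i)]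
  exact Finset.prod_filter_mul_prod_filter_not s (· ∈ A) _

open scoped Classical in
/-- The splicing of an infinite power of a probability measure, with one index for each factor. -/
noncomputable def piSplicing (ι : Type*) {X : Type*} [MeasurableSpace X] (m : Measure X)
    [IsProbabilityMeasure m] : Splicing ι (Measure.infinitePi fun _ : ι => m) where
  splice A a b := Set.piecewise A a b
  measurePreserving A := measurePreserving_piecewise A m
  splice_splice A B a b c := by
    ext i
    by_cases hA : i ∈ A <;> by_cases hB : i ∈ B <;> simp [hA, hB]
  splice_right A a b c := by ext i; by_cases hA : i ∈ A <;> simp [hA]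
  splice_univ a b := by ext; simp
  splice_empty a b := by ext; simp

variable (m : Measure X) [IsProbabilityMeasure m]

lemma piSplicing_splice_apply_of_mem {A : Set ι} {i : ι} (hi : i ∈ A) (a b : ι → X) :
    (piSplicing ι m).splice A a b i = a i := by
  simp [piSplicing, hi]

variable [DecidableEq ι]

lemma piSplicing_splice_compl_singleton (i : ι) (a b : ι → X) :
    (piSplicing ι m).splice {i}ᶜ a b = Function.update a i (b i) := by
  simp only [piSplicing, Set.piecewise_compl, Set.piecewise_singleton]

lemma piSplicing_splice_update_of_mem {A : Set ι} {i : ι} (hi : i ∈ A) (a b : ι → X) (x : X) :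
    (piSplicing ι m).splice A (Function.update a i x) b =
      Function.update ((piSplicing ι m).splice A a b) i x := by
  funext j
  rcases eq_or_ne j i with rfl | hj
  · simp [piSplicing, hi]
  · by_cases hjA : j ∈ A <;> simp [piSplicing, hj, hjA]

lemma piSplicing_splice_update_of_notMem {A : Set ι} {i : ι} (hi : i ∉ A) (a b : ι → X) (x : X) :
    (piSplicing ι m).splice A (Function.update a i x) b = (piSplicing ι m).splice A a b := by
  funext j
  by_cases hj : j ∈ A
  · simp [piSplicing, hj, ne_of_mem_of_not_mem hj hi]
  · simp [piSplicing, hj]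

end PiSplicing

section Prod

variable {X Y : Type*} [MeasurableSpace X] [MeasurableSpace Y] {μ : Measure X} {ν : Measure Y}
  [SFinite μ] [SFinite ν]

lemma measurePreserving_prodMap_prodProdProdComm {φ : X × X → X} {ψ : Y × Y → Y}
    (hφ : MeasurePreserving φ (μ.prod μ) μ) (hψ : MeasurePreserving ψ (ν.prod ν) ν) :
    MeasurePreserving (fun q : (X × Y) × (X × Y) => (φ (q.1.1, q.2.1), ψ (q.1.2, q.2.2)))
      ((μ.prod ν).prod (μ.prod ν)) (μ.prod ν) := by
  have hassoc := measurePreserving_prodAssoc μ ν (μ.prod ν)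
  have hassoc_left := (MeasurePreserving.id μ).prod (measurePreserving_prodAssoc ν μ ν).symm
  have hswap := (MeasurePreserving.id μ).prod
    ((Measure.measurePreserving_swap (μ := ν) (ν := μ)).prod (MeasurePreserving.id ν))
  have hassoc_right := (MeasurePreserving.id μ).prod (measurePreserving_prodAssoc μ ν ν)
  have hassoc_symm := (measurePreserving_prodAssoc μ μ (ν.prod ν)).symm
  exact (hφ.prod hψ).comp
    (hassoc_symm.comp (hassoc_right.comp (hswap.comp (hassoc_left.comp hassoc))))

/-- The splicing of a product of two spaces, each of them spliced. -/
def Splicing.prod {ι κ : Type*} (sp : Splicing ι μ) (sq : Splicing κ ν) :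
    Splicing (ι ⊕ κ) (μ.prod ν) where
  splice A a b := (sp.splice (Sum.inl ⁻¹' A) a.1 b.1, sq.splice (Sum.inr ⁻¹' A) a.2 b.2)
  measurePreserving A := measurePreserving_prodMap_prodProdProdComm
    (sp.measurePreserving (Sum.inl ⁻¹' A)) (sq.measurePreserving (Sum.inr ⁻¹' A))
  splice_splice _ _ _ _ _ := Prod.ext (sp.splice_splice _ _ _ _ _) (sq.splice_splice _ _ _ _ _)
  splice_right _ _ _ _ := Prod.ext (sp.splice_right _ _ _ _) (sq.splice_right _ _ _ _)
  splice_univ _ _ := Prod.ext (sp.splice_univ _ _) (sq.splice_univ _ _)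
  splice_empty _ _ := Prod.ext (sp.splice_empty _ _) (sq.splice_empty _ _)

end Prod

instance {S : Type*} (p : unitInterval) : IsProbabilityMeasure (bernoulliPi S p) := by
  unfold bernoulliPi; infer_instance

instance {S : Type*} (p : unitInterval) (ν : Measure ℝ) [IsProbabilityMeasure ν] :
    IsProbabilityMeasure (mixedProduct S p ν) := by
  unfold mixedProduct; infer_instance

/-- The splicing of `{0,1}^S × ℝ^ℕ`, whose coordinates are indexed by `S ⊕ ℕ`. -/
noncomputable def mixedSplicing (S : Type*) (p : unitInterval) (ν : Measure ℝ)
    [IsProbabilityMeasure ν] : Splicing (S ⊕ ℕ) (mixedProduct S p ν) :=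
  (piSplicing S (bernoulliMeasure true false p)).prod (piSplicing ℕ ν)

section MixedSplicing

variable {S : Type*} (p : unitInterval) (ν : Measure ℝ) [IsProbabilityMeasure ν]

lemma mixedSplicing_splice_compl_inl [DecidableEq S] (s : S) (a b : (S → Bool) × (ℕ → ℝ)) :
    (mixedSplicing S p ν).splice {Sum.inl s}ᶜ a b = (Function.update a.1 s (b.1 s), a.2) := by
  have hinl : Sum.inl ⁻¹' ({Sum.inl s}ᶜ : Set (S ⊕ ℕ)) = {s}ᶜ := by ext; simp
  have hinr : Sum.inr ⁻¹' ({Sum.inl s}ᶜ : Set (S ⊕ ℕ)) = Set.univ := by ext; simp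
  simp only [mixedSplicing, Splicing.prod, hinl, hinr, piSplicing_splice_compl_singleton,
    Splicing.splice_univ]

lemma mixedSplicing_splice_compl_inr (i : ℕ) (a b : (S → Bool) × (ℕ → ℝ)) :
    (mixedSplicing S p ν).splice {Sum.inr i}ᶜ a b = (a.1, Function.update a.2 i (b.2 i)) := by
  have hinl : Sum.inl ⁻¹' ({Sum.inr i}ᶜ : Set (S ⊕ ℕ)) = Set.univ := by ext; simp
  have hinr : Sum.inr ⁻¹' ({Sum.inr i}ᶜ : Set (S ⊕ ℕ)) = {i}ᶜ := by ext; simp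
  simp only [mixedSplicing, Splicing.prod, hinl, hinr, piSplicing_splice_compl_singleton,
    Splicing.splice_univ]

lemma mixedSplicing_splice_update_of_mem {i : ℕ} {A : Set (S ⊕ ℕ)} (hi : Sum.inr i ∈ A)
    (a b : (S → Bool) × (ℕ → ℝ)) (t : ℝ) :
    (mixedSplicing S p ν).splice A (a.1, Function.update a.2 i t) b =
      (((mixedSplicing S p ν).splice A a b).1,
        Function.update ((mixedSplicing S p ν).splice A a b).2 i t) :=
  Prod.ext rfl (piSplicing_splice_update_of_mem ν (A := Sum.inr ⁻¹' A) hi _ _ _)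

lemma mixedSplicing_splice_update_of_notMem {i : ℕ} {A : Set (S ⊕ ℕ)} (hi : Sum.inr i ∉ A)
    (a b : (S → Bool) × (ℕ → ℝ)) (t : ℝ) :
    (mixedSplicing S p ν).splice A (a.1, Function.update a.2 i t) b =
      (mixedSplicing S p ν).splice A a b :=
  Prod.ext rfl (piSplicing_splice_update_of_notMem ν (A := Sum.inr ⁻¹' A) hi _ _ _)

lemma measurePreserving_eval_fst (s : S) :
    MeasurePreserving (fun ω : (S → Bool) × (ℕ → ℝ) => ω.1 s) (mixedProduct S p ν)
      (bernoulliMeasure true false p) :=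
  (measurePreserving_eval_infinitePi (fun _ : S => bernoulliMeasure true false p) s).comp
    measurePreserving_fst

lemma measurePreserving_eval_snd (i : ℕ) :
    MeasurePreserving (fun ω : (S → Bool) × (ℕ → ℝ) => ω.2 i) (mixedProduct S p ν) ν :=
  (measurePreserving_eval_infinitePi (fun _ : ℕ => ν) i).comp measurePreserving_snd

lemma measurePreserving_update_fst [DecidableEq S] (s : S) :
    MeasurePreserving
      (fun q : ((S → Bool) × (ℕ → ℝ)) × Bool => (Function.update q.1.1 s q.2, q.1.2))
      ((mixedProduct S p ν).prod (bernoulliMeasure true false p)) (mixedProduct S p ν) := by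
  have hsplice := (mixedSplicing S p ν).measurePreserving {Sum.inl s}ᶜ
  simp only [mixedSplicing_splice_compl_inl] at hsplice
  have heval := (MeasurePreserving.id (mixedProduct S p ν)).prod
    (measurePreserving_eval_fst p ν s)
  refine ⟨by fun_prop, ?_⟩
  rw [← heval.map_eq, Measure.map_map (by fun_prop) heval.measurable]
  exact hsplice.map_eq

lemma measurePreserving_update_snd (i : ℕ) :
    MeasurePreserving
      (fun q : ((S → Bool) × (ℕ → ℝ)) × ℝ => (q.1.1, Function.update q.1.2 i q.2))
      ((mixedProduct S p ν).prod ν) (mixedProduct S p ν) := by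
  have hsplice := (mixedSplicing S p ν).measurePreserving {Sum.inr i}ᶜ
  simp only [mixedSplicing_splice_compl_inr] at hsplice
  have heval := (MeasurePreserving.id (mixedProduct S p ν)).prod
    (measurePreserving_eval_snd (S := S) p ν i)
  refine ⟨by fun_prop, ?_⟩
  rw [← heval.map_eq, Measure.map_map (by fun_prop) heval.measurable]
  exact hsplice.map_eq

lemma avg_compl_inl [DecidableEq S] (s : S) (f : (S → Bool) × (ℕ → ℝ) → ℝ)
    (ω : (S → Bool) × (ℕ → ℝ)) :
    (mixedSplicing S p ν).avg {Sum.inl s}ᶜ f ω =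
      ∫ b, f (Function.update ω.1 s b, ω.2) ∂(bernoulliMeasure true false p) := by
  have heval := measurePreserving_eval_fst p ν s
  simp only [Splicing.avg, mixedSplicing_splice_compl_inl]
  rw [← heval.map_eq, integral_map heval.measurable.aemeasurable]
  exact (measurable_of_countable (fun b => f (Function.update ω.1 s b, ω.2))).aestronglyMeasurable

lemma avg_compl_inr (i : ℕ) {f : (S → Bool) × (ℕ → ℝ) → ℝ} (hf : Measurable f)
    (ω : (S → Bool) × (ℕ → ℝ)) :
    (mixedSplicing S p ν).avg {Sum.inr i}ᶜ f ω = ∫ t, realSlice f i ω t ∂ν := by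
  have heval := measurePreserving_eval_snd (S := S) p ν i
  have hslice : Measurable (realSlice f i ω) :=
    hf.comp (by fun_prop : Measurable fun t => (ω.1, Function.update ω.2 i t))
  have h := integral_map (μ := mixedProduct S p ν) heval.measurable.aemeasurable
    hslice.aestronglyMeasurable
  rw [heval.map_eq] at h
  simp only [Splicing.avg, mixedSplicing_splice_compl_inr]
  exact h.symm

lemma comap_le_iSup_sigmaAlgebra_mixedSplicing {X : Type*} [MeasurableSpace X] (j : S ⊕ ℕ)
    {g : (S → Bool) × (ℕ → ℝ) → X} (hg : Measurable g)
    (hj : ∀ a b, g ((mixedSplicing S p ν).splice {j} a b) = g a) :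
    MeasurableSpace.comap g inferInstance ≤ ⨆ j, (mixedSplicing S p ν).sigmaAlgebra {j} := by
  refine le_trans ?_ (le_iSup (fun j => (mixedSplicing S p ν).sigmaAlgebra {j}) j)
  rintro _ ⟨t, ht, rfl⟩
  exact ⟨hg ht, fun a b => by simp only [Set.mem_preimage, hj]⟩

lemma le_iSup_sigmaAlgebra_mixedSplicing :
    (inferInstance : MeasurableSpace ((S → Bool) × (ℕ → ℝ))) ≤
      ⨆ j, (mixedSplicing S p ν).sigmaAlgebra {j} := by
  change MeasurableSpace.comap _ (⨆ s : S, MeasurableSpace.comap _ _) ⊔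
    MeasurableSpace.comap _ (⨆ i : ℕ, MeasurableSpace.comap _ _) ≤ _
  simp only [MeasurableSpace.comap_iSup, MeasurableSpace.comap_comp]
  refine sup_le (iSup_le fun s => ?_) (iSup_le fun i => ?_)
  · exact comap_le_iSup_sigmaAlgebra_mixedSplicing p ν (Sum.inl s) (g := fun ω => ω.1 s)
      (by fun_prop) (fun a b => piSplicing_splice_apply_of_mem (bernoulliMeasure true false p)
        (by simp) _ _)
  · exact comap_le_iSup_sigmaAlgebra_mixedSplicing p ν (Sum.inr i) (g := fun ω => ω.2 i)
      (by fun_prop) (fun a b => piSplicing_splice_apply_of_mem ν (by simp) _ _)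

end MixedSplicing

lemma entropy_comp {X Y : Type*} {mX : MeasurableSpace X} {mY : MeasurableSpace Y} {μ : Measure X}
    {ν : Measure Y} {φ : X → Y} (hφ : MeasurePreserving φ μ ν) {F : Y → ℝ} (hF : Measurable F) :
    entropy (fun x => F (φ x)) μ = entropy F ν := by
  have hlog : Measurable fun y => F y * Real.log (F y) := hF.mul hF.log
  rw [entropy, entropy, ← hφ.map_eq,
    integral_map hφ.measurable.aemeasurable hF.aestronglyMeasurable,
    integral_map hφ.measurable.aemeasurable hlog.aestronglyMeasurable]

lemma Splicing.mulLogAvg_univ_sub_le {ι Ω : Type*} {mΩ : MeasurableSpace Ω} {μ : Measure Ω}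
    (sp : Splicing ι μ) [IsProbabilityMeasure μ] (A : Set ι) {F G : Ω → ℝ} (hF : Measurable F)
    {m M : ℝ} (hm0 : 0 < m) (hb : ∀ ω, F ω ∈ Set.Icc m M) (hG : Integrable G μ)
    (h : ∀ᵐ ω ∂μ, entropy (fun η => F (sp.splice A ω η)) μ ≤ G ω) :
    sp.mulLogAvg Set.univ F - sp.mulLogAvg A F ≤ ∫ ω, G ω ∂μ := by
  have hlog : Measurable fun ω => F ω * Real.log (F ω) := hF.mul hF.log
  have hi : Integrable (fun ω => F ω * Real.log (F ω)) μ :=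
    integrable_mul_log_of_mem_Icc (.of_mem_Icc m M hF.aemeasurable (.of_forall hb)) hF hm0 hb
  have hi' := sp.integrable_avg A hi
  have hA := integrable_mul_log_of_mem_Icc
    (sp.integrable_avg A (.of_mem_Icc m M hF.aemeasurable (.of_forall hb)))
    (sp.measurable_avg A hF) hm0 (sp.avg_mem_Icc A hF hb)
  rw [mulLogAvg_univ, mulLogAvg, ← sp.integral_avg A hlog hi, ← integral_sub hi' hA]
  exact integral_mono_ae (hi'.sub hA) hG h

lemma cLS_nonneg {p : ℝ} (hp0 : 0 < p) (hp1 : p < 1) : 0 ≤ cLS p := by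
  rw [cLS]
  split_ifs with h
  · norm_num
  rcases le_total p (1 - p) with h1 | h1
  · exact div_nonneg_of_nonpos (sub_nonpos.2 (Real.log_le_log hp0 h1)) (sub_nonpos.2 h1)
  · exact div_nonneg (sub_nonneg.2 (Real.log_le_log (by linarith) h1)) (sub_nonneg.2 h1)

lemma bernoulli_logSobolev {p : unitInterval} (hp0 : 0 < (p : ℝ)) (hp1 : (p : ℝ) < 1)
    {u : Bool → ℝ} (hu : ∀ b, 0 < u b) :
    entropy (fun b => u b ^ 2) (bernoulliMeasure true false p) ≤
      cLS p * (p * (1 - p) * (u true - u false) ^ 2) := by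
  simp only [entropy, integral_bernoulliMeasure, smul_eq_mul]
  exact two_point_logSobolev hp0 hp1 (hu _) (hu _)

/-! ### The Gaussian logarithmic Sobolev inequality -/

section EntropyLimits

variable {Ω : Type*} {mΩ : MeasurableSpace Ω} {μ : Measure Ω} {m M : ℝ}

lemma abs_mul_log_le_of_mem_Icc {x : ℝ} (hm : 0 < m) (hx : x ∈ Set.Icc m M) :
    |x * Real.log x| ≤ M * max |Real.log m| |Real.log M| := by
  rw [abs_mul, abs_of_pos (hm.trans_le hx.1)]
  exact mul_le_mul hx.2 (abs_log_le_max_of_mem_Icc hm hx) (abs_nonneg _)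
    ((hm.trans_le hx.1).le.trans hx.2)

lemma tendsto_entropy_of_ae_tendsto [IsProbabilityMeasure μ] {F : Ω → ℝ} {Φ : ℕ → Ω → ℝ}
    (hm : 0 < m) (hΦ : ∀ n, Measurable (Φ n)) (hΦb : ∀ n ω, Φ n ω ∈ Set.Icc m M)
    (hlim : ∀ᵐ ω ∂μ, Tendsto (fun n => Φ n ω) atTop (𝓝 (F ω))) :
    Tendsto (fun n => entropy (Φ n) μ) atTop (𝓝 (entropy F μ)) := by
  have hF : ∀ᵐ ω ∂μ, m ≤ F ω := hlim.mono fun ω hω => ge_of_tendsto' hω fun n => (hΦb n ω).1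
  have hmean : Tendsto (fun n => ∫ ω, Φ n ω ∂μ) atTop (𝓝 (∫ ω, F ω ∂μ)) :=
    tendsto_integral_of_dominated_convergence (fun _ => M) (fun n => (hΦ n).aestronglyMeasurable)
      (integrable_const _) (fun n => .of_forall fun ω => by
        rw [Real.norm_of_nonneg (hm.le.trans (hΦb n ω).1)]; exact (hΦb n ω).2) hlim
  have hmul_log : Tendsto (fun n => ∫ ω, Φ n ω * Real.log (Φ n ω) ∂μ) atTop
      (𝓝 (∫ ω, F ω * Real.log (F ω) ∂μ)) := by
    refine tendsto_integral_of_dominated_convergence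
      (fun _ => M * max |Real.log m| |Real.log M|)
      (fun n => ((hΦ n).mul (hΦ n).log).aestronglyMeasurable) (integrable_const _)
      (fun n => .of_forall fun ω => abs_mul_log_le_of_mem_Icc hm (hΦb n ω)) ?_
    filter_upwards [hlim, hF] with ω hω hFω
    exact hω.mul (hω.log (hm.trans_le hFω).ne')
  have hmean_pos : m ≤ ∫ ω, F ω ∂μ := by
    refine ge_of_tendsto' hmean fun n => ?_
    simpa using integral_mono (μ := μ) (integrable_const m)
      (.of_mem_Icc m M (hΦ n).aemeasurable (.of_forall (hΦb n))) fun ω => (hΦb n ω).1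
  exact hmul_log.sub (hmean.mul (hmean.log (hm.trans_le hmean_pos).ne'))

end EntropyLimits

/-- The parameter of a fair coin. -/
noncomputable def fair : unitInterval := ⟨1 / 2, by norm_num, by norm_num⟩

/-- The law of an infinite sequence of independent fair coins. -/
noncomputable def coins : Measure (ℕ → Bool) :=
  Measure.infinitePi fun _ : ℕ => bernoulliMeasure true false fair

instance : IsProbabilityMeasure coins := by unfold coins; infer_instance

/-- The sign attached to the outcome of a coin. -/
def coinSign (b : Bool) : ℝ := if b then 1 else -1

/-- The random walk driven by the coins after `n` steps, normalised to have variance one. -/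
noncomputable def coinWalk (n : ℕ) (ω : ℕ → Bool) : ℝ :=
  (√n)⁻¹ * ∑ k ∈ Finset.range n, coinSign (ω k)

section CoinWalk

lemma measurable_coinSign : Measurable coinSign := measurable_of_countable _

lemma measurable_coinWalk (n : ℕ) : Measurable (coinWalk n) := by
  have := measurable_coinSign
  unfold coinWalk
  fun_prop

lemma measurePreserving_coin (k : ℕ) :
    MeasurePreserving (fun ω : ℕ → Bool => ω k) coins (bernoulliMeasure true false fair) :=
  measurePreserving_eval_infinitePi _ k

lemma integral_comp_coin (k : ℕ) (g : Bool → ℝ) :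
    ∫ ω, g (ω k) ∂coins = (g true + g false) / 2 := by
  have hk := measurePreserving_coin k
  rw [← integral_map hk.measurable.aemeasurable
    (measurable_of_countable _).aestronglyMeasurable, hk.map_eq, integral_bernoulliMeasure]
  simp only [fair, smul_eq_mul]
  ring

lemma identDistrib_coinSign (k : ℕ) :
    IdentDistrib (fun ω : ℕ → Bool => coinSign (ω k)) (fun ω => coinSign (ω 0)) coins coins :=
  (IdentDistrib.mk (measurePreserving_coin k).aemeasurable (measurePreserving_coin 0).aemeasurable
    ((measurePreserving_coin k).map_eq.trans (measurePreserving_coin 0).map_eq.symm)).comp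
    measurable_coinSign

lemma tendsto_integral_coinWalk {φ : ℝ → ℝ} (hφ : Continuous φ) {C : ℝ} (hC : ∀ x, |φ x| ≤ C) :
    Tendsto (fun n => ∫ ω, φ (coinWalk n ω) ∂coins) atTop
      (𝓝 (∫ x, φ x ∂(gaussianReal 0 1))) := by
  have hmean : ∫ ω, coinSign (ω 0) ∂coins = 0 := by
    rw [integral_comp_coin 0 coinSign]; norm_num [coinSign]
  have hvar : ∫ ω, coinSign (ω 0) ^ 2 ∂coins = 1 := by
    rw [integral_comp_coin 0 fun b => coinSign b ^ 2]; norm_num [coinSign]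
  have hclt := tendstoInDistribution_inv_sqrt_mul_sum (P := coins)
    (X := fun k ω => coinSign (ω k)) (HasLaw.id (μ := gaussianReal 0 1)) hmean hvar
    (iIndepFun_infinitePi fun _ => measurable_coinSign) identDistrib_coinSign
  have h := ProbabilityMeasure.tendsto_iff_forall_integral_tendsto.1 hclt.tendsto
    (BoundedContinuousFunction.ofNormedAddCommGroup φ hφ C hC)
  simp only [BoundedContinuousFunction.coe_ofNormedAddCommGroup, ProbabilityMeasure.coe_mk,
    Measure.map_id] at h
  exact h.congr fun n => integral_map (measurable_coinWalk n).aemeasurable hφ.aestronglyMeasurable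

lemma tendsto_entropy_coinWalk {F : ℝ → ℝ} (hF : Continuous F) {m M : ℝ} (hm : 0 < m)
    (hb : ∀ x, F x ∈ Set.Icc m M) :
    Tendsto (fun n => entropy (fun ω => F (coinWalk n ω)) coins) atTop
      (𝓝 (entropy F (gaussianReal 0 1))) := by
  have hpos : ∀ x, 0 < F x := fun x => hm.trans_le (hb x).1
  have hmul_log := tendsto_integral_coinWalk (hF.mul (hF.log fun x => (hpos x).ne'))
    fun x => abs_mul_log_le_of_mem_Icc hm (hb x)
  have hmean := tendsto_integral_coinWalk hF (C := M) fun x => by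
    rw [abs_of_pos (hpos x)]; exact (hb x).2
  have hmean_pos : 0 < ∫ x, F x ∂(gaussianReal 0 1) :=
    integral_pos_of_forall_pos (.of_mem_Icc m M hF.measurable.aemeasurable (.of_forall hb)) hpos
  exact hmul_log.sub (hmean.mul (hmean.log hmean_pos.ne'))

lemma abs_coinSign_sub_le (a b : Bool) : |coinSign a - coinSign b| ≤ 2 := by
  cases a <;> cases b <;> norm_num [coinSign]

lemma abs_coinWalk_update_sub_le {n k : ℕ} (hk : k < n) (ω : ℕ → Bool) (b : Bool) :
    |coinWalk n (Function.update ω k b) - coinWalk n ω| ≤ 2 * (√n)⁻¹ := by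
  rw [coinWalk, coinWalk, ← mul_sub, ← Finset.sum_sub_distrib,
    Finset.sum_eq_single_of_mem k (Finset.mem_range.2 hk)
      (fun i _ hi => by rw [Function.update_of_ne hi, sub_self]), Function.update_self, abs_mul,
    abs_of_nonneg (by positivity), mul_comm]
  gcongr
  exact abs_coinSign_sub_le _ _

lemma dependsOn_coinWalk (n : ℕ) :
    (piSplicing ℕ (bernoulliMeasure true false fair)).DependsOn
      (initialCoords (Equiv.refl ℕ) n) (coinWalk n) := fun a b => by
  unfold coinWalk
  congr 1
  refine Finset.sum_congr rfl fun k hk => ?_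
  rw [piSplicing_splice_apply_of_mem _ (show k ∈ initialCoords (Equiv.refl ℕ) n from
    Finset.mem_range.1 hk)]

section Entropy

variable {n : ℕ} {w g : ℝ → ℝ} {m M : ℝ}

lemma entropy_coinWalk_update_le {k : ℕ} (hk : k < n) (hw : ∀ x, 0 < w x)
    (hlip : ∀ x y z, |y - x| ≤ 2 * (√n)⁻¹ → |z - x| ≤ 2 * (√n)⁻¹ →
      |w y - w z| ≤ g x * |y - z|) (ω : ℕ → Bool) :
    entropy (fun b => w (coinWalk n (Function.update ω k b)) ^ 2)
      (bernoulliMeasure true false fair) ≤ 2 / n * g (coinWalk n ω) ^ 2 := by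
  set y := fun b => coinWalk n (Function.update ω k b)
  have hjump : |y true - y false| ≤ 2 * (√n)⁻¹ := by
    simpa only [Function.update_idem] using
      abs_coinWalk_update_sub_le hk (Function.update ω k false) true
  have hincr : (w (y true) - w (y false)) ^ 2 ≤ g (coinWalk n ω) ^ 2 * (2 * (√n)⁻¹) ^ 2 := by
    refine (sq_le_sq.2 ((hlip (coinWalk n ω) _ _ (abs_coinWalk_update_sub_le hk ω true)
      (abs_coinWalk_update_sub_le hk ω false)).trans (le_abs_self _))).trans ?_
    rw [mul_pow, sq_abs]
    exact mul_le_mul_of_nonneg_left (sq_le_sq.2 (hjump.trans (le_abs_self _))) (sq_nonneg _)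
  have hLS : cLS (fair : ℝ) = 2 := by norm_num [cLS, fair]
  have hfair : (fair : ℝ) = 1 / 2 := rfl
  calc entropy (fun b => w (y b) ^ 2) (bernoulliMeasure true false fair)
      ≤ 2 * (1 / 2 * (1 - 1 / 2) * (w (y true) - w (y false)) ^ 2) := by
        have h := bernoulli_logSobolev (p := fair) (by norm_num [hfair]) (by norm_num [hfair])
          fun b => hw (y b)
        rwa [hLS, hfair] at h
    _ ≤ 2 * (1 / 2 * (1 - 1 / 2) * (g (coinWalk n ω) ^ 2 * (2 * (√n)⁻¹) ^ 2)) := by gcongr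
    _ = 2 / n * g (coinWalk n ω) ^ 2 := by
        rw [mul_pow, inv_pow, Real.sq_sqrt (Nat.cast_nonneg n)]; ring

/-- The `n` coins contribute at most `2 / n * g²` each. -/
lemma entropy_coinWalk_le (hn : 0 < n) (hw : Measurable w) (hm : 0 < m)
    (hb : ∀ x, w x ∈ Set.Icc m M) (hg : Integrable (fun ω => g (coinWalk n ω) ^ 2) coins)
    (hlip : ∀ x y z, |y - x| ≤ 2 * (√n)⁻¹ → |z - x| ≤ 2 * (√n)⁻¹ →
      |w y - w z| ≤ g x * |y - z|) :
    entropy (fun ω => w (coinWalk n ω) ^ 2) coins ≤ 2 * ∫ ω, g (coinWalk n ω) ^ 2 ∂coins := by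
  let sp : Splicing ℕ coins := piSplicing ℕ (bernoulliMeasure true false fair)
  have hF : Measurable fun ω => w (coinWalk n ω) ^ 2 :=
    (hw.comp (measurable_coinWalk n)).pow_const 2
  have hFb : ∀ ω, w (coinWalk n ω) ^ 2 ∈ Set.Icc (m ^ 2) (M ^ 2) := fun ω =>
    sq_mem_Icc_sq hm (hb _)
  have hdep : sp.DependsOn (initialCoords (Equiv.refl ℕ) n) fun ω => w (coinWalk n ω) ^ 2 :=
    fun a b => congrArg (fun x => w x ^ 2) (dependsOn_coinWalk n a b)
  have hcoin : ∀ k ∈ Finset.range n,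
      sp.mulLogAvg Set.univ (fun ω => w (coinWalk n ω) ^ 2) -
        sp.mulLogAvg {k}ᶜ (fun ω => w (coinWalk n ω) ^ 2) ≤
      ∫ ω, 2 / n * g (coinWalk n ω) ^ 2 ∂coins := fun k hk => by
    refine sp.mulLogAvg_univ_sub_le {k}ᶜ hF (pow_pos hm 2) hFb (hg.const_mul _)
      (.of_forall fun ω => ?_)
    simp only [sp, piSplicing_splice_compl_singleton]
    refine (entropy_comp (measurePreserving_coin k) (measurable_of_countable
      fun b => w (coinWalk n (Function.update ω k b)) ^ 2)).trans_le ?_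
    exact entropy_coinWalk_update_le (Finset.mem_range.1 hk)
      (fun x => hm.trans_le (hb x).1) hlip ω
  refine (sp.entropy_le_sum_of_dependsOn (Equiv.refl ℕ) n hdep hF (pow_pos hm 2) hFb).trans
    ((Finset.sum_le_sum hcoin).trans_eq ?_)
  have hn' : (n : ℝ) ≠ 0 := Nat.cast_ne_zero.2 hn.ne'
  rw [Finset.sum_const, Finset.card_range, nsmul_eq_mul, integral_const_mul]
  field_simp

end Entropy

end CoinWalk

section GaussianLogSobolev

variable {w v : ℝ → ℝ} {m M : ℝ}

lemma abs_sub_le_of_forall_abs_le_add {δ ε : ℝ}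
    (hw : ∀ s t, |w t - w s| ≤ |∫ r in s..t, v r|)
    (hv : ∀ x y, |x - y| ≤ δ → |v x| ≤ |v y| + ε) {x y z : ℝ} (hy : |y - x| ≤ δ)
    (hz : |z - x| ≤ δ) : |w y - w z| ≤ (|v x| + ε) * |y - z| := by
  refine (hw z y).trans (intervalIntegral.norm_integral_le_of_norm_le_const (f := v)
    (C := |v x| + ε) fun r hr => hv r x ?_)
  rw [← Real.dist_eq, ← Metric.mem_closedBall, Real.closedBall_eq_Icc] at hy hz ⊢
  exact Set.ordConnected_Icc.uIcc_subset hz hy (Set.uIoc_subset_uIcc hr)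

lemma continuous_of_abs_sub_le_abs_intervalIntegral {C : ℝ} (hC : ∀ x, |v x| ≤ C)
    (hw : ∀ s t, |w t - w s| ≤ |∫ r in s..t, v r|) : Continuous w :=
  (LipschitzWith.of_dist_le' (K := C) fun x y => by
    rw [Real.dist_eq, Real.dist_eq]
    exact (hw y x).trans
      (intervalIntegral.norm_integral_le_of_norm_le_const (f := v) fun r _ => hC r)).continuous

lemma entropy_gaussianReal_le_of_hasCompactSupport_add {ε : ℝ} (hε : 0 < ε) (hv : Continuous v)
    (hvs : HasCompactSupport v) (hw : ∀ s t, |w t - w s| ≤ |∫ r in s..t, v r|) (hm : 0 < m)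
    (hb : ∀ x, w x ∈ Set.Icc m M) :
    entropy (fun x => w x ^ 2) (gaussianReal 0 1) ≤
      2 * ∫ x, (|v x| + ε) ^ 2 ∂(gaussianReal 0 1) := by
  obtain ⟨C, hC⟩ : ∃ C, ∀ x, |v x| ≤ C := hvs.exists_bound_of_continuous hv
  have hwc := continuous_of_abs_sub_le_abs_intervalIntegral hC hw
  have hvc : Continuous fun x => (|v x| + ε) ^ 2 := (hv.abs.add continuous_const).pow 2
  have hvb : ∀ x, |(|v x| + ε) ^ 2| ≤ (C + ε) ^ 2 := fun x => by
    rw [abs_of_nonneg (sq_nonneg _)]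
    exact pow_le_pow_left₀ (by positivity) (add_le_add_left (hC x) ε) 2
  obtain ⟨δ, hδ, huc⟩ := Metric.uniformContinuous_iff.1
    (hvs.uniformContinuous_of_continuous hv) ε hε
  have hjump : Tendsto (fun n : ℕ => 2 * (√(n : ℝ))⁻¹) atTop (𝓝 0) := by
    simpa using (tendsto_inv_atTop_zero.comp
      (Real.tendsto_sqrt_atTop.comp tendsto_natCast_atTop_atTop)).const_mul 2
  refine le_of_tendsto_of_tendsto
    (tendsto_entropy_coinWalk (hwc.pow 2) (pow_pos hm 2) fun x => sq_mem_Icc_sq hm (hb x))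
    ((tendsto_integral_coinWalk hvc hvb).const_mul 2) ?_
  filter_upwards [hjump.eventually (gt_mem_nhds hδ), eventually_gt_atTop 0] with n hn hn0
  refine entropy_coinWalk_le hn0 hwc.measurable hm hb
    (.of_bound (hvc.measurable.comp (measurable_coinWalk n)).aestronglyMeasurable _
      (.of_forall fun ω => hvb _)) fun x y z hy hz =>
    abs_sub_le_of_forall_abs_le_add hw (fun r s hrs => ?_) hy hz
  have hrs' := huc (a := r) (b := s) (by rw [Real.dist_eq]; exact hrs.trans_lt hn)
  rw [Real.dist_eq] at hrs'
  linarith [abs_sub_abs_le_abs_sub (v r) (v s)]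

lemma entropy_gaussianReal_le_of_hasCompactSupport (hv : Continuous v)
    (hvs : HasCompactSupport v) (hw : ∀ s t, |w t - w s| ≤ |∫ r in s..t, v r|) (hm : 0 < m)
    (hb : ∀ x, w x ∈ Set.Icc m M) :
    entropy (fun x => w x ^ 2) (gaussianReal 0 1) ≤ 2 * ∫ x, v x ^ 2 ∂(gaussianReal 0 1) := by
  obtain ⟨C, hC⟩ : ∃ C, ∀ x, |v x| ≤ C := hvs.exists_bound_of_continuous hv
  have hlim : Tendsto (fun k : ℕ => ∫ x, (|v x| + 1 / (k + 1 : ℝ)) ^ 2 ∂(gaussianReal 0 1)) atTop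
      (𝓝 (∫ x, v x ^ 2 ∂(gaussianReal 0 1))) := by
    refine tendsto_integral_of_dominated_convergence (fun _ => (C + 1) ^ 2)
      (fun k => ((hv.abs.add continuous_const).pow 2).aestronglyMeasurable) (integrable_const _)
      (fun k => .of_forall fun x => ?_) (.of_forall fun x => ?_)
    · rw [Real.norm_of_nonneg (sq_nonneg _)]
      refine pow_le_pow_left₀ (by positivity) (add_le_add (hC x) ?_) 2
      rw [div_le_one (by positivity)]
      linarith [(Nat.cast_nonneg k : (0 : ℝ) ≤ k)]
    · simpa using ((tendsto_one_div_add_atTop_nhds_zero_nat (𝕜 := ℝ)).const_add |v x|).pow 2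
  exact ge_of_tendsto' (hlim.const_mul 2) fun k =>
    entropy_gaussianReal_le_of_hasCompactSupport_add (by positivity) hv hvs hw hm hb

end GaussianLogSobolev

section Approximation

lemma integral_sq_eq_toReal_eLpNorm_sq {Ω : Type*} [MeasurableSpace Ω] {μ : Measure Ω}
    {f : Ω → ℝ} (hf : MemLp f 2 μ) : ∫ x, f x ^ 2 ∂μ = (eLpNorm f 2 μ).toReal ^ 2 := by
  have h := eLpNorm_nnreal_pow_eq_lintegral (μ := μ) (f := f) (p := 2) two_ne_zero
  simp only [NNReal.coe_ofNat, ENNReal.rpow_ofNat, ENNReal.coe_ofNat] at h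
  rw [← ENNReal.toReal_pow, h, ← ofReal_integral_sq hf,
    ENNReal.toReal_ofReal (integral_nonneg fun x => sq_nonneg _)]

lemma tendsto_integral_sq_of_tendsto_eLpNorm_sub {Ω : Type*} [MeasurableSpace Ω] {μ : Measure Ω}
    {f : Ω → ℝ} {w : ℕ → Ω → ℝ} (hf : MemLp f 2 μ) (hw : ∀ n, MemLp (w n) 2 μ)
    (h : Tendsto (fun n => eLpNorm (w n - f) 2 μ) atTop (𝓝 0)) :
    Tendsto (fun n => ∫ x, w n x ^ 2 ∂μ) atTop (𝓝 (∫ x, f x ^ 2 ∂μ)) := by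
  simpa only [Lp.norm_toLp, ← integral_sq_eq_toReal_eLpNorm_sq hf,
    ← integral_sq_eq_toReal_eLpNorm_sq (hw _)] using
    ((Lp.tendsto_Lp_iff_tendsto_eLpNorm'' w hw f hf).2 h).norm.pow 2

lemma exists_restrict_uIoc_le_smul_gaussianReal (a b : ℝ) : ∃ C : ℝ≥0∞, C ≠ ∞ ∧
    volume.restrict (Set.uIoc a b) ≤ C • gaussianReal 0 1 := by
  obtain ⟨x₀, -, hx₀⟩ := (isCompact_uIcc (a := a) (b := b)).exists_isMinOn Set.nonempty_uIcc
    (f := gaussianPDFReal 0 1) (by unfold gaussianPDFReal; fun_prop)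
  set c := gaussianPDFReal 0 1 x₀
  have hc : 0 < c := gaussianPDFReal_pos 0 1 x₀ one_ne_zero
  refine ⟨(ENNReal.ofReal c)⁻¹, by simp [hc], Measure.le_iff.2 fun s hs => ?_⟩
  have hmul : ENNReal.ofReal c * volume (s ∩ Set.uIoc a b) ≤ gaussianReal 0 1 s := by
    rw [← setLIntegral_const]
    refine le_trans ?_ (measure_mono (Set.inter_subset_left (s := s) (t := Set.uIoc a b)))
    rw [gaussianReal_apply 0 one_ne_zero]
    exact setLIntegral_mono (measurable_gaussianPDF 0 1) fun x hx =>
      ENNReal.ofReal_le_ofReal (hx₀ (Set.uIoc_subset_uIcc hx.2))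
  rw [Measure.restrict_apply hs, Measure.smul_apply, smul_eq_mul]
  exact (ENNReal.mul_le_iff_le_inv (by simpa using hc) ENNReal.ofReal_ne_top).1 hmul

lemma intervalIntegrable_of_gaussianReal {v : ℝ → ℝ} (hv : Integrable v (gaussianReal 0 1))
    (a b : ℝ) : IntervalIntegrable v volume a b := by
  obtain ⟨C, hC, h⟩ := exists_restrict_uIoc_le_smul_gaussianReal a b
  rw [intervalIntegrable_iff]
  exact (hv.smul_measure hC).mono_measure h

lemma tendsto_intervalIntegral_of_tendsto_eLpNorm_sub {v : ℝ → ℝ} {w : ℕ → ℝ → ℝ} {p : ℝ≥0∞}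
    (hp : 1 ≤ p) (hv : MemLp v p (gaussianReal 0 1)) (hw : ∀ n, MemLp (w n) p (gaussianReal 0 1))
    (h : Tendsto (fun n => eLpNorm (w n - v) p (gaussianReal 0 1)) atTop (𝓝 0)) (s t : ℝ) :
    Tendsto (fun n => ∫ r in s..t, w n r) atTop (𝓝 (∫ r in s..t, v r)) := by
  obtain ⟨C, hC, hle⟩ := exists_restrict_uIoc_le_smul_gaussianReal s t
  have hint : ∀ {f : ℝ → ℝ}, MemLp f p (gaussianReal 0 1) →
      IntegrableOn f (Set.uIoc s t) := fun hf =>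
    intervalIntegrable_iff.1 (intervalIntegrable_of_gaussianReal (hf.integrable hp) s t)
  have hbound : ∀ n, ∫⁻ r in Set.uIoc s t, ‖w n r - v r‖ₑ ≤
      C * eLpNorm (w n - v) p (gaussianReal 0 1) := fun n => by
    refine (lintegral_mono' hle le_rfl).trans ?_
    rw [lintegral_smul_measure, smul_eq_mul]
    exact mul_le_mul' le_rfl ((eLpNorm_one_eq_lintegral_enorm (f := w n - v)).symm.trans_le
      (eLpNorm_le_eLpNorm_of_exponent_le hp ((hw n).sub hv).1))
  have hlim : Tendsto (fun n => ∫⁻ r in Set.uIoc s t, ‖w n r - v r‖ₑ) atTop (𝓝 0) :=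
    tendsto_of_tendsto_of_tendsto_of_le_of_le tendsto_const_nhds
      (by simpa using ENNReal.Tendsto.const_mul h (Or.inr hC)) (fun _ => zero_le) hbound
  simp only [intervalIntegral.intervalIntegral_eq_integral_uIoc]
  exact (tendsto_integral_of_L1 v (hint hv).1 (.of_forall fun n => hint (hw n)) hlim).const_smul _

lemma exists_continuous_hasCompactSupport_tendsto {v : ℝ → ℝ} {μ : Measure ℝ} [μ.Regular]
    {p : ℝ≥0∞} (hp : p ≠ ∞) (hv : MemLp v p μ) :
    ∃ w : ℕ → ℝ → ℝ, (∀ n, Continuous (w n)) ∧ (∀ n, HasCompactSupport (w n)) ∧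
      (∀ n, MemLp (w n) p μ) ∧ Tendsto (fun n => eLpNorm (w n - v) p μ) atTop (𝓝 0) := by
  choose w hws hwv hwc hwp using fun n : ℕ =>
    hv.exists_hasCompactSupport_eLpNorm_sub_le hp (ε := ((n + 1 : ℝ≥0∞))⁻¹) (by simp)
  have hlim : Tendsto (fun n : ℕ => ((n + 1 : ℝ≥0∞))⁻¹) atTop (𝓝 0) := by
    simpa using (tendsto_add_atTop_iff_nat 1).2 ENNReal.tendsto_inv_nat_nhds_zero
  exact ⟨w, hwc, hws, hwp, tendsto_of_tendsto_of_tendsto_of_le_of_le tendsto_const_nhds hlim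
    (fun _ => zero_le) fun n => by rw [eLpNorm_sub_comm]; exact hwv n⟩

lemma gaussian_logSobolev {u v : ℝ → ℝ} (hv : MemLp v 2 (gaussianReal 0 1)) {s : ℝ}
    (hu : ∀ᵐ t ∂(gaussianReal 0 1), u t - u s = ∫ r in s..t, v r)
    {θ : ℝ → ℝ} {m M : ℝ} (hθ : LipschitzWith 1 θ) (hm : 0 < m) (hb : ∀ x, θ x ∈ Set.Icc m M) :
    entropy (fun x => θ (u x) ^ 2) (gaussianReal 0 1) ≤
      2 * ∫ x, v x ^ 2 ∂(gaussianReal 0 1) := by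
  obtain ⟨w, hwc, hws, hw2, hwv⟩ :=
    exists_continuous_hasCompactSupport_tendsto ENNReal.ofNat_ne_top hv
  have hwi : ∀ n a b, IntervalIntegrable (w n) volume a b := fun n => (hwc n).intervalIntegrable
  let U : ℕ → ℝ → ℝ := fun n t => u s + ∫ r in s..t, w n r
  have hUw : ∀ n a b, |θ (U n b) - θ (U n a)| ≤ |∫ r in a..b, w n r| := fun n a b => by
    rw [← intervalIntegral.integral_interval_sub_left (hwi n s b) (hwi n s a)]
    simpa [Real.dist_eq, U] using hθ.dist_le_mul (U n b) (U n a)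
  have hUu : ∀ᵐ t ∂(gaussianReal 0 1),
      Tendsto (fun n => θ (U n t) ^ 2) atTop (𝓝 (θ (u t) ^ 2)) := by
    filter_upwards [hu] with t ht
    have hlim := (tendsto_intervalIntegral_of_tendsto_eLpNorm_sub one_le_two hv hw2 hwv
      s t).const_add (u s)
    rw [← ht, add_sub_cancel] at hlim
    exact ((hθ.continuous.tendsto _).comp hlim).pow 2
  have hU : ∀ n, Measurable fun x => θ (U n x) ^ 2 := fun n =>
    (hθ.continuous.comp
      ((intervalIntegral.continuous_primitive (hwi n) s).const_add _)).measurable.pow_const 2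
  exact le_of_tendsto_of_tendsto
    (tendsto_entropy_of_ae_tendsto (pow_pos hm 2) hU (fun n x => sq_mem_Icc_sq hm (hb _)) hUu)
    ((tendsto_integral_sq_of_tendsto_eLpNorm_sub hv hw2 hwv).const_mul 2)
    (.of_forall fun n => entropy_gaussianReal_le_of_hasCompactSupport (hwc n) (hws n) (hUw n) hm
      fun x => hb _)

end Approximation

/-! ### Derivations on the mixed product -/

lemma Splicing.ae_ae_splice {ι Ω X : Type*} {mΩ : MeasurableSpace Ω} {mX : MeasurableSpace X}
    {μ : Measure Ω} [IsProbabilityMeasure μ] {ρ : Measure X} [SFinite ρ] (sp : Splicing ι μ)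
    (A : Set ι) {P : Ω × X → Prop} (h : ∀ᵐ q ∂(μ.prod ρ), P q) :
    ∀ᵐ q ∂(μ.prod ρ), ∀ᵐ ω' ∂μ, P (sp.splice A q.1 ω', q.2) := by
  have hswap := (measurePreserving_prodAssoc μ μ ρ).symm.comp
    (((MeasurePreserving.id μ).prod (Measure.measurePreserving_swap (μ := ρ) (ν := μ))).comp
      (measurePreserving_prodAssoc μ ρ μ))
  have hsplice := ((sp.measurePreserving A).prod (MeasurePreserving.id ρ)).comp hswap
  exact Measure.ae_ae_of_ae_prod (hsplice.quasiMeasurePreserving.ae h)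

lemma Splicing.avg_congr_ae {ι Ω : Type*} {mΩ : MeasurableSpace Ω} {μ : Measure Ω}
    (sp : Splicing ι μ) [SFinite μ] (A : Set ι) {f g : Ω → ℝ} (h : f =ᵐ[μ] g) :
    sp.avg A f =ᵐ[μ] sp.avg A g := by
  filter_upwards [Measure.ae_ae_of_ae_prod ((sp.measurePreserving A).quasiMeasurePreserving.ae h)]
    with ω hω
  exact integral_congr_ae hω

section RealSlices

variable {S : Type*} (p : unitInterval) (ν : Measure ℝ) {f : (S → Bool) × (ℕ → ℝ) → ℝ}

lemma measurable_realSlice (hf : Measurable f) (i : ℕ) (ω : (S → Bool) × (ℕ → ℝ)) :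
    Measurable (realSlice f i ω) :=
  hf.comp (by fun_prop : Measurable fun t => (ω.1, Function.update ω.2 i t))

variable [IsProbabilityMeasure ν]

lemma ae_memLp_realSlice (i : ℕ) (hf : MeasurableL2 f (mixedProduct S p ν)) :
    ∀ᵐ ω ∂(mixedProduct S p ν), MemLp (realSlice f i ω) 2 ν := by
  have hsq := ((measurePreserving_update_snd p ν i).integrable_comp_of_integrable
    hf.integrable_sq).prod_right_ae
  filter_upwards [hsq] with ω hω
  exact (memLp_two_iff_integrable_sq
    (measurable_realSlice hf.measurable i ω).aestronglyMeasurable).2 hω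

lemma realSlice_avg {i : ℕ} {A : Set (S ⊕ ℕ)} (hi : Sum.inr i ∈ A)
    (f : (S → Bool) × (ℕ → ℝ) → ℝ) (ω : (S → Bool) × (ℕ → ℝ)) (t : ℝ) :
    realSlice ((mixedSplicing S p ν).avg A f) i ω t =
      ∫ ω', realSlice f i ((mixedSplicing S p ν).splice A ω ω') t ∂(mixedProduct S p ν) := by
  simp only [realSlice, Splicing.avg, mixedSplicing_splice_update_of_mem p ν hi]

lemma ae_integrable_realSlice_splice (i : ℕ) (A : Set (S ⊕ ℕ))
    (hf : Integrable f (mixedProduct S p ν)) :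
    ∀ᵐ ω ∂(mixedProduct S p ν), Integrable
      (fun z : ℝ × ((S → Bool) × (ℕ → ℝ)) =>
        realSlice f i ((mixedSplicing S p ν).splice A ω z.2) z.1)
      (ν.prod (mixedProduct S p ν)) := by
  set μ := mixedProduct S p ν
  have hswap := (measurePreserving_prodAssoc μ μ ν).symm.comp
    ((MeasurePreserving.id μ).prod (Measure.measurePreserving_swap (μ := ν) (ν := μ)))
  have hslice := (measurePreserving_update_snd p ν i).comp
    ((((mixedSplicing S p ν).measurePreserving A).prod (MeasurePreserving.id ν)).comp hswap)
  exact (hslice.integrable_comp_of_integrable hf).prod_right_ae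

lemma ae_integrable_realSlice_splice_right {i : ℕ} {A : Set (S ⊕ ℕ)} (hi : Sum.inr i ∈ A)
    (hf : Integrable f (mixedProduct S p ν)) :
    ∀ᵐ q ∂((mixedProduct S p ν).prod ν), Integrable
      (fun ω' => realSlice f i ((mixedSplicing S p ν).splice A q.1 ω') q.2)
      (mixedProduct S p ν) := by
  have h := (measurePreserving_update_snd p ν i).quasiMeasurePreserving.ae
    ((mixedSplicing S p ν).integrable_comp_splice A hf).prod_right_ae
  simpa only [realSlice, mixedSplicing_splice_update_of_mem p ν hi] using h

end RealSlices

section Primitive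

variable {S : Type*} (p : unitInterval)

/-- `D` is the derivative of `f` in the real coordinate `i`, in integrated form: almost surely,
the increments of the slices of `f` are the integrals of the slices of `D`. Quantifying over
almost all pairs of end points makes the notion stable under averages over other coordinates. -/
def IsPrimitive (ν : Measure ℝ) (i : ℕ) (f D : (S → Bool) × (ℕ → ℝ) → ℝ) : Prop :=
  ∀ᵐ q ∂((mixedProduct S p ν).prod (ν.prod ν)),
    realSlice f i q.1 q.2.2 - realSlice f i q.1 q.2.1 = ∫ r in q.2.1..q.2.2, realSlice D i q.1 r

variable {p} {i : ℕ} {f g D E : (S → Bool) × (ℕ → ℝ) → ℝ}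

lemma IsPrimitive.avg_zero {ν : Measure ℝ} [IsProbabilityMeasure ν] {A : Set (S ⊕ ℕ)}
    (hi : Sum.inr i ∉ A) (f : (S → Bool) × (ℕ → ℝ) → ℝ) :
    IsPrimitive p ν i ((mixedSplicing S p ν).avg A f) (fun _ => 0) :=
  .of_forall fun q => by
    simp [realSlice, Splicing.avg, mixedSplicing_splice_update_of_notMem p ν hi]

lemma IsPrimitive.sub (hD : MeasurableL2 D (mixedProduct S p γ))
    (hE : MeasurableL2 E (mixedProduct S p γ)) (hf : IsPrimitive p γ i f D)
    (hg : IsPrimitive p γ i g E) :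
    IsPrimitive p γ i (fun ω => f ω - g ω) (fun ω => D ω - E ω) := by
  have hfst := Measure.quasiMeasurePreserving_fst (μ := mixedProduct S p γ) (ν := (γ).prod γ)
  filter_upwards [hf, hg, hfst.ae (ae_memLp_realSlice p γ i hD),
    hfst.ae (ae_memLp_realSlice p γ i hE)] with q hf hg hD hE
  have h := intervalIntegral.integral_sub
    (intervalIntegrable_of_gaussianReal (hD.integrable one_le_two) q.2.1 q.2.2)
    (intervalIntegrable_of_gaussianReal (hE.integrable one_le_two) q.2.1 q.2.2)
  simp only [realSlice] at *
  rw [h, ← hf, ← hg]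
  ring

lemma IsPrimitive.avg {A : Set (S ⊕ ℕ)} (hf : Integrable f (mixedProduct S p γ))
    (hD : Integrable D (mixedProduct S p γ)) (h : IsPrimitive p γ i f D)
    (hi : Sum.inr i ∈ A) :
    IsPrimitive p γ i ((mixedSplicing S p γ).avg A f) ((mixedSplicing S p γ).avg A D) := by
  set μ := mixedProduct S p γ
  set sp := mixedSplicing S p γ
  have hfA := ae_integrable_realSlice_splice_right p γ hi hf
  have hfA₁ := ((MeasurePreserving.id μ).prod
    (measurePreserving_fst (μ := γ) (ν := γ))).quasiMeasurePreserving.ae hfA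
  have hfA₂ := ((MeasurePreserving.id μ).prod
    (measurePreserving_snd (μ := γ) (ν := γ))).quasiMeasurePreserving.ae hfA
  have hDA := (Measure.quasiMeasurePreserving_fst (μ := μ) (ν := (γ).prod γ)).ae
    (ae_integrable_realSlice_splice p γ i A hD)
  filter_upwards [sp.ae_ae_splice A h, hfA₁, hfA₂, hDA] with q hfD hfq₁ hfq₂ hDq
  obtain ⟨C, hC, hle⟩ := exists_restrict_uIoc_le_smul_gaussianReal q.2.1 q.2.2
  have hDint : Integrable (fun z : ℝ × ((S → Bool) × (ℕ → ℝ)) =>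
      realSlice D i (sp.splice A q.1 z.2) z.1)
      ((volume.restrict (Set.uIoc q.2.1 q.2.2)).prod μ) := by
    refine (hDq.smul_measure hC).mono_measure ?_
    rw [← Measure.prod_smul_left]
    exact Measure.prod_mono hle le_rfl
  calc realSlice (sp.avg A f) i q.1 q.2.2 - realSlice (sp.avg A f) i q.1 q.2.1
    _ = ∫ ω', (realSlice f i (sp.splice A q.1 ω') q.2.2 -
          realSlice f i (sp.splice A q.1 ω') q.2.1) ∂μ := by
        rw [realSlice_avg p γ hi, realSlice_avg p γ hi]
        exact (integral_sub hfq₂ hfq₁).symm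
    _ = ∫ ω', (∫ r in q.2.1..q.2.2, realSlice D i (sp.splice A q.1 ω') r) ∂μ :=
        integral_congr_ae hfD
    _ = ∫ r in q.2.1..q.2.2, (∫ ω', realSlice D i (sp.splice A q.1 ω') r ∂μ) :=
        (intervalIntegral_integral_swap hDint).symm
    _ = ∫ r in q.2.1..q.2.2, realSlice (sp.avg A D) i q.1 r := by
        simp only [sp, realSlice_avg p γ hi]; rfl

lemma IsPrimitive.logSobolev (hf : Measurable f) (hD : MeasurableL2 D (mixedProduct S p γ))
    (h : IsPrimitive p γ i f D) {θ : ℝ → ℝ} {m M : ℝ} (hθ : LipschitzWith 1 θ)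
    (hb : ∀ x, θ x ∈ Set.Icc m M) (hm : 0 < m) :
    (mixedSplicing S p γ).mulLogAvg Set.univ (fun ω => θ (f ω) ^ 2) -
      (mixedSplicing S p γ).mulLogAvg {Sum.inr i}ᶜ (fun ω => θ (f ω) ^ 2) ≤
      2 * ∫ ω, D ω ^ 2 ∂(mixedProduct S p γ) := by
  set sp := mixedSplicing S p γ
  have hFm : Measurable fun ω => θ (f ω) ^ 2 := (hθ.continuous.measurable.comp hf).pow_const 2
  rw [← sp.integral_avg {Sum.inr i}ᶜ (hD.measurable.pow_const 2) hD.integrable_sq,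
    ← integral_const_mul]
  refine sp.mulLogAvg_univ_sub_le _ hFm (pow_pos hm 2) (fun ω => sq_mem_Icc_sq hm (hb _))
    ((sp.integrable_avg _ hD.integrable_sq).const_mul 2) ?_
  have hae := Measure.ae_ae_of_ae_prod h
  filter_upwards [hae, ae_memLp_realSlice p γ i hD] with ω hfD hDω
  obtain ⟨s, hs⟩ := (Measure.ae_ae_of_ae_prod hfD).exists
  have hentropy := entropy_comp (measurePreserving_eval_snd (S := S) p γ i)
    (measurable_realSlice hFm i ω)
  simp only [sp, mixedSplicing_splice_compl_inr]
  rw [avg_compl_inr p γ i (hD.measurable.pow_const 2)]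
  exact hentropy.trans_le (gaussian_logSobolev hDω hs hθ hm hb)

end Primitive

section Influences

variable {S : Type*} [DecidableEq S] {p : unitInterval} {f : (S → Bool) × (ℕ → ℝ) → ℝ}

lemma deltaBit_eq_sub_avg (ν : Measure ℝ) [IsProbabilityMeasure ν]
    (f : (S → Bool) × (ℕ → ℝ) → ℝ) (s : S) :
    deltaBit p f s = fun ω => f ω - (mixedSplicing S p ν).avg {Sum.inl s}ᶜ f ω := by
  funext ω
  rw [avg_compl_inl]
  rfl

lemma avg_compl_inl_sq_deltaBit (ν : Measure ℝ) [IsProbabilityMeasure ν]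
    (f : (S → Bool) × (ℕ → ℝ) → ℝ) (s : S) (ω : (S → Bool) × (ℕ → ℝ)) :
    (mixedSplicing S p ν).avg {Sum.inl s}ᶜ (fun ω => deltaBit p f s ω ^ 2) ω =
      p * (1 - p) *
        (f (Function.update ω.1 s true, ω.2) - f (Function.update ω.1 s false, ω.2)) ^ 2 := by
  simp only [avg_compl_inl, deltaBit, Function.update_idem,
    integral_bernoulliMeasure, smul_eq_mul]
  ring

lemma measurableL2_deltaBit {ν : Measure ℝ} [IsProbabilityMeasure ν]
    (hf : MeasurableL2 f (mixedProduct S p ν)) (s : S) :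
    MeasurableL2 (deltaBit p f s) (mixedProduct S p ν) := by
  rw [deltaBit_eq_sub_avg ν]
  exact hf.sub ((mixedSplicing S p ν).measurableL2_avg _ hf)

lemma deltaBit_logSobolev {ν : Measure ℝ} [IsProbabilityMeasure ν] (hp0 : 0 < (p : ℝ))
    (hp1 : (p : ℝ) < 1) (s : S) (hf : MeasurableL2 f (mixedProduct S p ν)) {θ : ℝ → ℝ} {m M : ℝ}
    (hθ : LipschitzWith 1 θ) (hb : ∀ x, θ x ∈ Set.Icc m M) (hm : 0 < m) :
    (mixedSplicing S p ν).mulLogAvg Set.univ (fun ω => θ (f ω) ^ 2) -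
      (mixedSplicing S p ν).mulLogAvg {Sum.inl s}ᶜ (fun ω => θ (f ω) ^ 2) ≤
      cLS p * ∫ ω, deltaBit p f s ω ^ 2 ∂(mixedProduct S p ν) := by
  set sp := mixedSplicing S p ν
  have hΔ := measurableL2_deltaBit hf s
  have hFm : Measurable fun ω => θ (f ω) ^ 2 :=
    (hθ.continuous.measurable.comp hf.measurable).pow_const 2
  rw [← sp.integral_avg {Sum.inl s}ᶜ (hΔ.measurable.pow_const 2) hΔ.integrable_sq,
    ← integral_const_mul]
  refine sp.mulLogAvg_univ_sub_le _ hFm (pow_pos hm 2) (fun ω => sq_mem_Icc_sq hm (hb _))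
    ((sp.integrable_avg _ hΔ.integrable_sq).const_mul _) (.of_forall fun ω => ?_)
  let u : Bool → ℝ := fun b => f (Function.update ω.1 s b, ω.2)
  have hentropy := entropy_comp (measurePreserving_eval_fst p ν s)
    (measurable_of_countable fun b => θ (u b) ^ 2)
  have hcontract : (θ (u true) - θ (u false)) ^ 2 ≤ (u true - u false) ^ 2 :=
    sq_le_sq.2 (by simpa [Real.dist_eq] using hθ.dist_le_mul (u true) (u false))
  simp only [sp, mixedSplicing_splice_compl_inl]
  rw [avg_compl_inl_sq_deltaBit]
  refine hentropy.trans_le <|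
    (bernoulli_logSobolev hp0 hp1 fun b => hm.trans_le (hb (u b)).1).trans ?_
  exact mul_le_mul_of_nonneg_left
    (mul_le_mul_of_nonneg_left hcontract (mul_nonneg hp0.le (sub_nonneg.2 hp1.le)))
    (cLS_nonneg hp0 hp1)

lemma deltaReal_eq_sub_avg (ν : Measure ℝ) [IsProbabilityMeasure ν]
    {S : Type*} {f : (S → Bool) × (ℕ → ℝ) → ℝ} (hf : Measurable f) (i : ℕ) :
    deltaReal ν f i = fun ω => f ω - (mixedSplicing S p ν).avg {Sum.inr i}ᶜ f ω := by
  funext ω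
  rw [avg_compl_inr p ν i hf]
  rfl

lemma sumInfluences_eq_tsum {ν : Measure ℝ} [IsProbabilityMeasure ν]
    (hf : MeasurableL2 f (mixedProduct S p ν)) :
    sumInfluences p ν f = ∑' j, ENNReal.ofReal
      ((∫ ω, |f ω - (mixedSplicing S p ν).avg {j}ᶜ f ω| ∂(mixedProduct S p ν)) ^ 2) := by
  have hd : ∀ j, Integrable (fun ω => f ω - (mixedSplicing S p ν).avg {j}ᶜ f ω)
      (mixedProduct S p ν) := fun j =>
    (hf.sub ((mixedSplicing S p ν).measurableL2_avg _ hf)).integrable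
  have hsq : ∀ j, ENNReal.ofReal
      ((∫ ω, |f ω - (mixedSplicing S p ν).avg {j}ᶜ f ω| ∂(mixedProduct S p ν)) ^ 2) =
      (∫⁻ ω, ‖f ω - (mixedSplicing S p ν).avg {j}ᶜ f ω‖ₑ ∂(mixedProduct S p ν)) ^ 2 := fun j => by
    rw [ENNReal.ofReal_pow (integral_nonneg fun _ => abs_nonneg _),
      ← ofReal_integral_norm_eq_lintegral_enorm (hd j)]
    rfl
  simp only [hsq, sumInfluences, Summable.tsum_sum ENNReal.summable ENNReal.summable,
    deltaBit_eq_sub_avg ν, deltaReal_eq_sub_avg (p := p) ν hf.measurable]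

end Influences

section MixedDerivation

variable (S : Type*) [DecidableEq S] (p : unitInterval)

/-- The partial derivatives of square integrable functions on the mixed product: the differences
`Δ_s f` for the coordinates `s` in `S`, and the derivatives in the sense of `IsPrimitive` for the
real coordinates. -/
structure MixedDeriv (j : S ⊕ ℕ) (f D : (S → Bool) × (ℕ → ℝ) → ℝ) : Prop where
  measurableL2 : MeasurableL2 f (mixedProduct S p (gaussianReal 0 1))
  measurableL2_deriv : MeasurableL2 D (mixedProduct S p (gaussianReal 0 1))
  deriv : Sum.elim (fun s => D =ᵐ[mixedProduct S p (gaussianReal 0 1)] deltaBit p f s)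
    (fun i => IsPrimitive p (gaussianReal 0 1) i f D) j

variable {S p}

lemma deltaBit_avg_ae_eq {ν : Measure ℝ} [IsProbabilityMeasure ν]
    {f : (S → Bool) × (ℕ → ℝ) → ℝ} (hf : MeasurableL2 f (mixedProduct S p ν))
    (A : Set (S ⊕ ℕ)) (s : S) :
    deltaBit p ((mixedSplicing S p ν).avg A f) s =ᵐ[mixedProduct S p ν]
      (mixedSplicing S p ν).avg A (deltaBit p f s) := by
  set sp := mixedSplicing S p ν
  have hcomm := sp.avg_avg_ae_eq {Sum.inl s}ᶜ A hf.measurable hf.integrable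
  rw [Set.inter_comm] at hcomm
  rw [deltaBit_eq_sub_avg ν, deltaBit_eq_sub_avg ν]
  filter_upwards [sp.avg_sub_ae_eq A hf.integrable (sp.integrable_avg {Sum.inl s}ᶜ hf.integrable),
    sp.avg_avg_ae_eq A {Sum.inl s}ᶜ hf.measurable hf.integrable, hcomm] with ω hsub havg hcomm
  rw [hsub, havg, hcomm]

lemma deltaBit_avg_ae_eq_zero {ν : Measure ℝ} [IsProbabilityMeasure ν]
    {f : (S → Bool) × (ℕ → ℝ) → ℝ} (hf : MeasurableL2 f (mixedProduct S p ν))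
    {A : Set (S ⊕ ℕ)} {s : S} (hs : Sum.inl s ∉ A) :
    deltaBit p ((mixedSplicing S p ν).avg A f) s =ᵐ[mixedProduct S p ν] 0 := by
  rw [deltaBit_eq_sub_avg ν]
  filter_upwards [(mixedSplicing S p ν).avg_avg_ae_eq {Sum.inl s}ᶜ A hf.measurable
    hf.integrable] with ω h
  rw [h, Set.inter_eq_self_of_subset_right (Set.subset_compl_singleton_iff.2 hs), sub_self,
    Pi.zero_apply]

lemma deltaBit_sub_ae_eq {ν : Measure ℝ} [IsProbabilityMeasure ν]
    {f g : (S → Bool) × (ℕ → ℝ) → ℝ} (hf : Integrable f (mixedProduct S p ν))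
    (hg : Integrable g (mixedProduct S p ν)) (s : S) :
    deltaBit p (fun ω => f ω - g ω) s =ᵐ[mixedProduct S p ν]
      fun ω => deltaBit p f s ω - deltaBit p g s ω := by
  simp only [deltaBit_eq_sub_avg ν]
  filter_upwards [(mixedSplicing S p ν).avg_sub_ae_eq {Sum.inl s}ᶜ hf hg] with ω h
  rw [h]
  ring

lemma isDerivation_mixedDeriv (hp0 : 0 < (p : ℝ)) (hp1 : (p : ℝ) < 1) :
    (mixedSplicing S p γ).IsDerivation (Sum.elim (fun _ => cLS p) (fun _ => 2))
      (MixedDeriv S p) where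
  measurableL2 h := h.measurableL2
  measurableL2_deriv h := h.measurableL2_deriv
  avg {j A f D} h hj := by
    refine ⟨Splicing.measurableL2_avg _ _ h.1, Splicing.measurableL2_avg _ _ h.2, ?_⟩
    cases j with
    | inl s => exact (Splicing.avg_congr_ae _ A h.deriv).trans (deltaBit_avg_ae_eq h.1 A s).symm
    | inr i => exact IsPrimitive.avg h.1.integrable h.2.integrable h.deriv hj
  avg_zero {j A f} hf hj := by
    refine ⟨Splicing.measurableL2_avg _ _ hf, .zero, ?_⟩
    cases j with
    | inl s => exact (deltaBit_avg_ae_eq_zero hf hj).symm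
    | inr i => exact IsPrimitive.avg_zero hj f
  sub {j f g D E} h h' := by
    refine ⟨h.1.sub h'.1, h.2.sub h'.2, ?_⟩
    cases j with
    | inl s =>
      exact (EventuallyEq.sub h.deriv h'.deriv).trans
        (deltaBit_sub_ae_eq h.1.integrable h'.1.integrable s).symm
    | inr i => exact IsPrimitive.sub h.2 h'.2 h.deriv h'.deriv
  logSobolev {j f D θ m M} h hθ hb hm := by
    cases j with
    | inl s =>
      have hsq : ∫ ω, D ω ^ 2 ∂(mixedProduct S p γ) =
          ∫ ω, deltaBit p f s ω ^ 2 ∂(mixedProduct S p γ) :=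
        integral_congr_ae (EventuallyEq.pow_const h.deriv 2)
      rw [hsq]
      exact deltaBit_logSobolev hp0 hp1 s h.1 hθ hb hm
    | inr i => exact IsPrimitive.logSobolev h.1.measurable h.2 h.deriv hθ hb hm

end MixedDerivation

section Gaussian

lemma sum_le_toReal_tsum_ofReal {ι : Type*} {a : ι → ℝ} (ha : ∀ j, 0 ≤ a j)
    (h : ∑' j, ENNReal.ofReal (a j) ≠ ∞) (s : Finset ι) :
    ∑ j ∈ s, a j ≤ (∑' j, ENNReal.ofReal (a j)).toReal := by
  rw [← ENNReal.ofReal_le_iff_le_toReal h, ENNReal.ofReal_sum_of_nonneg fun j _ => ha j]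
  exact ENNReal.sum_le_tsum s

/-- The choice `l = V / B` is optimal; letting `l → ∞` instead excludes `B = 0` when `V > 0`. -/
lemma ofReal_mul_log_div_le {V : ℝ} (hV : 0 ≤ V) {B E : ℝ≥0∞}
    (h : B ≠ ∞ → E ≠ ∞ → ∀ l > 0, (Real.log l + 1) * V ≤ E.toReal + l * B.toReal) :
    (ENNReal.ofReal V : EReal) * ENNReal.log (ENNReal.ofReal V / B) ≤ (E : EReal) := by
  rcases hV.eq_or_lt with rfl | hV
  · simp only [ENNReal.ofReal_zero, EReal.coe_ennreal_zero, zero_mul]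
    exact EReal.coe_ennreal_nonneg E
  rcases eq_or_ne B ∞ with rfl | hB
  · have hVpos : (0 : EReal) < (ENNReal.ofReal V : EReal) := by simpa using hV
    rw [ENNReal.div_top, ENNReal.log_zero, EReal.mul_bot_of_pos hVpos]
    exact bot_le
  rcases eq_or_ne E ∞ with rfl | hE
  · simp
  have h := h hB hE
  rcases eq_or_ne B 0 with rfl | hB0
  · have := h (Real.exp (E.toReal / V)) (Real.exp_pos _)
    rw [Real.log_exp, ENNReal.toReal_zero, mul_zero, add_mul, div_mul_cancel₀ _ hV.ne'] at this
    linarith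
  have hBpos : 0 < B.toReal := ENNReal.toReal_pos hB0 hB
  have hopt := h (V / B.toReal) (by positivity)
  rw [div_mul_cancel₀ _ hBpos.ne'] at hopt
  have hdiv : ENNReal.ofReal V / B = ENNReal.ofReal (V / B.toReal) := by
    rw [ENNReal.ofReal_div_of_pos hBpos, ENNReal.ofReal_toReal hB]
  rw [hdiv, ENNReal.log_ofReal_of_pos (by positivity), EReal.coe_ennreal_ofReal,
    max_eq_left hV.le, ← EReal.coe_mul, ← EReal.coe_ennreal_toReal hE, EReal.coe_le_coe_iff]
  linarith

variable {S : Type*} [DecidableEq S] {p : unitInterval} {F : (S → Bool) × (ℕ → ℝ) → ℝ}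
  {D : ℕ → (S → Bool) × (ℕ → ℝ) → ℝ}

lemma mixedDeriv_sumElim (hF : MeasurableL2 F (mixedProduct S p γ))
    (hD : ∀ i, MeasurableL2 (D i) (mixedProduct S p γ)) (hFD : ∀ i, IsPrimitive p γ i F (D i)) :
    ∀ j, MixedDeriv S p j F (Sum.elim (deltaBit p F) D j)
  | Sum.inl _ => ⟨hF, measurableL2_deltaBit hF _, EventuallyEq.rfl⟩
  | Sum.inr _ => ⟨hF, hD _, hFD _⟩

lemma tsum_ofReal_mul_integral_sq_sumElim {c d : ℝ} (hc : 0 ≤ c) (hd : 0 ≤ d) {ν : Measure ℝ}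
    [IsProbabilityMeasure ν] (hF : MeasurableL2 F (mixedProduct S p ν))
    (hD : ∀ i, MeasurableL2 (D i) (mixedProduct S p ν)) :
    ∑' j, ENNReal.ofReal (Sum.elim (fun _ : S => c) (fun _ : ℕ => d) j *
        ∫ ω, Sum.elim (deltaBit p F) D j ω ^ 2 ∂(mixedProduct S p ν)) =
      ENNReal.ofReal c * ∑' s : S, ∫⁻ ω, ‖deltaBit p F s ω‖ₑ ^ 2 ∂(mixedProduct S p ν) +
        ENNReal.ofReal d * ∑' i : ℕ, ∫⁻ ω, ‖D i ω‖ₑ ^ 2 ∂(mixedProduct S p ν) := by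
  rw [Summable.tsum_sum ENNReal.summable ENNReal.summable, ← ENNReal.tsum_mul_left,
    ← ENNReal.tsum_mul_left]
  simp only [Sum.elim_inl, Sum.elim_inr, ENNReal.ofReal_mul hc, ENNReal.ofReal_mul hd,
    ofReal_integral_sq (measurableL2_deltaBit hF _).memLp, ofReal_integral_sq (hD _).memLp]

theorem gaussian_modified_poincare [Countable S] (hp0 : 0 < (p : ℝ)) (hp1 : (p : ℝ) < 1)
    (hF : MeasurableL2 F (mixedProduct S p γ)) (hD : ∀ i, MeasurableL2 (D i) (mixedProduct S p γ))
    (hFD : ∀ i, IsPrimitive p γ i F (D i)) :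
    (evariance F (mixedProduct S p γ) : EReal) *
      ENNReal.log (evariance F (mixedProduct S p γ) / sumInfluences p γ F) ≤
      ((ENNReal.ofReal (cLS p) *
        ∑' s : S, ∫⁻ ω, ‖deltaBit p F s ω‖ₑ ^ 2 ∂(mixedProduct S p γ) +
        2 * ∑' i : ℕ, ∫⁻ ω, ‖D i ω‖ₑ ^ 2 ∂(mixedProduct S p γ) : ℝ≥0∞) : EReal) := by
  have hc : ∀ j : S ⊕ ℕ, 0 ≤ Sum.elim (fun _ => cLS p) (fun _ => 2) j := by
    rintro (_ | _)
    exacts [cLS_nonneg hp0 hp1, zero_le_two]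
  have henergy := tsum_ofReal_mul_integral_sq_sumElim (cLS_nonneg hp0 hp1) zero_le_two hF hD
  rw [ENNReal.ofReal_ofNat] at henergy
  rw [← henergy, sumInfluences_eq_tsum hF, ← ofReal_variance hF.memLp]
  refine ofReal_mul_log_div_le (variance_nonneg F _) fun hB hE l hl => ?_
  obtain ⟨e⟩ : Nonempty ((S ⊕ ℕ) ≃ ℕ) := nonempty_equiv_of_countable
  rw [variance_eq_sub hF.memLp]
  exact (isDerivation_mixedDeriv hp0 hp1).modified_poincare hc e
    (le_iSup_sigmaAlgebra_mixedSplicing p γ) hF (mixedDeriv_sumElim hF hD hFD)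
    (sum_le_toReal_tsum_ofReal
      (fun j => mul_nonneg (hc j) (integral_nonneg fun _ => sq_nonneg _)) hE)
    (sum_le_toReal_tsum_ofReal (fun _ => sq_nonneg _) hB) hl

end Gaussian

/-! ### Weak derivatives on an open interval -/

section WeakDerivative

variable {I : Set ℝ} {u v : ℝ → ℝ}

lemma exists_subset_Ioo_of_isCompact {K : Set ℝ} (hI : IsOpen I) (hne : I.Nonempty)
    (hK : IsCompact K) (hKI : K ⊆ I) : ∃ a ∈ I, ∃ b ∈ I, a < b ∧ K ⊆ Set.Ioo a b := by
  obtain ⟨t, ht⟩ := hne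
  have hsub : insert t K ⊆ I := Set.insert_subset ht hKI
  have hne' : (insert t K).Nonempty := Set.insert_nonempty t K
  obtain ⟨l, hlK, hl⟩ := (hK.insert t).exists_isLeast hne'
  obtain ⟨r, hrK, hr⟩ := (hK.insert t).exists_isGreatest hne'
  obtain ⟨a, hal, haI⟩ :=
    (mem_nhdsLT_iff_exists_Ico_subset).1 (mem_nhdsWithin_of_mem_nhds (hI.mem_nhds (hsub hlK)))
  obtain ⟨b, hrb, hbI⟩ :=
    (mem_nhdsGT_iff_exists_Ioc_subset).1 (mem_nhdsWithin_of_mem_nhds (hI.mem_nhds (hsub hrK)))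
  have hmem : ∀ x ∈ insert t K, x ∈ Set.Ioo a b := fun x hx =>
    ⟨hal.trans_le (hl hx), (hr hx).trans_lt hrb⟩
  have htab := hmem t (Set.mem_insert t K)
  exact ⟨a, haI ⟨le_rfl, hal⟩, b, hbI ⟨hrb, le_rfl⟩, htab.1.trans htab.2,
    fun x hx => hmem x (Set.mem_insert_of_mem t hx)⟩

lemma intervalIntegrable_of_locallyIntegrableOn (hc : I.OrdConnected)
    (hv : LocallyIntegrableOn v I) {a b : ℝ} (ha : a ∈ I) (hb : b ∈ I) :
    IntervalIntegrable v volume a b :=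
  (hv.integrableOn_compact_subset (hc.uIcc_subset ha hb) isCompact_uIcc).intervalIntegrable

lemma integrable_mul_of_tsupport_subset {η w : ℝ → ℝ} (hη : Continuous η)
    (hηc : HasCompactSupport η) (hηI : tsupport η ⊆ I) (hw : LocallyIntegrableOn w I) :
    Integrable fun t => η t * w t := by
  have hmul : IntegrableOn (fun t => η t * w t) (tsupport η) :=
    (hw.integrableOn_compact_subset hηI hηc).continuousOn_mul hη.continuousOn hηc
  refine (integrableOn_iff_integrable_of_support_subset ?_).1 hmul
  exact fun t ht => subset_tsupport _ (left_ne_zero_of_mul ht)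

lemma continuousOn_of_forall_sub_eq_integral (hI : IsOpen I) (hc : I.OrdConnected)
    (hv : LocallyIntegrableOn v I) (huv : ∀ a ∈ I, ∀ b ∈ I, u b - u a = ∫ t in a..b, v t) :
    ContinuousOn u I := by
  intro x hx
  obtain ⟨a, ha, b, hb, hab, hsub⟩ := exists_subset_Ioo_of_isCompact hI ⟨x, hx⟩
    isCompact_singleton (Set.singleton_subset_iff.2 hx)
  have hprim : ContinuousOn (fun t => u a + ∫ s in a..t, v s) (Set.Icc a b) := by
    rw [← Set.uIcc_of_le hab.le]
    exact continuousOn_const.add (intervalIntegral.continuousOn_primitive_interval'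
      (intervalIntegrable_of_locallyIntegrableOn hc hv ha hb) Set.left_mem_uIcc)
  have hu : ContinuousOn u (Set.Icc a b) := hprim.congr fun t ht => by
    simp only [← huv a ha t (hc.out ha hb ht), add_sub_cancel]
  obtain ⟨hax, hxb⟩ : x ∈ Set.Ioo a b := hsub rfl
  exact (hu.continuousAt (Icc_mem_nhds hax hxb)).continuousWithinAt

lemma integral_mul_eq_neg_integral_deriv_mul {φ : ℝ → ℝ} {a b : ℝ}
    (hv : IntervalIntegrable v volume a b)
    (hu : ∀ t ∈ Set.uIcc a b, u t = u a + ∫ s in a..t, v s)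
    (hφ : ContDiff ℝ 1 φ) (ha : φ a = 0) (hb : φ b = 0) :
    ∫ t in a..b, v t * φ t = -∫ t in a..b, deriv φ t * u t := by
  set U : ℝ → ℝ := fun t => u a + ∫ s in a..t, v s
  have hU : AbsolutelyContinuousOnInterval U a b :=
    (contDiff_const.contDiffOn.absolutelyContinuousOnInterval).fun_add
      (hv.absolutelyContinuousOnInterval_intervalIntegral Set.left_mem_uIcc)
  have hderiv : ∫ t in a..b, deriv U t * φ t = ∫ t in a..b, v t * φ t := by
    refine intervalIntegral.integral_congr_ae ?_
    filter_upwards [hv.ae_hasDerivAt_integral] with t ht hmem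
    rw [((ht (Set.uIoc_subset_uIcc hmem) a Set.left_mem_uIcc).const_add (u a)).deriv]
  have hprim : ∫ t in a..b, U t * deriv φ t = ∫ t in a..b, deriv φ t * u t :=
    intervalIntegral.integral_congr fun t ht => by simp only [U, ← hu t ht, mul_comm]
  have ibp := hU.integral_mul_deriv_eq_deriv_mul hφ.contDiffOn.absolutelyContinuousOnInterval
  rw [ha, hb, hderiv, hprim] at ibp
  linarith

lemma hasWeakDerivOn_of_forall_sub_eq_integral (hI : IsOpen I) (hc : I.OrdConnected)
    (hv : LocallyIntegrableOn v I) (huv : ∀ a ∈ I, ∀ b ∈ I, u b - u a = ∫ t in a..b, v t) :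
    HasWeakDerivOn I u v := by
  refine ⟨(continuousOn_of_forall_sub_eq_integral hI hc hv huv).locallyIntegrableOn
    hI.measurableSet, hv, fun φ hφ hφc hφI => ?_⟩
  rcases I.eq_empty_or_nonempty with rfl | hne
  · obtain rfl : φ = 0 := tsupport_eq_empty_iff.1 (Set.subset_empty_iff.1 hφI)
    simp
  obtain ⟨a, ha, b, hb, -, hsub⟩ := exists_subset_Ioo_of_isCompact hI hne hφc hφI
  have hφ_zero : ∀ t ∉ Set.Ioo a b, φ t = 0 := fun t ht =>
    image_eq_zero_of_notMem_tsupport fun h => ht (hsub h)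
  rw [← intervalIntegral.integral_eq_integral_of_support_subset (a := a) (b := b) fun t ht =>
      Set.Ioo_subset_Ioc_self (hsub (subset_tsupport _ (right_ne_zero_of_mul ht))),
    ← intervalIntegral.integral_eq_integral_of_support_subset (a := a) (b := b) fun t ht =>
      Set.Ioo_subset_Ioc_self (hsub (support_deriv_subset (left_ne_zero_of_mul ht)))]
  refine integral_mul_eq_neg_integral_deriv_mul
    (intervalIntegrable_of_locallyIntegrableOn hc hv ha hb) (fun t ht => ?_)
    (hφ.of_le (by exact_mod_cast le_top)) (hφ_zero a (by simp)) (hφ_zero b (by simp))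
  rw [← huv a ha t (hc.uIcc_subset ha hb ht), add_sub_cancel]

lemma HasWeakDerivOn.sub {u₁ v₁ u₂ v₂ : ℝ → ℝ} (h₁ : HasWeakDerivOn I u₁ v₁)
    (h₂ : HasWeakDerivOn I u₂ v₂) :
    HasWeakDerivOn I (fun t => u₁ t - u₂ t) (fun t => v₁ t - v₂ t) := by
  refine ⟨h₁.1.sub h₂.1, h₁.2.1.sub h₂.2.1, fun φ hφ hφc hφI => ?_⟩
  have hφ' : Continuous (deriv φ) := hφ.continuous_deriv (by simp)
  have hφ'I : tsupport (deriv φ) ⊆ I :=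
    (closure_minimal support_deriv_subset (isClosed_tsupport φ)).trans hφI
  have hv {w : ℝ → ℝ} (hw : LocallyIntegrableOn w I) : Integrable fun t => w t * φ t := by
    simpa only [mul_comm] using integrable_mul_of_tsupport_subset hφ.continuous hφc hφI hw
  have hu {w : ℝ → ℝ} (hw : LocallyIntegrableOn w I) : Integrable fun t => deriv φ t * w t :=
    integrable_mul_of_tsupport_subset hφ' hφc.deriv hφ'I hw
  simp only [sub_mul, mul_sub]
  rw [integral_sub (hv h₁.2.1) (hv h₂.2.1), integral_sub (hu h₁.1) (hu h₂.1),
    h₁.2.2 φ hφ hφc hφI, h₂.2.2 φ hφ hφc hφI]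
  ring

lemma support_primitive_subset_Icc {η : ℝ → ℝ} {a b : ℝ}
    (hη : Function.support η ⊆ Set.Ioo a b) (h0 : ∫ t, η t = 0) :
    Function.support (fun t => ∫ s in a..t, η s) ⊆ Set.Icc a b := by
  intro t ht
  by_contra hn
  refine ht ?_
  rcases not_and_or.1 hn with hta | hbt
  · have hzero : ∫ s in a..t, η s = ∫ _ in a..t, (0 : ℝ) := by
      refine intervalIntegral.integral_congr fun s hs => ?_
      rw [Set.uIcc_of_ge (not_le.1 hta).le] at hs
      exact Function.notMem_support.1 fun hs' => (hη hs').1.not_ge hs.2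
    simpa using hzero
  · refine (intervalIntegral.integral_eq_integral_of_support_subset fun s hs => ?_).trans h0
    exact ⟨(hη hs).1, (hη hs).2.le.trans (not_le.1 hbt).le⟩

lemma exists_deriv_eq_of_integral_eq_zero (hI : IsOpen I) (hc : I.OrdConnected)
    (hne : I.Nonempty) {η : ℝ → ℝ} (hη : ContDiff ℝ ((⊤ : ℕ∞) : WithTop ℕ∞) η)
    (hηc : HasCompactSupport η) (hηI : tsupport η ⊆ I) (h0 : ∫ t, η t = 0) :
    ∃ φ : ℝ → ℝ, ContDiff ℝ ((⊤ : ℕ∞) : WithTop ℕ∞) φ ∧ HasCompactSupport φ ∧ tsupport φ ⊆ I ∧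
      deriv φ = η := by
  obtain ⟨a, ha, b, hb, -, hsub⟩ := exists_subset_Ioo_of_isCompact hI hne hηc hηI
  have hder : ∀ t, HasDerivAt (fun t => ∫ s in a..t, η s) (η t) t := fun t =>
    intervalIntegral.integral_hasDerivAt_right (hη.continuous.intervalIntegrable _ _)
      (hη.continuous.stronglyMeasurableAtFilter _ _) hη.continuous.continuousAt
  have hderiv : deriv (fun t => ∫ s in a..t, η s) = η := funext fun t => (hder t).deriv
  have hsupp : Function.support (fun t => ∫ s in a..t, η s) ⊆ Set.Icc a b :=
    support_primitive_subset_Icc ((subset_tsupport η).trans hsub) h0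
  refine ⟨fun t => ∫ s in a..t, η s, ?_, .of_support_subset_isCompact isCompact_Icc hsupp,
    (closure_minimal hsupp isClosed_Icc).trans (hc.out ha hb), hderiv⟩
  rw [contDiff_infty_iff_deriv, hderiv]
  exact ⟨fun t => (hder t).differentiableAt, hη⟩

/-- Subtracting from `η` the multiple of the bump `χ` with the same integral leaves the derivative
of a test function. -/
lemma HasWeakDerivOn.integral_mul_eq_of_zero (hI : IsOpen I) (hc : I.OrdConnected)
    (hne : I.Nonempty) {w : ℝ → ℝ} (hw : HasWeakDerivOn I w fun _ => 0) {η χ : ℝ → ℝ}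
    (hη : ContDiff ℝ ((⊤ : ℕ∞) : WithTop ℕ∞) η) (hηc : HasCompactSupport η)
    (hηI : tsupport η ⊆ I) (hχ : ContDiff ℝ ((⊤ : ℕ∞) : WithTop ℕ∞) χ)
    (hχc : HasCompactSupport χ) (hχI : tsupport χ ⊆ I) (hχ1 : ∫ t, χ t = 1) :
    ∫ t, η t * w t = (∫ t, η t) * ∫ t, χ t * w t := by
  set m := ∫ t, η t
  have hdiff0 : ∫ t, (η t - m * χ t) = 0 := by
    rw [integral_sub (hη.continuous.integrable_of_hasCompactSupport hηc)
      ((hχ.continuous.integrable_of_hasCompactSupport hχc).const_mul m), integral_const_mul, hχ1,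
      mul_one, sub_self]
  obtain ⟨φ, hφ, hφc, hφI, hφ'⟩ := exists_deriv_eq_of_integral_eq_zero hI hc hne
    (hη.sub (contDiff_const.mul hχ)) (hηc.sub hχc.mul_left)
    ((tsupport_sub η fun t => m * χ t).trans
      (Set.union_subset hηI (tsupport_mul_subset_right.trans hχI))) hdiff0
  have hweak := hw.2.2 φ hφ hφc hφI
  simp only [zero_mul, integral_zero, hφ', zero_eq_neg, sub_mul, mul_assoc] at hweak
  rw [integral_sub (integrable_mul_of_tsupport_subset hη.continuous hηc hηI hw.1)
    ((integrable_mul_of_tsupport_subset hχ.continuous hχc hχI hw.1).const_mul m),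
    integral_const_mul] at hweak
  exact sub_eq_zero.1 hweak

lemma exists_contDiff_integral_eq_one (hI : IsOpen I) (hne : I.Nonempty) :
    ∃ χ : ℝ → ℝ, ContDiff ℝ ((⊤ : ℕ∞) : WithTop ℕ∞) χ ∧ HasCompactSupport χ ∧ tsupport χ ⊆ I ∧
      ∫ t, χ t = 1 := by
  obtain ⟨t₀, ht₀⟩ := hne
  obtain ⟨χ, hχI, hχc, hχ, hχ_range, hχt₀⟩ :=
    exists_contDiff_tsupport_subset (n := ⊤) (hI.mem_nhds ht₀)
  have hpos : 0 < ∫ t, χ t := hχ.continuous.integral_pos_of_hasCompactSupport_nonneg_nonzero hχc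
    (fun t => (hχ_range ⟨t, rfl⟩).1) (x := t₀) (by simp [hχt₀])
  refine ⟨fun t => (∫ t, χ t)⁻¹ * χ t, contDiff_const.mul hχ, hχc.mul_left,
    tsupport_mul_subset_right.trans hχI, ?_⟩
  rw [integral_const_mul, inv_mul_cancel₀ hpos.ne']

lemma HasWeakDerivOn.ae_eq_const (hI : IsOpen I) (hc : I.OrdConnected) (hne : I.Nonempty)
    {w : ℝ → ℝ} (hw : HasWeakDerivOn I w fun _ => 0) : ∃ c : ℝ, ∀ᵐ t, t ∈ I → w t = c := by
  obtain ⟨χ, hχ, hχc, hχI, hχ1⟩ := exists_contDiff_integral_eq_one hI hne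
  set c := ∫ t, χ t * w t
  refine ⟨c, ?_⟩
  have hzero : ∀ᵐ t, t ∈ I → w t - c = 0 := by
    refine hI.ae_eq_zero_of_integral_contDiff_smul_eq_zero
      (hw.1.sub (locallyIntegrableOn_const c)) fun η hη hηc hηI => ?_
    simp only [smul_eq_mul, mul_sub]
    rw [integral_sub (integrable_mul_of_tsupport_subset hη.continuous hηc hηI hw.1)
      ((hη.continuous.integrable_of_hasCompactSupport hηc).mul_const c), integral_mul_const,
      hw.integral_mul_eq_of_zero hI hc hne hη hηc hηI hχ hχc hχI hχ1, sub_self]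
  filter_upwards [hzero] with t ht htI
  exact sub_eq_zero.1 (ht htI)

lemma HasWeakDerivOn.exists_ae_eq (hI : IsOpen I) (hc : I.OrdConnected)
    (h : HasWeakDerivOn I u v) {t₀ : ℝ} (ht₀ : t₀ ∈ I) :
    ∃ c : ℝ, ∀ᵐ t, t ∈ I → u t = c + ∫ s in t₀..t, v s := by
  have hint {t : ℝ} (ht : t ∈ I) : IntervalIntegrable v volume t₀ t :=
    intervalIntegrable_of_locallyIntegrableOn hc h.2.1 ht₀ ht
  have hdiff := h.sub (hasWeakDerivOn_of_forall_sub_eq_integral hI hc h.2.1 fun a ha b hb =>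
    intervalIntegral.integral_interval_sub_left (hint hb) (hint ha))
  simp only [sub_self] at hdiff
  obtain ⟨c, hconst⟩ := hdiff.ae_eq_const hI hc ⟨t₀, ht₀⟩
  refine ⟨c, ?_⟩
  filter_upwards [hconst] with t ht htI
  exact sub_eq_iff_eq_add.1 (ht htI)

lemma ae_hasDerivAt_integral_of_locallyIntegrableOn (hI : IsOpen I) (hc : I.OrdConnected)
    (hv : LocallyIntegrableOn v I) {t₀ : ℝ} (ht₀ : t₀ ∈ I) :
    ∀ᵐ t, t ∈ I → HasDerivAt (fun t => ∫ s in t₀..t, v s) (v t) t := by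
  suffices hnull : volume {t | t ∈ I ∧ ¬ HasDerivAt (fun t => ∫ s in t₀..t, v s) (v t) t} = 0 by
    simpa only [ae_iff, Classical.not_imp] using hnull
  refine measure_null_of_locally_null _ fun x hx => ?_
  obtain ⟨a, ha, b, hb, hab, hsub⟩ := exists_subset_Ioo_of_isCompact hI ⟨t₀, ht₀⟩
    (K := {x, t₀}) (Set.toFinite _).isCompact (Set.insert_subset hx.1 (by simpa))
  have hx_mem : x ∈ Set.Ioo a b := hsub (Set.mem_insert x {t₀})
  have ht₀_mem : t₀ ∈ Set.Icc a b :=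
    Set.Ioo_subset_Icc_self (hsub (Set.mem_insert_of_mem x rfl))
  refine ⟨_, inter_mem self_mem_nhdsWithin
    (mem_nhdsWithin_of_mem_nhds (Ioo_mem_nhds hx_mem.1 hx_mem.2)), ?_⟩
  refine measure_mono_null ?_ (ae_iff.1
    (intervalIntegrable_of_locallyIntegrableOn hc hv ha hb).ae_hasDerivAt_integral)
  rintro t ⟨⟨-, hnot⟩, ht⟩ hderiv
  rw [Set.uIcc_of_le hab.le] at hderiv
  exact hnot (hderiv (Set.Ioo_subset_Icc_self ht) t₀ ht₀_mem)

/-- Such zeros are isolated, so there are only countably many of them. -/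
lemma ae_eq_zero_of_hasDerivAt_of_eq_zero (U v : ℝ → ℝ) :
    ∀ᵐ t, HasDerivAt U (v t) t → U t = 0 → v t = 0 := by
  suffices hnull : volume {t | HasDerivAt U (v t) t ∧ U t = 0 ∧ v t ≠ 0} = 0 by
    simpa only [ae_iff, Classical.not_imp] using hnull
  refine measure_null_of_locally_null _ fun x ⟨hderiv, _, hvx⟩ => ⟨{x}, ?_, by simp⟩
  rw [mem_nhdsWithin_iff_eventually]
  filter_upwards [eventually_nhdsWithin_iff.1 (hderiv.eventually_ne (c := 0) hvx)] with y hy hyS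
  by_contra hne
  exact hy hne hyS.2.1

lemma HasWeakDerivOn.ae_eq_zero (hI : IsOpen I) (hc : I.OrdConnected)
    (h : HasWeakDerivOn I u v) : ∀ᵐ t, t ∈ I → u t = 0 → v t = 0 := by
  rcases I.eq_empty_or_nonempty with rfl | ⟨t₀, ht₀⟩
  · simp
  obtain ⟨c, hu⟩ := h.exists_ae_eq hI hc ht₀
  filter_upwards [hu, ae_hasDerivAt_integral_of_locallyIntegrableOn hI hc h.2.1 ht₀,
    ae_eq_zero_of_hasDerivAt_of_eq_zero (fun t => c + ∫ s in t₀..t, v s) v]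
    with t hut hderiv hzero htI hu0
  exact hzero ((hderiv htI).const_add c) ((hut htI).symm.trans hu0)

end WeakDerivative

/-! ### Functions with primitive slices -/

lemma measurable_intervalIntegral_prod {X : Type*} [MeasurableSpace X] {φ : X × ℝ → ℝ}
    (hφ : Measurable φ) :
    Measurable fun q : X × (ℝ × ℝ) => ∫ r in q.2.1..q.2.2, φ (q.1, r) := by
  have hIoc {a b : ℝ × ℝ → ℝ} (ha : Measurable a) (hb : Measurable b) :
      Measurable fun q : X × (ℝ × ℝ) => ∫ r in Set.Ioc (a q.2) (b q.2), φ (q.1, r) := by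
    have hset : MeasurableSet
        ({z | a z.1.2 < z.2} ∩ {z | z.2 ≤ b z.1.2} : Set ((X × (ℝ × ℝ)) × ℝ)) :=
      (measurableSet_lt (by fun_prop) (by fun_prop)).inter
        (measurableSet_le (by fun_prop) (by fun_prop))
    have hφ' : Measurable fun z : (X × (ℝ × ℝ)) × ℝ => φ (z.1.1, z.2) := by fun_prop
    simp only [← integral_indicator measurableSet_Ioc]
    exact ((hφ'.indicator hset).stronglyMeasurable.integral_prod_right' (ν := volume)).measurable
  exact (hIoc measurable_fst measurable_snd).sub (hIoc measurable_snd measurable_fst)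

section AlmostEverywhere

variable {S : Type*} {p : unitInterval} {ν : Measure ℝ} {f g : (S → Bool) × (ℕ → ℝ) → ℝ}

lemma measurable_realSlice_prod (hf : Measurable f) (i : ℕ) :
    Measurable fun z : ((S → Bool) × (ℕ → ℝ)) × ℝ => realSlice f i z.1 z.2 :=
  hf.comp (by fun_prop : Measurable fun z : ((S → Bool) × (ℕ → ℝ)) × ℝ =>
    (z.1.1, Function.update z.1.2 i z.2))

variable [IsProbabilityMeasure ν]

lemma realSlice_congr_ae (i : ℕ) (h : f =ᵐ[mixedProduct S p ν] g) :
    ∀ᵐ ω ∂(mixedProduct S p ν), realSlice f i ω =ᵐ[ν] realSlice g i ω :=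
  Measure.ae_ae_of_ae_prod ((measurePreserving_update_snd p ν i).quasiMeasurePreserving.ae h)

lemma ae_eq_of_realSlice_ae_eq (i : ℕ) (hf : AEStronglyMeasurable f (mixedProduct S p ν))
    (hg : AEStronglyMeasurable g (mixedProduct S p ν))
    (h : ∀ᵐ ω ∂(mixedProduct S p ν), realSlice f i ω =ᵐ[ν] realSlice g i ω) :
    f =ᵐ[mixedProduct S p ν] g := by
  obtain ⟨f', hf', hff'⟩ := hf
  obtain ⟨g', hg', hgg'⟩ := hg
  refine hff'.trans (EventuallyEq.trans ?_ hgg'.symm)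
  have hupdate := measurePreserving_update_snd (S := S) p ν i
  have hset := measurableSet_eq_fun hf'.measurable hg'.measurable
  have hset_slice : MeasurableSet {q : ((S → Bool) × (ℕ → ℝ)) × ℝ |
      realSlice f' i q.1 q.2 = realSlice g' i q.1 q.2} := hupdate.measurable hset
  rw [EventuallyEq, ← hupdate.map_eq, ae_map_iff hupdate.measurable.aemeasurable hset]
  refine (Measure.ae_prod_iff_ae_ae hset_slice).2 ?_
  filter_upwards [h, realSlice_congr_ae i hff', realSlice_congr_ae i hgg'] with ω hω hfω hgω
  exact hfω.symm.trans (hω.trans hgω)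

lemma deltaReal_congr_ae (h : f =ᵐ[mixedProduct S p ν] g) (i : ℕ) :
    deltaReal ν f i =ᵐ[mixedProduct S p ν] deltaReal ν g i := by
  filter_upwards [h, realSlice_congr_ae i h] with ω hω hslice
  simp only [deltaReal, hω, integral_congr_ae hslice]

variable [DecidableEq S]

lemma deltaBit_congr_ae (h : f =ᵐ[mixedProduct S p ν] g) (s : S) :
    deltaBit p f s =ᵐ[mixedProduct S p ν] deltaBit p g s := by
  filter_upwards [h, Measure.ae_ae_of_ae_prod
    ((measurePreserving_update_fst p ν s).quasiMeasurePreserving.ae h)] with ω hω hslice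
  simp only [deltaBit, hω, integral_congr_ae hslice]

lemma sumInfluences_congr_ae (h : f =ᵐ[mixedProduct S p ν] g) :
    sumInfluences p ν f = sumInfluences p ν g := by
  have hbits (s : S) := lintegral_congr_ae ((deltaBit_congr_ae h s).fun_comp (‖·‖ₑ))
  have hreals (i : ℕ) := lintegral_congr_ae ((deltaReal_congr_ae h i).fun_comp (‖·‖ₑ))
  simp only [Function.comp_def] at hbits hreals
  simp only [sumInfluences, hbits, hreals]

end AlmostEverywhere

section PrimitiveSlices

variable {S : Type*} {p : unitInterval} {F F' : (S → Bool) × (ℕ → ℝ) → ℝ}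

/-- Almost every slice of `F` in the real coordinate `i` agrees, up to a null set, with a primitive
of the slice of `D`. Unlike `IsPrimitive`, this is stable under modification of `F` on a null
set without any measurability assumption. -/
def HasPrimitiveSlices (p : unitInterval) (i : ℕ) (F D : (S → Bool) × (ℕ → ℝ) → ℝ) : Prop :=
  ∀ᵐ ω ∂(mixedProduct S p γ), LocallyIntegrable (realSlice D i ω) ∧
    ∃ c : ℝ, ∀ᵐ t ∂γ, realSlice F i ω t = c + ∫ r in (0 : ℝ)..t, realSlice D i ω r

lemma MemGaussSobolev.exists_hasPrimitiveSlices (hF : MemGaussSobolev p F) (i : ℕ) :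
    ∃ D : (S → Bool) × (ℕ → ℝ) → ℝ,
      MeasurableL2 D (mixedProduct S p γ) ∧ HasPrimitiveSlices p i F D := by
  obtain ⟨D, hD, hweak⟩ := hF.2 i
  refine ⟨hD.1.mk D, ⟨hD.1.stronglyMeasurable_mk.measurable, hD.ae_eq hD.1.ae_eq_mk⟩, ?_⟩
  filter_upwards [hweak, realSlice_congr_ae i hD.1.ae_eq_mk] with ω hω hslice
  have hslice_vol : realSlice D i ω =ᵐ[volume] realSlice (hD.1.mk D) i ω :=
    (gaussianReal_absolutelyContinuous' 0 one_ne_zero).ae_le hslice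
  obtain ⟨c, hc⟩ := hω.exists_ae_eq isOpen_univ Set.ordConnected_univ (Set.mem_univ 0)
  refine ⟨locallyIntegrableOn_univ.1 (hω.2.1.congr (ae_restrict_of_ae hslice_vol)), c, ?_⟩
  filter_upwards [(gaussianReal_absolutelyContinuous 0 one_ne_zero).ae_le hc] with t ht
  rw [ht (Set.mem_univ t),
    intervalIntegral.integral_congr_ae (hslice_vol.mono fun r hr _ => hr)]

lemma HasPrimitiveSlices.isPrimitive {i : ℕ} {D : (S → Bool) × (ℕ → ℝ) → ℝ}
    (h : HasPrimitiveSlices p i F D) (hF' : Measurable F') (hD : Measurable D)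
    (hFF' : F =ᵐ[mixedProduct S p γ] F') : IsPrimitive p γ i F' D := by
  have hF'_slice := measurable_realSlice_prod hF' i
  have hset : MeasurableSet {q : ((S → Bool) × (ℕ → ℝ)) × (ℝ × ℝ) |
      realSlice F' i q.1 q.2.2 - realSlice F' i q.1 q.2.1 =
        ∫ r in q.2.1..q.2.2, realSlice D i q.1 r} :=
    measurableSet_eq_fun
      ((hF'_slice.comp (by fun_prop : Measurable fun q : ((S → Bool) × (ℕ → ℝ)) × (ℝ × ℝ) =>
        (q.1, q.2.2))).sub (hF'_slice.comp (by fun_prop : Measurable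
          fun q : ((S → Bool) × (ℕ → ℝ)) × (ℝ × ℝ) => (q.1, q.2.1))))
      (measurable_intervalIntegral_prod (measurable_realSlice_prod hD i))
  rw [IsPrimitive, Measure.ae_prod_iff_ae_ae hset]
  filter_upwards [h, realSlice_congr_ae i hFF'] with ω ⟨hloc, c, hc⟩ hslice
  have hint (b : ℝ) : IntervalIntegrable (realSlice D i ω) volume 0 b :=
    (hloc.integrableOn_isCompact isCompact_uIcc).intervalIntegrable
  refine (Measure.ae_prod_iff_ae_ae (measurable_prodMk_left hset)).2 ?_
  have hF'_eq : ∀ᵐ t ∂γ, realSlice F' i ω t = c + ∫ r in (0 : ℝ)..t, realSlice D i ω r :=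
    hslice.symm.trans hc
  filter_upwards [hF'_eq] with s hs
  filter_upwards [hF'_eq] with t ht
  rw [hs, ht, add_sub_add_left_eq_sub,
    intervalIntegral.integral_interval_sub_left (hint t) (hint s)]

theorem HasPrimitiveSlices.modified_poincare [Countable S] [DecidableEq S] (hp0 : 0 < (p : ℝ))
    (hp1 : (p : ℝ) < 1) (hF : MemLp F 2 (mixedProduct S p γ))
    {D : ℕ → (S → Bool) × (ℕ → ℝ) → ℝ} (hD : ∀ i, MeasurableL2 (D i) (mixedProduct S p γ))
    (hFD : ∀ i, HasPrimitiveSlices p i F (D i)) :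
    (evariance F (mixedProduct S p γ) : EReal) *
      ENNReal.log (evariance F (mixedProduct S p γ) / sumInfluences p γ F) ≤
      ((ENNReal.ofReal (cLS p) *
        ∑' s : S, ∫⁻ ω, ‖deltaBit p F s ω‖ₑ ^ 2 ∂(mixedProduct S p γ) +
        2 * ∑' i : ℕ, ∫⁻ ω, ‖D i ω‖ₑ ^ 2 ∂(mixedProduct S p γ) : ℝ≥0∞) : EReal) := by
  have hmk := hF.1.ae_eq_mk
  have hF_mk : MeasurableL2 (hF.1.mk F) (mixedProduct S p γ) :=
    ⟨hF.1.stronglyMeasurable_mk.measurable, hF.ae_eq hmk⟩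
  have hbits (s : S) := lintegral_congr_ae ((deltaBit_congr_ae hmk s).fun_comp (‖·‖ₑ ^ 2))
  simp only [Function.comp_def] at hbits
  simpa only [sumInfluences_congr_ae hmk, evariance_congr hmk, hbits] using
    gaussian_modified_poincare hp0 hp1 hF_mk hD fun i =>
      (hFD i).isPrimitive hF_mk.measurable (hD i).measurable hmk

end PrimitiveSlices

/-! ### The transport of the Gaussian measure -/

/-- The measure `μ` on the line has the measurable, nonnegative function `d` as a density with
respect to the Lebesgue measure. -/
structure IsDensity (μ : Measure ℝ) (d : ℝ → ℝ) : Prop where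
  measurable : Measurable d
  nonneg : ∀ t, 0 ≤ d t
  eq : μ = volume.withDensity fun t => ENNReal.ofReal (d t)

namespace IsDensity

variable {μ : Measure ℝ} {d : ℝ → ℝ}

lemma absolutelyContinuous (h : IsDensity μ d) : μ ≪ volume :=
  h.eq ▸ withDensity_absolutelyContinuous _ _

lemma ae_pos (h : IsDensity μ d) : ∀ᵐ t ∂μ, 0 < d t := by
  rw [h.eq, ae_withDensity_iff h.measurable.ennreal_ofReal]
  exact .of_forall fun t ht => by simpa using ht

lemma integrableOn_iff (h : IsDensity μ d) {A : Set ℝ} (hA : MeasurableSet A) {k : ℝ → ℝ} :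
    IntegrableOn k A μ ↔ IntegrableOn (fun y => k y * d y) A := by
  rw [h.eq, IntegrableOn, restrict_withDensity hA,
    integrable_withDensity_iff_integrable_smul' h.measurable.ennreal_ofReal (by simp)]
  simp only [ENNReal.toReal_ofReal (h.nonneg _), smul_eq_mul, mul_comm (d _), IntegrableOn]

lemma setIntegral_eq (h : IsDensity μ d) {A : Set ℝ} (hA : MeasurableSet A) (k : ℝ → ℝ) :
    ∫ y in A, k y ∂μ = ∫ y in A, k y * d y := by
  rw [h.eq, restrict_withDensity hA,
    integral_withDensity_eq_integral_toReal_smul h.measurable.ennreal_ofReal (by simp)]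
  simp only [ENNReal.toReal_ofReal (h.nonneg _), smul_eq_mul, mul_comm (d _)]

lemma integrable [IsFiniteMeasure μ] (h : IsDensity μ d) : Integrable d := by
  simpa using (h.integrableOn_iff MeasurableSet.univ (k := fun _ => 1)).1
    (integrable_const 1).integrableOn

variable [IsProbabilityMeasure μ]

lemma setIntegral_Iic (h : IsDensity μ d) (t : ℝ) : ∫ u in Set.Iic t, d u = cdf μ t := by
  rw [cdf_eq_real]
  simpa using (h.setIntegral_eq (measurableSet_Iic (a := t)) fun _ => 1).symm

lemma cdf_sub_cdf (h : IsDensity μ d) (a b : ℝ) : cdf μ b - cdf μ a = ∫ u in a..b, d u := by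
  rw [← intervalIntegral.integral_Iic_sub_Iic h.integrable.integrableOn h.integrable.integrableOn,
    h.setIntegral_Iic, h.setIntegral_Iic]

lemma continuous_cdf (h : IsDensity μ d) : Continuous (cdf μ) := by
  have hprimitive : ⇑(cdf μ) = fun t => cdf μ 0 + ∫ u in (0 : ℝ)..t, d u :=
    funext fun t => by rw [← h.cdf_sub_cdf, add_sub_cancel]
  rw [hprimitive]
  exact continuous_const.add (intervalIntegral.continuous_primitive
    (fun a b => h.integrable.intervalIntegrable) 0)

end IsDensity

section CumulativeDistribution

variable {μ : Measure ℝ} {t : ℝ}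

lemma strictMono_cdf [IsProbabilityMeasure μ] [μ.IsOpenPosMeasure] : StrictMono (cdf μ) := by
  intro a b hab
  have hpos : 0 < μ (Set.Ioc a b) :=
    ((Measure.measure_Ioo_pos μ).2 hab).trans_le (measure_mono Set.Ioo_subset_Ioc_self)
  rw [← measure_cdf μ, StieltjesFunction.measure_Ioc, ENNReal.ofReal_pos] at hpos
  exact sub_pos.1 hpos

lemma cdf_mem_Ioo (hmono : StrictMono (cdf μ)) (x : ℝ) : cdf μ x ∈ Set.Ioo (0 : ℝ) 1 :=
  ⟨(cdf_nonneg μ _).trans_lt (hmono (sub_one_lt x)),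
    (hmono (lt_add_one x)).trans_le (cdf_le_one μ _)⟩

lemma bddBelow_setOf_le_cdf (ht : 0 < t) : BddBelow {x | t ≤ cdf μ x} := by
  obtain ⟨y, hy⟩ := ((tendsto_cdf_atBot μ).eventually (gt_mem_nhds ht)).exists
  exact ⟨y, fun x hx => ((monotone_cdf μ).reflect_lt (hy.trans_le hx)).le⟩

lemma le_cdf_genInv (hc : Continuous (cdf μ)) (ht : t ∈ Set.Ioo (0 : ℝ) 1) :
    t ≤ cdf μ (genInv (cdf μ) t) :=
  (isClosed_le continuous_const hc).csInf_mem
    ((((tendsto_cdf_atTop μ).eventually (lt_mem_nhds ht.2)).exists).imp fun _ hx => hx.le)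
    (bddBelow_setOf_le_cdf ht.1)

lemma genInv_cdf_le_iff (hc : Continuous (cdf μ)) (ht : t ∈ Set.Ioo (0 : ℝ) 1) {x : ℝ} :
    genInv (cdf μ) t ≤ x ↔ t ≤ cdf μ x :=
  ⟨fun h => (le_cdf_genInv hc ht).trans (monotone_cdf μ h),
    fun h => csInf_le (bddBelow_setOf_le_cdf ht.1) h⟩

lemma cdf_genInv (hc : Continuous (cdf μ)) (ht : t ∈ Set.Ioo (0 : ℝ) 1) :
    cdf μ (genInv (cdf μ) t) = t := by
  refine le_antisymm ?_ (le_cdf_genInv hc ht)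
  refine le_of_tendsto (hc.continuousWithinAt (s := Set.Iio (genInv (cdf μ) t))) ?_
  filter_upwards [self_mem_nhdsWithin] with x hx
  exact (not_le.1 fun h => not_lt.2 ((genInv_cdf_le_iff hc ht).2 h) hx).le

lemma genInv_cdf (hc : Continuous (cdf μ)) (hmono : StrictMono (cdf μ)) (x : ℝ) :
    genInv (cdf μ) (cdf μ x) = x :=
  hmono.injective (cdf_genInv hc (cdf_mem_Ioo hmono x))

lemma measureReal_setOf_cdf_le [IsProbabilityMeasure μ] (hc : Continuous (cdf μ))
    (hmono : StrictMono (cdf μ)) (ht : t ∈ Set.Icc (0 : ℝ) 1) : μ.real {x | cdf μ x ≤ t} = t := by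
  rcases ht.1.eq_or_lt with rfl | ht0
  · have hempty : {x | cdf μ x ≤ 0} = ∅ :=
      Set.eq_empty_of_forall_notMem fun x => (cdf_mem_Ioo hmono x).1.not_ge
    simp [hempty]
  rcases ht.2.eq_or_lt with rfl | ht1
  · simp [cdf_le_one]
  · have hIic : {x | cdf μ x ≤ t} = Set.Iic (genInv (cdf μ) t) := Set.ext fun x => by
      rw [Set.mem_Iic, ← hmono.le_iff_le, cdf_genInv hc ⟨ht0, ht1⟩, Set.mem_ofPred_eq]
    rw [hIic, ← cdf_eq_real, cdf_genInv hc ⟨ht0, ht1⟩]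

end CumulativeDistribution

lemma gaussDensity_eq : gaussDensity = gaussianPDFReal 0 1 := by
  funext x
  simp [gaussDensity, gaussianPDFReal]

lemma gaussDensity_pos (x : ℝ) : 0 < gaussDensity x := by
  rw [gaussDensity_eq]
  exact gaussianPDFReal_pos _ _ _ one_ne_zero

lemma isDensity_gaussDensity : IsDensity γ gaussDensity where
  measurable := gaussDensity_eq ▸ measurable_gaussianPDFReal 0 1
  nonneg x := (gaussDensity_pos x).le
  eq := by
    rw [gaussDensity_eq, gaussianReal_of_var_ne_zero _ one_ne_zero]
    rfl

lemma gaussCDF_eq_cdf : gaussCDF = cdf γ :=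
  funext isDensity_gaussDensity.setIntegral_Iic

lemma strictMono_cdf_gaussianReal : StrictMono (cdf γ) :=
  have := (gaussianReal_absolutelyContinuous' 0 one_ne_zero).isOpenPosMeasure
  strictMono_cdf

lemma strictMono_gaussCDF : StrictMono gaussCDF :=
  gaussCDF_eq_cdf ▸ strictMono_cdf_gaussianReal

lemma gaussCDF_mem_Ioo (z : ℝ) : gaussCDF z ∈ Set.Ioo (0 : ℝ) 1 := by
  rw [gaussCDF_eq_cdf]
  exact cdf_mem_Ioo strictMono_cdf_gaussianReal z

lemma gaussCDF_genInv {t : ℝ} (ht : t ∈ Set.Ioo (0 : ℝ) 1) :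
    gaussCDF (genInv gaussCDF t) = t := by
  rw [gaussCDF_eq_cdf]
  exact cdf_genInv isDensity_gaussDensity.continuous_cdf ht

lemma genInv_gaussCDF (z : ℝ) : genInv gaussCDF (gaussCDF z) = z := by
  rw [gaussCDF_eq_cdf]
  exact genInv_cdf isDensity_gaussDensity.continuous_cdf strictMono_cdf_gaussianReal z

lemma measureReal_setOf_gaussCDF_le {t : ℝ} (ht : t ∈ Set.Icc (0 : ℝ) 1) :
    Measure.real γ {z | gaussCDF z ≤ t} = t := by
  rw [gaussCDF_eq_cdf]
  exact measureReal_setOf_cdf_le isDensity_gaussDensity.continuous_cdf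
    strictMono_cdf_gaussianReal ht

/-- The map `G⁻¹ ∘ H`, which inverts the transport `H⁻¹ ∘ G` on `{0 < H < 1}`. -/
noncomputable def cotransport (h : ℝ → ℝ) (y : ℝ) : ℝ := genInv gaussCDF (cdfOf h y)

/-- If `w` is the derivative of `U`, this is the derivative of `U ∘ G⁻¹ ∘ H` as given by the chain
rule. -/
noncomputable def cotransportDeriv (h w : ℝ → ℝ) (y : ℝ) : ℝ :=
  w (cotransport h y) / gaussDensity (cotransport h y) * h y

/-- The set `{0 < H < 1}`, an open interval on which slices in the variables of law `ν` are
differentiated. -/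
def cdfSupport (h : ℝ → ℝ) : Set ℝ := {t | 0 < cdfOf h t ∧ cdfOf h t < 1}

lemma gaussCDF_cotransport {h : ℝ → ℝ} {y : ℝ} (hy : y ∈ cdfSupport h) :
    gaussCDF (cotransport h y) = cdfOf h y :=
  gaussCDF_genInv hy

/-- The measure `ν` lives on the half line and has density `h`. -/
structure IsHalfLineDensity (ν : Measure ℝ) (h : ℝ → ℝ) : Prop extends IsDensity ν h where
  measure_Iio_zero : ν (Set.Iio 0) = 0

namespace IsHalfLineDensity

variable {ν : Measure ℝ} [IsProbabilityMeasure ν] {h : ℝ → ℝ}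

lemma cdfOf_eq_cdf (hν : IsHalfLineDensity ν h) : cdfOf h = cdf ν := by
  have hIic : ν (Set.Iic 0) = 0 := by
    rw [← Set.Iio_union_right]
    exact measure_union_null hν.measure_Iio_zero (hν.absolutelyContinuous (by simp))
  have hzero : cdf ν 0 = 0 := by simp [cdf_eq_real, measureReal_def, hIic]
  funext t
  rw [cdfOf, ← hν.cdf_sub_cdf, hzero, sub_zero]

lemma cdfOf_transport (hν : IsHalfLineDensity ν h) (z : ℝ) :
    cdfOf h (transport h z) = gaussCDF z := by
  rw [transport, hν.cdfOf_eq_cdf]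
  exact cdf_genInv hν.continuous_cdf (gaussCDF_mem_Ioo z)

lemma transport_le_iff (hν : IsHalfLineDensity ν h) {z y : ℝ} :
    transport h z ≤ y ↔ gaussCDF z ≤ cdfOf h y := by
  rw [transport, hν.cdfOf_eq_cdf]
  exact genInv_cdf_le_iff hν.continuous_cdf (gaussCDF_mem_Ioo z)

lemma transport_mem_cdfSupport (hν : IsHalfLineDensity ν h) (z : ℝ) :
    transport h z ∈ cdfSupport h := by
  rw [cdfSupport, Set.mem_ofPred_eq, hν.cdfOf_transport]
  exact gaussCDF_mem_Ioo z

lemma cotransport_transport (hν : IsHalfLineDensity ν h) (z : ℝ) :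
    cotransport h (transport h z) = z := by
  rw [cotransport, hν.cdfOf_transport, genInv_gaussCDF]

lemma transport_le_iff_le_cotransport (hν : IsHalfLineDensity ν h) {z y : ℝ}
    (hy : y ∈ cdfSupport h) : transport h z ≤ y ↔ z ≤ cotransport h y := by
  rw [hν.transport_le_iff, ← gaussCDF_cotransport hy, strictMono_gaussCDF.le_iff_le]

lemma transport_preimage_Ioc (hν : IsHalfLineDensity ν h) {a b : ℝ} (ha : a ∈ cdfSupport h)
    (hb : b ∈ cdfSupport h) :
    transport h ⁻¹' Set.Ioc a b = Set.Ioc (cotransport h a) (cotransport h b) := by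
  ext z
  simp only [Set.mem_preimage, Set.mem_Ioc, ← not_le, hν.transport_le_iff_le_cotransport ha,
    hν.transport_le_iff_le_cotransport hb]

lemma measurable_transport (hν : IsHalfLineDensity ν h) : Measurable (transport h) := by
  refine measurable_of_Iic fun y => ?_
  have hpreimage : transport h ⁻¹' Set.Iic y = {z | gaussCDF z ≤ cdfOf h y} :=
    Set.ext fun _ => hν.transport_le_iff
  rw [hpreimage]
  exact measurableSet_le strictMono_gaussCDF.monotone.measurable measurable_const

lemma measurableEmbedding_transport (hν : IsHalfLineDensity ν h) :
    MeasurableEmbedding (transport h) :=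
  hν.measurable_transport.measurableEmbedding
    (Function.LeftInverse.injective hν.cotransport_transport)

lemma measurePreserving_transport (hν : IsHalfLineDensity ν h) :
    MeasurePreserving (transport h) γ ν := by
  have hm := hν.measurable_transport
  have := Measure.isProbabilityMeasure_map (μ := γ) hm.aemeasurable
  refine ⟨hm, Measure.eq_of_cdf _ _ (StieltjesFunction.ext fun y => ?_)⟩
  have hpreimage : transport h ⁻¹' Set.Iic y = {z | gaussCDF z ≤ cdf ν y} :=
    Set.ext fun _ => hν.cdfOf_eq_cdf ▸ hν.transport_le_iff
  rw [cdf_eq_real, map_measureReal_apply hm measurableSet_Iic, hpreimage,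
    measureReal_setOf_gaussCDF_le ⟨cdf_nonneg ν y, cdf_le_one ν y⟩]

lemma ae_iff_transport (hν : IsHalfLineDensity ν h) {P : ℝ → Prop} :
    (∀ᵐ y ∂ν, P y) ↔ ∀ᵐ z ∂γ, P (transport h z) := by
  rw [← hν.measurePreserving_transport.map_eq, hν.measurableEmbedding_transport.ae_map_iff]

lemma ae_mem_cdfSupport (hν : IsHalfLineDensity ν h) : ∀ᵐ y ∂ν, y ∈ cdfSupport h :=
  hν.ae_iff_transport.2 (.of_forall hν.transport_mem_cdfSupport)

lemma isOpen_cdfSupport (hν : IsHalfLineDensity ν h) : IsOpen (cdfSupport h) := by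
  rw [cdfSupport, hν.cdfOf_eq_cdf]
  exact isOpen_Ioo.preimage hν.continuous_cdf

lemma ordConnected_cdfSupport (hν : IsHalfLineDensity ν h) : (cdfSupport h).OrdConnected := by
  rw [cdfSupport, hν.cdfOf_eq_cdf]
  exact Set.ordConnected_Ioo.preimage_mono (monotone_cdf ν)

lemma integrableOn_cotransportDeriv_iff (hν : IsHalfLineDensity ν h) {A : Set ℝ}
    (hA : MeasurableSet A) {w : ℝ → ℝ} :
    IntegrableOn (cotransportDeriv h w) A ↔ IntegrableOn w (transport h ⁻¹' A) := by
  unfold cotransportDeriv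
  rw [← hν.integrableOn_iff hA, ← hν.measurePreserving_transport.integrableOn_comp_preimage
    hν.measurableEmbedding_transport,
    isDensity_gaussDensity.integrableOn_iff (hν.measurable_transport hA)]
  simp only [Function.comp_apply, hν.cotransport_transport,
    div_mul_cancel₀ _ (gaussDensity_pos _).ne']

lemma setIntegral_cotransportDeriv (hν : IsHalfLineDensity ν h) {A : Set ℝ}
    (hA : MeasurableSet A) (w : ℝ → ℝ) :
    ∫ y in A, cotransportDeriv h w y = ∫ z in transport h ⁻¹' A, w z := by
  unfold cotransportDeriv
  rw [← hν.setIntegral_eq hA, ← hν.measurePreserving_transport.setIntegral_preimage_emb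
    hν.measurableEmbedding_transport,
    isDensity_gaussDensity.setIntegral_eq (hν.measurable_transport hA)]
  simp only [hν.cotransport_transport, div_mul_cancel₀ _ (gaussDensity_pos _).ne']

lemma locallyIntegrableOn_cotransportDeriv (hν : IsHalfLineDensity ν h) {w : ℝ → ℝ}
    (hw : LocallyIntegrable w) : LocallyIntegrableOn (cotransportDeriv h w) (cdfSupport h) := by
  intro x hx
  obtain ⟨a, ha, b, hb, -, hsub⟩ := exists_subset_Ioo_of_isCompact hν.isOpen_cdfSupport ⟨x, hx⟩
    isCompact_singleton (Set.singleton_subset_iff.2 hx)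
  have hxab : x ∈ Set.Ioo a b := hsub rfl
  refine ⟨Set.Ioc a b, mem_nhdsWithin_of_mem_nhds (Ioc_mem_nhds hxab.1 hxab.2), ?_⟩
  rw [hν.integrableOn_cotransportDeriv_iff measurableSet_Ioc, hν.transport_preimage_Ioc ha hb]
  exact (hw.integrableOn_isCompact isCompact_Icc).mono_set Set.Ioc_subset_Icc_self

lemma hasWeakDerivOn_cotransport (hν : IsHalfLineDensity ν h) {w : ℝ → ℝ}
    (hw : LocallyIntegrable w) (c : ℝ) :
    HasWeakDerivOn (cdfSupport h) (fun y => c + ∫ r in (0 : ℝ)..cotransport h y, w r)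
      (cotransportDeriv h w) := by
  refine hasWeakDerivOn_of_forall_sub_eq_integral hν.isOpen_cdfSupport hν.ordConnected_cdfSupport
    (hν.locallyIntegrableOn_cotransportDeriv hw) fun a ha b hb => ?_
  have hint (s t : ℝ) : IntervalIntegrable w volume s t :=
    (hw.integrableOn_isCompact isCompact_uIcc).intervalIntegrable
  rw [add_sub_add_left_eq_sub, intervalIntegral.integral_interval_sub_left (hint _ _) (hint _ _),
    intervalIntegral, intervalIntegral, hν.setIntegral_cotransportDeriv measurableSet_Ioc,
    hν.setIntegral_cotransportDeriv measurableSet_Ioc, hν.transport_preimage_Ioc ha hb,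
    hν.transport_preimage_Ioc hb ha]

lemma measurable_weight_comp_transport (hν : IsHalfLineDensity ν h) :
    Measurable (weight h ∘ transport h) := by
  have hweight : weight h ∘ transport h = fun z => gaussDensity z / h (transport h z) :=
    funext fun z => by rw [Function.comp_apply, weight, ← cotransport, hν.cotransport_transport]
  rw [hweight]
  exact isDensity_gaussDensity.measurable.div (hν.measurable.comp hν.measurable_transport)

lemma weight_mul_ae_eq (hν : IsHalfLineDensity ν h) {u v w : ℝ → ℝ} (hw : LocallyIntegrable w)
    (huv : HasWeakDerivOn (cdfSupport h) u v) {c : ℝ}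
    (hu : u =ᵐ[ν] fun y => c + ∫ r in (0 : ℝ)..cotransport h y, w r) :
    ∀ᵐ y ∂ν, weight h y * v y = w (cotransport h y) := by
  have hzero := hν.absolutelyContinuous.ae_le
    ((huv.sub (hν.hasWeakDerivOn_cotransport hw c)).ae_eq_zero hν.isOpen_cdfSupport
      hν.ordConnected_cdfSupport)
  filter_upwards [hzero, hν.ae_mem_cdfSupport, hν.ae_pos, hu] with y hzero hy hpos hu
  have hv : v y = cotransportDeriv h w y := sub_eq_zero.1 (hzero hy (sub_eq_zero.2 hu))
  have hgauss := gaussDensity_pos (cotransport h y)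
  rw [hv, weight, ← cotransport, cotransportDeriv]
  field_simp

end IsHalfLineDensity

/-! ### Transport of the real coordinates -/

/-- The map `T` applied to each real coordinate of a configuration. -/
def mapReals {S : Type*} (T : ℝ → ℝ) (ω : (S → Bool) × (ℕ → ℝ)) : (S → Bool) × (ℕ → ℝ) :=
  (ω.1, fun i => T (ω.2 i))

section MapReals

variable {S : Type*} {p : unitInterval} {T : ℝ → ℝ} {f : (S → Bool) × (ℕ → ℝ) → ℝ}

lemma mapReals_update (T : ℝ → ℝ) (ω : (S → Bool) × (ℕ → ℝ)) (i : ℕ) (t : ℝ) :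
    mapReals T (ω.1, Function.update ω.2 i t) =
      ((mapReals T ω).1, Function.update (mapReals T ω).2 i (T t)) :=
  Prod.ext rfl (funext fun j => Function.apply_update (fun _ => T) ω.2 i t j)

lemma realSlice_mapReals (f : (S → Bool) × (ℕ → ℝ) → ℝ) (T : ℝ → ℝ) (i : ℕ)
    (ω : (S → Bool) × (ℕ → ℝ)) (t : ℝ) :
    realSlice f i (mapReals T ω) (T t) = realSlice (f ∘ mapReals T) i ω t := by
  simp only [realSlice, Function.comp_apply, mapReals_update]

lemma measurable_mapReals (hT : Measurable T) : Measurable (mapReals (S := S) T) := by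
  unfold mapReals
  fun_prop

lemma measurableEmbedding_mapReals [Countable S] (hT : MeasurableEmbedding T) :
    MeasurableEmbedding (mapReals (S := S) T) :=
  (measurable_mapReals hT.measurable).measurableEmbedding fun _ _ hω =>
    Prod.ext (congrArg Prod.fst hω :)
      (funext fun i => hT.injective (congrFun (congrArg Prod.snd hω) i :))

variable {μ ν : Measure ℝ}

lemma deltaReal_mapReals (hT : MeasurePreserving T μ ν) (hT_emb : MeasurableEmbedding T) (i : ℕ)
    (ω : (S → Bool) × (ℕ → ℝ)) :
    deltaReal ν f i (mapReals T ω) = deltaReal μ (f ∘ mapReals T) i ω := by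
  simp only [deltaReal, ← realSlice_mapReals, Function.comp_apply, hT.integral_comp hT_emb]

variable [IsProbabilityMeasure μ]

lemma measurePreserving_mapReals (hT : MeasurePreserving T μ ν) :
    MeasurePreserving (mapReals T) (mixedProduct S p μ) (mixedProduct S p ν) := by
  have hreals : MeasurePreserving (fun (z : ℕ → ℝ) i => T (z i))
      (Measure.infinitePi fun _ => μ) (Measure.infinitePi fun _ => ν) := by
    refine ⟨measurable_pi_lambda _ fun i => hT.measurable.comp (measurable_pi_apply i), ?_⟩
    simp only [Measure.infinitePi_map_pi (fun _ : ℕ => μ) fun _ => hT.measurable, hT.map_eq]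
  exact (MeasurePreserving.id (bernoulliPi S p)).prod hreals

variable [Countable S]

lemma evariance_comp_mapReals (hT : MeasurePreserving T μ ν) (hT_emb : MeasurableEmbedding T) :
    evariance (f ∘ mapReals T) (mixedProduct S p μ) = evariance f (mixedProduct S p ν) := by
  have hpres := measurePreserving_mapReals (S := S) (p := p) hT
  have hemb := measurableEmbedding_mapReals (S := S) hT_emb
  simp only [evariance, Function.comp_apply, hpres.integral_comp hemb,
    hpres.lintegral_comp_emb hemb fun ω => ‖f ω - ∫ ω', f ω' ∂(mixedProduct S p ν)‖ₑ ^ 2]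

lemma sumInfluences_comp_mapReals [DecidableEq S] (hT : MeasurePreserving T μ ν)
    (hT_emb : MeasurableEmbedding T) :
    sumInfluences p μ (f ∘ mapReals T) = sumInfluences p ν f := by
  have hlintegral := (measurePreserving_mapReals (S := S) (p := p) hT).lintegral_comp_emb
    (measurableEmbedding_mapReals hT_emb)
  simp only [sumInfluences, ← hlintegral, deltaReal_mapReals hT hT_emb]
  rfl

end MapReals

namespace IsHalfLineDensity

variable {S : Type*} {p : unitInterval} {ν : Measure ℝ} [IsProbabilityMeasure ν] {h : ℝ → ℝ}
  {f D E : (S → Bool) × (ℕ → ℝ) → ℝ} {i : ℕ}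

lemma realSlice_ae_eq_cotransport (hν : IsHalfLineDensity ν h) {ω : (S → Bool) × (ℕ → ℝ)}
    {U : ℝ → ℝ} (hU : ∀ᵐ z ∂γ, realSlice (f ∘ mapReals (transport h)) i ω z = U z) :
    realSlice f i (mapReals (transport h) ω) =ᵐ[ν] fun y => U (cotransport h y) := by
  rw [EventuallyEq, hν.ae_iff_transport]
  filter_upwards [hU] with z hz
  rw [realSlice_mapReals, hz, hν.cotransport_transport]

lemma mapReals_cotransport_transport (hν : IsHalfLineDensity ν h) (ω : (S → Bool) × (ℕ → ℝ)) :
    mapReals (cotransport h) (mapReals (transport h) ω) = ω := by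
  simp only [mapReals, hν.cotransport_transport]

variable [Countable S]

lemma ae_mixedProduct_iff (hν : IsHalfLineDensity ν h) {P : (S → Bool) × (ℕ → ℝ) → Prop} :
    (∀ᵐ ω ∂(mixedProduct S p ν), P ω) ↔
      ∀ᵐ ω ∂(mixedProduct S p γ), P (mapReals (transport h) ω) := by
  rw [← (measurePreserving_mapReals hν.measurePreserving_transport).map_eq,
    (measurableEmbedding_mapReals hν.measurableEmbedding_transport).ae_map_iff]

lemma aestronglyMeasurable_comp_iff (hν : IsHalfLineDensity ν h) :
    AEStronglyMeasurable (f ∘ mapReals (transport h)) (mixedProduct S p γ) ↔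
      AEStronglyMeasurable f (mixedProduct S p ν) :=
  (measurePreserving_mapReals hν.measurePreserving_transport).aestronglyMeasurable_comp_iff
    (measurableEmbedding_mapReals hν.measurableEmbedding_transport)

lemma memLp_comp_iff (hν : IsHalfLineDensity ν h) {q : ℝ≥0∞} :
    MemLp (f ∘ mapReals (transport h)) q (mixedProduct S p γ) ↔
      MemLp f q (mixedProduct S p ν) := by
  rw [← (measurePreserving_mapReals hν.measurePreserving_transport).map_eq,
    (measurableEmbedding_mapReals hν.measurableEmbedding_transport).memLp_map_measure_iff]

theorem exists_isPartialDeriv (hν : IsHalfLineDensity ν h) (hE : Measurable E)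
    (hfE : HasPrimitiveSlices p i (f ∘ mapReals (transport h)) E) :
    ∃ D : (S → Bool) × (ℕ → ℝ) → ℝ, IsPartialDeriv p ν h f i D := by
  refine ⟨fun ω => cotransportDeriv h (realSlice E i (mapReals (cotransport h) ω)) (ω.2 i),
    hν.aestronglyMeasurable_comp_iff.1 ?_, hν.ae_mixedProduct_iff.2 ?_⟩
  · have hh := hν.measurable
    have htransport := hν.measurable_transport
    have hgauss := isDensity_gaussDensity.measurable
    have hmeas : Measurable fun ω : (S → Bool) × (ℕ → ℝ) =>
        E ω / gaussDensity (ω.2 i) * h (transport h (ω.2 i)) := by fun_prop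
    refine hmeas.aestronglyMeasurable.congr (.of_forall fun ω => ?_)
    simp only [Function.comp_apply, hν.mapReals_cotransport_transport, cotransportDeriv]
    simp only [mapReals, hν.cotransport_transport, realSlice, Function.update_eq_self]
  · filter_upwards [hfE] with ω ⟨hloc, c, hc⟩
    refine ⟨_, _, hν.hasWeakDerivOn_cotransport hloc c, hν.realSlice_ae_eq_cotransport hc,
      .of_forall fun y => ?_⟩
    simp only [realSlice, cotransportDeriv, mapReals_update, hν.mapReals_cotransport_transport,
      Function.update_idem, Function.update_self]

lemma weightedGrad_ae_eq (hν : IsHalfLineDensity ν h) {D : ℕ → (S → Bool) × (ℕ → ℝ) → ℝ}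
    (hD : IsPartialDeriv p ν h f i (D i)) (hE : Measurable E)
    (hfE : HasPrimitiveSlices p i (f ∘ mapReals (transport h)) E) :
    weightedGrad h D i ∘ mapReals (transport h) =ᵐ[mixedProduct S p γ] E := by
  refine ae_eq_of_realSlice_ae_eq i ?_ hE.aestronglyMeasurable ?_
  · have hweight := hν.measurable_weight_comp_transport
    exact (hweight.comp (by fun_prop : Measurable fun ω : (S → Bool) × (ℕ → ℝ) =>
      ω.2 i)).aestronglyMeasurable.mul (hν.aestronglyMeasurable_comp_iff.2 hD.1)
  · filter_upwards [hfE, hν.ae_mixedProduct_iff.1 hD.2] with ω ⟨hloc, c, hc⟩ ⟨u, v, huv, hu, hv⟩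
    have hu_primitive := hu.symm.trans (hν.realSlice_ae_eq_cotransport hc)
    filter_upwards [hν.ae_iff_transport.1 (hν.weight_mul_ae_eq hloc huv hu_primitive),
      hν.ae_iff_transport.1 hv] with z hweight hv
    rw [← realSlice_mapReals, ← hν.cotransport_transport z]
    rw [hν.cotransport_transport z, ← hv] at hweight
    simpa only [hν.cotransport_transport, realSlice, weightedGrad, Function.update_self]
      using hweight

lemma energy_eq [DecidableEq S] (hν : IsHalfLineDensity ν h)
    {D E : ℕ → (S → Bool) × (ℕ → ℝ) → ℝ}
    (hDE : ∀ i, weightedGrad h D i ∘ mapReals (transport h) =ᵐ[mixedProduct S p γ] E i) :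
    energy p ν h f D =
      ENNReal.ofReal (cLS p) * ∑' s : S, ∫⁻ ω, ‖deltaBit p (f ∘ mapReals (transport h)) s ω‖ₑ ^ 2
        ∂(mixedProduct S p γ) + 2 * ∑' i : ℕ, ∫⁻ ω, ‖E i ω‖ₑ ^ 2 ∂(mixedProduct S p γ) := by
  have hlintegral :=
    (measurePreserving_mapReals (S := S) (p := p) hν.measurePreserving_transport).lintegral_comp_emb
    (measurableEmbedding_mapReals hν.measurableEmbedding_transport)
  have hgrad (i : ℕ) := lintegral_congr_ae ((hDE i).fun_comp (‖·‖ₑ ^ 2))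
  simp only [Function.comp_apply] at hgrad
  simp only [energy, ← hlintegral, hgrad]
  rfl

end IsHalfLineDensity

end ModifiedPoincare

theorem mainTheorem10 {S : Type*} [Countable S] [DecidableEq S]
    (p : unitInterval) (hp0 : 0 < (p : ℝ)) (hp1 : (p : ℝ) < 1)
    (ν : Measure ℝ) [IsProbabilityMeasure ν] (hν : ν (Set.Iio 0) = 0)
    (h : ℝ → ℝ) (h_meas : Measurable h) (h_nonneg : ∀ t, 0 ≤ h t)
    (hνh : ν = volume.withDensity (fun t => ENNReal.ofReal (h t)))
    (f : (S → Bool) × (ℕ → ℝ) → ℝ)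
    (hf : MemGaussSobolev p
      (fun ω : (S → Bool) × (ℕ → ℝ) => f (ω.1, fun i => transport h (ω.2 i)))) :
    MemLp f 2 (mixedProduct S p ν) ∧
    (∀ i : ℕ, ∃ D : (S → Bool) × (ℕ → ℝ) → ℝ, IsPartialDeriv p ν h f i D) ∧
    ∀ D : ℕ → (S → Bool) × (ℕ → ℝ) → ℝ, (∀ i : ℕ, IsPartialDeriv p ν h f i (D i)) →
      (∀ i : ℕ, MemLp (weightedGrad h D i) 2 (mixedProduct S p ν)) ∧
      (evariance f (mixedProduct S p ν) : EReal) *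
          ENNReal.log (evariance f (mixedProduct S p ν) / sumInfluences p ν f) ≤
        (energy p ν h f D : EReal) := by
  have hden : IsHalfLineDensity ν h := ⟨⟨h_meas, h_nonneg, hνh⟩, hν⟩
  change MemGaussSobolev p (f ∘ mapReals (transport h)) at hf
  choose E hE hfE using hf.exists_hasPrimitiveSlices
  refine ⟨hden.memLp_comp_iff.1 hf.1,
    fun i => hden.exists_isPartialDeriv (hE i).measurable (hfE i), fun D hD => ?_⟩
  have hgrad (i : ℕ) := hden.weightedGrad_ae_eq (hD i) (hE i).measurable (hfE i)
  refine ⟨fun i => hden.memLp_comp_iff.1 ((hE i).memLp.ae_eq (hgrad i).symm), ?_⟩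
  rw [← evariance_comp_mapReals hden.measurePreserving_transport hden.measurableEmbedding_transport,
    ← sumInfluences_comp_mapReals hden.measurePreserving_transport
      hden.measurableEmbedding_transport, hden.energy_eq hgrad]
  exact HasPrimitiveSlices.modified_poincare hp0 hp1 hf.1 hE hfE
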